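/- **Conventions.** A polygonal curve with $n\ge 1$ vertices $p_0,\dots,p_{n-1}\in\mathbb R^d$ is the map $P:[0,n-1]\to\mathbb R^d$ with $P(i+t)=(1-t)p_i+t\,p_{i+1}$ for $0\le t\le 1$; a subcurve is $P[a,b]=P|_{[a,b]}$ with $0\le a\le b\le n-1$ (a single point if $a=b$), and inclusion of subcurves means inclusion of parameter intervals. The Fréchet distance of $f$ on $[a,b]$ and $g$ on $[a',b']$ is $\delta_F=\inf_{\sigma,\theta}\max_{t\in[0,1]}\|f(\sigma(t))-g(\theta(t))\|$ over continuous non-decreasing $\sigma:[0,1]\to[a,b]$, $\theta:[0,1]\to[a',b']$ that map $0,1$ to the respective end points. The model of computation is the unit-cost real RAM: cells hold integers or real numbers, and arithmetic operations (including square roots and the floor function), indirect memory accesses, comparisons and assignments take one unit of time each; the size of a data structure is the number of cells it occupies. **Theorem.** Let $d\ge 1$ be a constant. There are a constant $C>0$, a construction program and a query program, all depending only on $d$, with the following property. Let $n,k\ge 1$, let $P$ be a polygonal curve with $n$ vertices in $\mathbb R^d$, let $\mathcal D$ be the diameter of its vertex set, let $\delta>0$ and $0<\varepsilon\le\min\{1,\delta\}$,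 and put $$B=C^{kd}\cdot\max\Big\{\Big(\frac1\varepsilon\Big)^{kd},\Big(\frac{\mathcal D}{\varepsilon^2}\Big)^{kd}\Big\}.$$ Given $P,k,\delta,\varepsilon$, the construction program halts after at most $n\,k\,B$ units of time and leaves a data structure of size at most $n\,B$. Given only this data structure and any polygonal curve $Q$ with $k$ vertices in $\mathbb R^d$, the query program reports a set $R$ of subcurves of $P$ such that 1. every $P'\in R$ satisfies $\delta_F(P',Q)\le(1+\varepsilon)\delta$; 2. every subcurve $P'$ of $P$ with $\delta_F(P',Q)\le\delta$ contains a member of $R$ (so $\delta_F(P',Q)>\delta$ for every subcurve $P'$ that contains no reported one); 3. for some polygonal curve $\widetilde Q$ with $k$ vertices and $\delta_F(\widetilde Q,Q)\le\varepsilon\delta/2$, $R$ is exactly the set of inclusion-minimal subcurves among the subcurves $P'$ of $P$ with $\delta_F(P',\widetilde Q)\le(1+\varepsilon/2)\delta$. The set $R$ is written as a list of $r$ records, with the number $r$. Each record is non-void and stands either for one subcurve $P[u,v]$ or for all one-point subcurves $P[s,s]$, $s\in[u,v]$, and no subcurve belongs to two records. The query takes at most $C\,(k+r)$ units of time, that is,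 $O(k)$ time apart from the output of the $r$ records. -/

import Mathlib

/-! ### Polygonal curves, subcurves and the Fréchet distance -/

/-- `vertex p i` is the `i`-th vertex (counted from `0`) of the vertex sequence `p`. The value for
`n ≤ i` is irrelevant. -/
noncomputable def vertex {n d : ℕ} (p : Fin n → EuclideanSpace ℝ (Fin d)) (i : ℕ) :
    EuclideanSpace ℝ (Fin d) :=
  if h : i < n then p ⟨i, h⟩ else 0

/-- The polygonal curve with vertices `p 0, …, p (n - 1)`, as a map on the parameter interval
`[0, n - 1]`: `curve p (i + t) = (1 - t) p_i + t p_{i+1}` for `0 ≤ t < 1`. -/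
noncomputable def curve {n d : ℕ} (p : Fin n → EuclideanSpace ℝ (Fin d)) (s : ℝ) :
    EuclideanSpace ℝ (Fin d) :=
  (1 - Int.fract s) • vertex p ⌊s⌋₊ + Int.fract s • vertex p (⌊s⌋₊ + 1)

/-- The Fréchet distance between `f` on `[a, b]` and `g` on `[a', b']`: the infimum of
`max_{t ∈ [0,1]} ‖f (σ t) - g (θ t)‖` over continuous non-decreasing `σ` from `[0, 1]` to `[a, b]`
and `θ` from `[0, 1]` to `[a', b']` that respect the end points. -/
noncomputable def frechetDist {d : ℕ} (f : ℝ → EuclideanSpace ℝ (Fin d)) (a b : ℝ)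
    (g : ℝ → EuclideanSpace ℝ (Fin d)) (a' b' : ℝ) : ℝ :=
  sInf {r : ℝ | ∃ σ θ : ℝ → ℝ,
    ContinuousOn σ (Set.Icc 0 1) ∧ MonotoneOn σ (Set.Icc 0 1) ∧ σ 0 = a ∧ σ 1 = b ∧
    ContinuousOn θ (Set.Icc 0 1) ∧ MonotoneOn θ (Set.Icc 0 1) ∧ θ 0 = a' ∧ θ 1 = b' ∧
    ∀ t ∈ Set.Icc (0 : ℝ) 1, ‖f (σ t) - g (θ t)‖ ≤ r}

/-- The Fréchet distance between two polygonal curves. -/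
noncomputable def polyFrechet {n k d : ℕ} (p : Fin n → EuclideanSpace ℝ (Fin d))
    (q : Fin k → EuclideanSpace ℝ (Fin d)) : ℝ :=
  frechetDist (curve p) 0 ((n : ℝ) - 1) (curve q) 0 ((k : ℝ) - 1)

/-- The pair `x = (a, b)` of parameters describes a subcurve of a curve with `n` vertices, the
restriction to `[a, b]` (a single point of the curve if `a = b`). -/
def IsSubcurve (n : ℕ) (x : ℝ × ℝ) : Prop :=
  0 ≤ x.1 ∧ x.1 ≤ x.2 ∧ x.2 ≤ (n : ℝ) - 1

/-- The Fréchet distance between the subcurve `x` of `p` and the whole curve `q`. -/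
noncomputable def subFrechet {n k d : ℕ} (p : Fin n → EuclideanSpace ℝ (Fin d)) (x : ℝ × ℝ)
    (q : Fin k → EuclideanSpace ℝ (Fin d)) : ℝ :=
  frechetDist (curve p) x.1 x.2 (curve q) 0 ((k : ℝ) - 1)

/-- `x` is an inclusion-minimal subcurve of `p` among those at Fréchet distance at most `ρ`
from `q`. -/
def IsInclusionMinimal {n k d : ℕ} (p : Fin n → EuclideanSpace ℝ (Fin d))
    (q : Fin k → EuclideanSpace ℝ (Fin d)) (ρ : ℝ) (x : ℝ × ℝ) : Prop :=
  IsSubcurve n x ∧ subFrechet p x q ≤ ρ ∧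
    ∀ y : ℝ × ℝ, IsSubcurve n y → x.1 ≤ y.1 → y.2 ≤ x.2 → subFrechet p y q ≤ ρ → y = x

/-- The set `R` of subcurves answers a `(1 + ε) δ` approximate subtrajectory range searching
query: reported subcurves are at distance at most `(1 + ε) δ` from `q`; a subcurve that contains
no reported one is at distance more than `δ`; and the reported subcurves are exactly the
inclusion-minimal subcurves at distance at most `(1 + ε / 2) δ` from a curve `c` with `k` vertices
that lies within distance `ε δ / 2` of `q`. -/
structure IsASRSAnswer {n k d : ℕ} (p : Fin n → EuclideanSpace ℝ (Fin d)) (δ ε : ℝ)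
    (q : Fin k → EuclideanSpace ℝ (Fin d)) (R : Set (ℝ × ℝ)) : Prop where
  sound : ∀ x ∈ R, IsSubcurve n x ∧ subFrechet p x q ≤ (1 + ε) * δ
  complete : ∀ y : ℝ × ℝ, IsSubcurve n y → subFrechet p y q ≤ δ →
    ∃ x ∈ R, y.1 ≤ x.1 ∧ x.2 ≤ y.2
  minimal : ∃ c : Fin k → EuclideanSpace ℝ (Fin d), polyFrechet c q ≤ ε * δ / 2 ∧
    R = {x | IsInclusionMinimal p c ((1 + ε / 2) * δ) x}

/-! ### A real RAM with unit cost

The memory consists of four banks. Each bank is an array of integer cells and an array of real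
cells. The machine runs structured programs; every arithmetic operation (including square root
and floor), memory access, comparison and assignment costs one unit of time. -/

/-- The memory banks: input, data structure, output, and working space. -/
inductive Bank where
  | inp
  | ds
  | out
  | wrk

/-- The contents of one bank. -/
structure Store where
  int : ℕ → ℤ
  real : ℕ → ℝ

/-- A bank all of whose cells hold `0`. -/
def Store.empty : Store := ⟨fun _ => 0, fun _ => 0⟩

/-- The contents of the whole memory. -/
abbrev Memory := Bank → Store

/-- The two types of values. -/
inductive Ty where
  | int
  | real

/-- The values of each type. -/
@[reducible] def Ty.Val : Ty → Type
  | .int => ℤ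
  | .real => ℝ

/-- Expressions. The address in a memory access is an integer expression. -/
inductive Exp : Ty → Type where
  | litI : ℤ → Exp .int
  | litR : ℚ → Exp .real
  | getI : Bank → Exp .int → Exp .int
  | getR : Bank → Exp .int → Exp .real
  | addI : Exp .int → Exp .int → Exp .int
  | subI : Exp .int → Exp .int → Exp .int
  | mulI : Exp .int → Exp .int → Exp .int
  | divI : Exp .int → Exp .int → Exp .int
  | addR : Exp .real → Exp .real → Exp .real
  | subR : Exp .real → Exp .real → Exp .real
  | mulR : Exp .real → Exp .real → Exp .real
  | divR : Exp .real → Exp .real → Exp .real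
  | sqrt : Exp .real → Exp .real
  | ofInt : Exp .int → Exp .real
  | floor : Exp .real → Exp .int

/-- The value of an expression. Division by zero and the square root of a negative number
give `0`; a negative address is read as `0`. -/
noncomputable def Exp.eval (m : Memory) : {τ : Ty} → Exp τ → τ.Val
  | _, .litI z => z
  | _, .litR c => (c : ℝ)
  | _, .getI B a => (m B).int (a.eval m).toNat
  | _, .getR B a => (m B).real (a.eval m).toNat
  | _, .addI x y => x.eval m + y.eval m
  | _, .subI x y => x.eval m - y.eval m
  | _, .mulI x y => x.eval m * y.eval m
  | _, .divI x y => x.eval m / y.eval m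
  | _, .addR x y => x.eval m + y.eval m
  | _, .subR x y => x.eval m - y.eval m
  | _, .mulR x y => x.eval m * y.eval m
  | _, .divR x y => x.eval m / y.eval m
  | _, .sqrt x => Real.sqrt (x.eval m)
  | _, .ofInt x => ((x.eval m : ℤ) : ℝ)
  | _, .floor x => ⌊(x.eval m : ℝ)⌋

/-- The time for evaluating an expression: the number of its nodes. -/
def Exp.cost : {τ : Ty} → Exp τ → ℕ
  | _, .litI _ => 1
  | _, .litR _ => 1
  | _, .getI _ a => a.cost + 1
  | _, .getR _ a => a.cost + 1
  | _, .addI x y => x.cost + y.cost + 1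
  | _, .subI x y => x.cost + y.cost + 1
  | _, .mulI x y => x.cost + y.cost + 1
  | _, .divI x y => x.cost + y.cost + 1
  | _, .addR x y => x.cost + y.cost + 1
  | _, .subR x y => x.cost + y.cost + 1
  | _, .mulR x y => x.cost + y.cost + 1
  | _, .divR x y => x.cost + y.cost + 1
  | _, .sqrt x => x.cost + 1
  | _, .ofInt x => x.cost + 1
  | _, .floor x => x.cost + 1

/-- Comparisons. -/
inductive Test where
  | leI : Exp .int → Exp .int → Test
  | ltI : Exp .int → Exp .int → Test
  | leR : Exp .real → Exp .real → Test
  | ltR : Exp .real → Exp .real → Test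

/-- The truth value of a comparison. -/
def Test.Holds (m : Memory) : Test → Prop
  | .leI x y => x.eval m ≤ y.eval m
  | .ltI x y => x.eval m < y.eval m
  | .leR x y => x.eval m ≤ y.eval m
  | .ltR x y => x.eval m < y.eval m

/-- The time for a comparison. -/
def Test.cost : Test → ℕ
  | .leI x y => x.cost + y.cost + 1
  | .ltI x y => x.cost + y.cost + 1
  | .leR x y => x.cost + y.cost + 1
  | .ltR x y => x.cost + y.cost + 1

/-- Programs. `setI B a x` writes the value of `x` to the integer cell of bank `B` with
address `a`, and `setR` does the same for real cells. -/
inductive Program where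
  | skip : Program
  | setI : Bank → Exp .int → Exp .int → Program
  | setR : Bank → Exp .int → Exp .real → Program
  | seq : Program → Program → Program
  | branch : Test → Program → Program → Program
  | loop : Test → Program → Program

open Classical in
/-- Write the integer `z` to the cell `i` of bank `B`. -/
noncomputable def Memory.writeI (m : Memory) (B : Bank) (i : ℕ) (z : ℤ) : Memory :=
  Function.update m B ⟨Function.update (m B).int i z, (m B).real⟩

open Classical in
/-- Write the real number `x` to the cell `i` of bank `B`. -/
noncomputable def Memory.writeR (m : Memory) (B : Bank) (i : ℕ) (x : ℝ) : Memory :=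
  Function.update m B ⟨(m B).int, Function.update (m B).real i x⟩

/-- `Runs P m t m'`: started with memory `m`, the program `P` halts after `t` units of time
with memory `m'`. -/
inductive Runs : Program → Memory → ℕ → Memory → Prop where
  | skip (m : Memory) : Runs .skip m 1 m
  | setI (m : Memory) (B : Bank) (a : Exp .int) (x : Exp .int) :
      Runs (.setI B a x) m (a.cost + x.cost + 1) (m.writeI B (a.eval m).toNat (x.eval m))
  | setR (m : Memory) (B : Bank) (a : Exp .int) (x : Exp .real) :
      Runs (.setR B a x) m (a.cost + x.cost + 1) (m.writeR B (a.eval m).toNat (x.eval m))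
  | seq {P₁ P₂ : Program} {m₀ m₁ m₂ : Memory} {t₁ t₂ : ℕ} :
      Runs P₁ m₀ t₁ m₁ → Runs P₂ m₁ t₂ m₂ → Runs (.seq P₁ P₂) m₀ (t₁ + t₂) m₂
  | branch_true {b : Test} {P₁ P₂ : Program} {m m' : Memory} {t : ℕ} :
      b.Holds m → Runs P₁ m t m' → Runs (.branch b P₁ P₂) m (b.cost + t) m'
  | branch_false {b : Test} {P₁ P₂ : Program} {m m' : Memory} {t : ℕ} :
      ¬ b.Holds m → Runs P₂ m t m' → Runs (.branch b P₁ P₂) m (b.cost + t) m'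
  | loop_stop {b : Test} {P : Program} {m : Memory} :
      ¬ b.Holds m → Runs (.loop b P) m b.cost m
  | loop_step {b : Test} {P : Program} {m₀ m₁ m₂ : Memory} {t₁ t₂ : ℕ} :
      b.Holds m₀ → Runs P m₀ t₁ m₁ → Runs (.loop b P) m₁ t₂ m₂ →
        Runs (.loop b P) m₀ (b.cost + t₁ + t₂) m₂

/-! ### Data structures: input, size, output -/

/-- The coordinates of the vertices of `p`, one vertex after the other: coordinate `j` of
vertex `i` is entry `i * d + j`. -/
noncomputable def coords {n d : ℕ} (p : Fin n → EuclideanSpace ℝ (Fin d)) (a : ℕ) : ℝ :=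
  if h : a < n * d then p (⟨a, h⟩ : Fin (n * d)).divNat (⟨a, h⟩ : Fin (n * d)).modNat else 0

/-- The memory at the start of the construction: the input bank holds the integers `n`, `k` and
the real numbers `δ`, `ε` followed by the coordinates of `p`; all other cells hold `0`. -/
noncomputable def constructionStart {n d : ℕ} (p : Fin n → EuclideanSpace ℝ (Fin d)) (k : ℕ)
    (δ ε : ℝ) : Memory
  | .inp =>
    ⟨fun a => if a = 0 then (n : ℤ) else if a = 1 then (k : ℤ) else 0,
      fun a => if a = 0 then δ else if a = 1 then ε else coords p (a - 2)⟩
  | .ds => Store.empty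
  | .out => Store.empty
  | .wrk => Store.empty

/-- The memory at the start of a query: the data structure `S`, and in the input bank the
integer `k` and the coordinates of `q`; all other cells hold `0`. -/
noncomputable def queryStart {k d : ℕ} (S : Store) (q : Fin k → EuclideanSpace ℝ (Fin d)) :
    Memory
  | .inp => ⟨fun a => if a = 0 then (k : ℤ) else 0, coords q⟩
  | .ds => S
  | .out => Store.empty
  | .wrk => Store.empty

/-- The data structure `S` occupies at most `N` cells: the first `a` integer cells and the first
`b` real cells, where `a + b ≤ N`. -/
def Store.SizeAtMost (S : Store) (N : ℝ) : Prop :=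
  ∃ a b : ℕ, (∀ i, a ≤ i → S.int i = 0) ∧ (∀ i, b ≤ i → S.real i = 0) ∧ (a : ℝ) + (b : ℝ) ≤ N

/-- The subcurves described by the `i`-th record of the output `O`. Real cells `2 * i` and
`2 * i + 1` hold parameters `u`, `v`. If the integer cell `i + 1` holds `0`, the record stands for
the subcurve from `u` to `v`; otherwise it stands for all one-point subcurves with parameter in
`[u, v]` (inclusion-minimal subcurves that are single points come in whole intervals). -/
def Store.record (O : Store) (i : ℕ) : Set (ℝ × ℝ) :=
  {x | (O.int (i + 1) = 0 ∧ x = (O.real (2 * i), O.real (2 * i + 1))) ∨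
    (O.int (i + 1) ≠ 0 ∧ x.1 = x.2 ∧ O.real (2 * i) ≤ x.1 ∧ x.1 ≤ O.real (2 * i + 1))}

/-- The output `O` reports the set `R` of subcurves by `r` records: integer cell `0` holds `r`,
no record is void, no subcurve is reported by two records, and together the records give `R`. -/
def Store.Reports (O : Store) (r : ℕ) (R : Set (ℝ × ℝ)) : Prop :=
  O.int 0 = (r : ℤ) ∧ (∀ i < r, (O.record i).Nonempty) ∧
    (∀ i < r, ∀ j < r, i ≠ j → Disjoint (O.record i) (O.record j)) ∧
    R = {x | ∃ i < r, x ∈ O.record i}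

/-- The quantity `C^(k d) * max {(1 / ε)^(k d), (D / ε²)^(k d)}`, where `D` is the diameter of the
vertex set of `p`. -/
noncomputable def gridBound {n d : ℕ} (p : Fin n → EuclideanSpace ℝ (Fin d)) (k : ℕ)
    (ε C : ℝ) : ℝ :=
  C ^ (k * d) *
    max ((1 / ε) ^ (k * d)) ((Metric.diam (Set.range p) / ε ^ 2) ^ (k * d))

/-! The proof rounds the query to a finite grid and tabulates the exact answer for every grid curve.
Rounding each vertex of Q down, coordinate by coordinate, to a grid of mesh εδ/(2d) moves every
vertex by at most εδ/2. By the triangle inequality, a subcurve within δ of Q is within (1+ε/2)δ of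
the rounded curve, and a subcurve within (1+ε/2)δ of the rounded curve is within (1+ε)δ of Q. Hence
the inclusion-minimal subcurves at distance at most (1+ε/2)δ from the rounded curve are a correct
answer (`isASRSAnswer_of_close`). A bounded grid suffices. Let L ≤ 𝒟 be the largest coordinate
deviation of the vertices of P from the first one. If a coordinate of Q leaves the box of half side
L+2δ around the first vertex, then, as (1+ε/2)δ < 2δ, no subcurve is feasible for Q itself, and the
empty answer is correct with Q as its own approximation (`not_feasible`). So an axis carries M ≤
13d·max(1/ε, 𝒟/ε²) grid points (`gridSide_le`), there are M^(kd) grid curves, and a query computes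
kd digits by floors and copies a list of records.

For one curve c and one radius ρ, distance at most ρ means that the free space contains a monotone
path (`frechetDist_le_iff`; the infimum is attained by compactness). Within a unit cell the free
space is convex, so only the cell boundaries matter. For each edge of P (a column) and each vertex
of c (a level), a short list of pairs (a, b) records which starts are possible: up to domination,
the points from a on are reached from starts as late as b. At the next level the old pairs are
clipped to the free interval, and just one new pair arises, from paths that enter the cell over its
left side (`ColumnOK.next`). Latest starts on the vertical cell sides are handed along the row in a
monotone queue (`QueueOK`, `Handover`) that receives at most one element per column, so its upkeep
has constant amortized cost. A row costs O(nk), and a curve O(nk²).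

At the top level there are nk pairs, already sorted by their end (`isStream_candidates`). One sweep
discards dominated pairs and merges overlapping families of one-point subcurves; what remains is
exactly the set of inclusion-minimal subcurves (`IsFront.minimal`). In particular minimal subcurves
exist below every feasible one, with no further compactness argument.

All this is carried out by concrete programs, whose time is bounded together with their effect; the
queue length serves as potential (`Program.Ends.loop`). The surplus factor k in the construction
time is absorbed by k ≤ 2^(kd) in the constant C^(kd). -/

/-! ### Loop-free programs and rules for timed execution -/

namespace Program

/-- A program without loops. -/
def LoopFree : Program → Prop
  | .skip => True
  | .setI _ _ _ => True
  | .setR _ _ _ => True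
  | .seq P Q => P.LoopFree ∧ Q.LoopFree
  | .branch _ P Q => P.LoopFree ∧ Q.LoopFree
  | .loop _ _ => False

/-- An upper bound for the running time of a loop-free program. -/
def cost : Program → ℕ
  | .skip => 1
  | .setI _ a x => a.cost + x.cost + 1
  | .setR _ a x => a.cost + x.cost + 1
  | .seq P Q => P.cost + Q.cost
  | .branch b P Q => b.cost + (P.cost + Q.cost)
  | .loop _ _ => 0

open Classical in
/-- The effect of a loop-free program. -/
noncomputable def den : Program → Memory → Memory
  | .skip, m => m
  | .setI B a x, m => m.writeI B (a.eval m).toNat (x.eval m)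
  | .setR B a x, m => m.writeR B (a.eval m).toNat (x.eval m)
  | .seq P Q, m => Q.den (P.den m)
  | .branch b P Q, m => if b.Holds m then P.den m else Q.den m
  | .loop _ _, m => m

theorem LoopFree.runs {P : Program} (h : P.LoopFree) (m : Memory) :
    ∃ t ≤ P.cost, Runs P m t (P.den m) := by
  induction P generalizing m with
  | skip => exact ⟨1, le_rfl, .skip m⟩
  | setI B a x => exact ⟨_, le_rfl, .setI m B a x⟩
  | setR B a x => exact ⟨_, le_rfl, .setR m B a x⟩
  | seq P Q hP hQ =>
    obtain ⟨t, ht, h1⟩ := hP h.1 m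
    obtain ⟨t', ht', h2⟩ := hQ h.2 (P.den m)
    exact ⟨t + t', by simp only [cost]; omega, .seq h1 h2⟩
  | branch b P Q hP hQ =>
    obtain ⟨t, ht, h1⟩ := hP h.1 m
    obtain ⟨t', ht', h2⟩ := hQ h.2 m
    by_cases hb : b.Holds m
    · exact ⟨b.cost + t, by simp only [cost]; omega, by
        simpa [den, hb] using Runs.branch_true hb h1⟩
    · exact ⟨b.cost + t', by simp only [cost]; omega, by
        simpa [den, hb] using Runs.branch_false hb h2⟩
  | loop b P => exact h.elim

/-- Started with memory `m`, the program halts, and running time and final memory satisfy `Q`. -/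
def Ends (P : Program) (m : Memory) (Q : ℕ → Memory → Prop) : Prop :=
  ∃ t m', Runs P m t m' ∧ Q t m'

/-- Started with memory `m`, the program halts after at most `T` units of time, and the final
memory satisfies `Q`. -/
def Within (P : Program) (m : Memory) (T : ℕ) (Q : Memory → Prop) : Prop :=
  P.Ends m fun t m' => t ≤ T ∧ Q m'

theorem Ends.mono {P : Program} {m : Memory} {Q Q' : ℕ → Memory → Prop} (h : P.Ends m Q)
    (hQ : ∀ t m', Q t m' → Q' t m') : P.Ends m Q' := by
  obtain ⟨t, m', h1, h2⟩ := h
  exact ⟨t, m', h1, hQ _ _ h2⟩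

theorem Within.mono {P : Program} {m : Memory} {T T' : ℕ} {Q Q' : Memory → Prop}
    (h : P.Within m T Q) (hT : T ≤ T') (hQ : ∀ m', Q m' → Q' m') : P.Within m T' Q' :=
  Ends.mono h fun _ _ h => ⟨h.1.trans hT, hQ _ h.2⟩

theorem Ends.seq {P P' : Program} {m : Memory} {Q : ℕ → Memory → Prop}
    (h : P.Ends m fun t m' => P'.Ends m' fun t' m'' => Q (t + t') m'') :
    (Program.seq P P').Ends m Q := by
  obtain ⟨t, m', h1, t', m'', h2, h3⟩ := h
  exact ⟨_, _, .seq h1 h2, h3⟩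

theorem Within.seq {P P' : Program} {m : Memory} {T T' : ℕ} {Q : Memory → Prop}
    (h : P.Within m T fun m' => P'.Within m' T' Q) : (Program.seq P P').Within m (T + T') Q := by
  obtain ⟨t, m', h1, ht, t', m'', h2, ht', h3⟩ := h
  exact ⟨_, _, .seq h1 h2, by omega, h3⟩

theorem LoopFree.within {P : Program} (h : P.LoopFree) {m : Memory} {Q : Memory → Prop}
    (hQ : Q (P.den m)) : P.Within m P.cost Q := by
  obtain ⟨t, ht, hr⟩ := h.runs m
  exact ⟨t, _, hr, ht, hQ⟩

/-- Every step takes time, so a potential that pays for the time drops strictly in each round of a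
loop. This is what makes the induction in `Ends.loop` terminate. -/
theorem Runs.pos {P : Program} {m m' : Memory} {t : ℕ} (h : Runs P m t m') : 0 < t := by
  have hb : ∀ b : Test, 0 < b.cost := by intro b; cases b <;> simp [Test.cost]
  induction h with
  | skip => simp
  | setI => simp
  | setR => simp
  | seq => omega
  | branch_true => omega
  | branch_false => omega
  | loop_stop => exact hb _
  | loop_step => omega

/-- The rule for loops, with an invariant and a potential that pays for the time. -/
theorem Ends.loop {b : Test} {P : Program} (Inv : Memory → Prop) (Φ : Memory → ℕ)
    (hbody : ∀ m, Inv m → b.Holds m →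
      P.Ends m fun t m' => Inv m' ∧ b.cost + t + Φ m' ≤ Φ m) (m : Memory) (hm : Inv m) :
    (Program.loop b P).Ends m fun t m' =>
      Inv m' ∧ ¬ b.Holds m' ∧ t + Φ m' ≤ b.cost + Φ m := by
  induction h : Φ m using Nat.strong_induction_on generalizing m with
  | _ N ih =>
    by_cases hb : b.Holds m
    · obtain ⟨t, m', h1, h2, h3⟩ := hbody m hm hb
      have := Runs.pos h1
      obtain ⟨t', m'', h4, h5, h6, h7⟩ := ih (Φ m') (by omega) m' h2 rfl
      exact ⟨_, _, .loop_step hb h1 h4, h5, h6, by omega⟩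
    · exact ⟨_, _, Runs.loop_stop hb, hm, hb, by omega⟩

end Program

/-! ### Named variables and arrays in the working space -/

/-- Names of integer variables. -/
inductive IVar where
  | col | lev | slot | lft | rgt | cnt | idx | pos | num | side | quo | base
  deriving DecidableEq

/-- Names of real arrays. The scalar variables are the arrays of which only entry `0` is used. -/
inductive RVar where
  | q | va | vb | qt | qs
  | aa | bb | cc | lo | hi | ca | cb | front | best | top | last | rad | step | rho | tmp
  deriving DecidableEq

namespace IVar

/-- The address of an integer variable. -/
def code (x : IVar) : ℕ := x.ctorIdx

theorem code_inj {x y : IVar} : x.code = y.code ↔ x = y := by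
  constructor
  · intro h
    cases x <;> cases y <;> first | rfl | exact absurd h (by decide)
  · rintro rfl
    rfl

/-- The value of an integer variable. -/
def e (x : IVar) : Exp .int := .getI .wrk (.litI x.code)

/-- The assignment to an integer variable. -/
def set (x : IVar) (a : Exp .int) : Program := .setI .wrk (.litI x.code) a

end IVar

namespace RVar

/-- The address of entry `0` of an array; entry `z` is stored `32 * z` cells further on. -/
def code (x : RVar) : ℕ := x.ctorIdx + 1

theorem code_inj {x y : RVar} : x.code = y.code ↔ x = y := by
  constructor
  · intro h
    cases x <;> cases y <;> first | rfl | exact absurd h (by decide)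
  · rintro rfl
    rfl

theorem code_pos (x : RVar) : 0 < x.code := Nat.succ_pos _

theorem code_lt (x : RVar) : x.code < 32 := by
  cases x <;> decide

/-- The value of an array entry. -/
def get (x : RVar) (a : Exp .int) : Exp .real :=
  .getR .wrk (.addI (.mulI (.litI 32) a) (.litI x.code))

/-- The value of a real variable. -/
def e (x : RVar) : Exp .real := x.get (.litI 0)

/-- The assignment to an array entry. -/
def put (x : RVar) (a : Exp .int) (y : Exp .real) : Program :=
  .setR .wrk (.addI (.mulI (.litI 32) a) (.litI x.code)) y

/-- The assignment to a real variable. -/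
def set (x : RVar) (y : Exp .real) : Program := x.put (.litI 0) y

end RVar

namespace Memory

/-- The value of an integer variable. -/
def I (m : Memory) (x : IVar) : ℤ := (m .wrk).int x.code

/-- The value of an array entry. -/
def R (m : Memory) (x : RVar) (z : ℤ) : ℝ := (m .wrk).real (32 * z + x.code).toNat

/-- The assignment to an integer variable. -/
noncomputable def putI (m : Memory) (x : IVar) (z : ℤ) : Memory := m.writeI .wrk x.code z

/-- The assignment to an array entry. -/
noncomputable def putR (m : Memory) (x : RVar) (z : ℤ) (y : ℝ) : Memory :=
  m.writeR .wrk (32 * z + x.code).toNat y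

variable (m : Memory) (x y : IVar) (u v : RVar) (z z' : ℤ) (a : ℝ) (i : ℕ) (B : Bank)

@[simp] theorem I_putI : (m.putI x z).I y = if y = x then z else m.I y := by
  simp [I, putI, writeI, Function.update_apply, IVar.code_inj]

@[simp] theorem I_putR : (m.putR u z a).I y = m.I y := by
  simp [I, putR, writeR]

@[simp] theorem R_putI : (m.putI x z).R u z' = m.R u z' := by
  simp [R, putI, writeI]

/-- The arrays are interleaved with stride 32, and all codes lie strictly between 0 and 32, so
distinct pairs of name and index have distinct addresses. A write with negative `z` is truncated to
address 0, which no entry with index `z' ≥ 0` uses because the codes are positive. -/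
theorem R_putR (h : 0 ≤ z') :
    (m.putR u z a).R v z' = if v = u ∧ z' = z then a else m.R v z' := by
  have h1 := u.code_pos
  have h2 := v.code_pos
  have h3 := u.code_lt
  have h4 := v.code_lt
  have : ((32 * z' + v.code).toNat = (32 * z + u.code).toNat) ↔ (v = u ∧ z' = z) := by
    rw [← RVar.code_inj]
    omega
  simp [R, putR, writeR, Function.update_apply, this]

@[simp] theorem R_putR_zero :
    (m.putR u z a).R v 0 = if v = u ∧ 0 = z then a else m.R v 0 := R_putR _ _ _ _ _ _ le_rfl

@[simp] theorem R_putR_natCast :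
    (m.putR u z a).R v i = if v = u ∧ i = z then a else m.R v i :=
  R_putR _ _ _ _ _ _ (Int.natCast_nonneg i)

@[simp] theorem putI_inp : (m.putI x z) .inp = m .inp := by simp [putI, writeI]
@[simp] theorem putI_ds : (m.putI x z) .ds = m .ds := by simp [putI, writeI]
@[simp] theorem putI_out : (m.putI x z) .out = m .out := by simp [putI, writeI]
@[simp] theorem putR_inp : (m.putR u z a) .inp = m .inp := by simp [putR, writeR]
@[simp] theorem putR_ds : (m.putR u z a) .ds = m .ds := by simp [putR, writeR]

@[simp] theorem I_writeI_ds : (m.writeI .ds i z).I x = m.I x := by simp [I, writeI]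
@[simp] theorem I_writeR_ds : (m.writeR .ds i a).I x = m.I x := by simp [I, writeR]
@[simp] theorem I_writeI_out : (m.writeI .out i z).I x = m.I x := by simp [I, writeI]
@[simp] theorem I_writeR_out : (m.writeR .out i a).I x = m.I x := by simp [I, writeR]
@[simp] theorem R_writeI_ds : (m.writeI .ds i z).R u z' = m.R u z' := by simp [R, writeI]
@[simp] theorem R_writeR_ds : (m.writeR .ds i a).R u z' = m.R u z' := by simp [R, writeR]

@[simp] theorem writeI_same_int : ((m.writeI B i z) B).int = Function.update (m B).int i z := by
  simp [writeI]
@[simp] theorem writeI_same_real : ((m.writeI B i z) B).real = (m B).real := by simp [writeI]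
@[simp] theorem writeR_same_int : ((m.writeR B i a) B).int = (m B).int := by simp [writeR]
@[simp] theorem writeR_same_real :
    ((m.writeR B i a) B).real = Function.update (m B).real i a := by simp [writeR]
theorem writeI_of_ne {B B' : Bank} (h : B' ≠ B) : (m.writeI B i z) B' = m B' := by
  simp [writeI, h]
theorem writeR_of_ne {B B' : Bank} (h : B' ≠ B) : (m.writeR B i a) B' = m B' := by
  simp [writeR, h]
@[simp] theorem writeI_ds_inp : (m.writeI .ds i z) .inp = m .inp := m.writeI_of_ne _ _ (by simp)
@[simp] theorem writeR_ds_inp : (m.writeR .ds i a) .inp = m .inp := m.writeR_of_ne _ _ (by simp)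
@[simp] theorem writeI_out_ds : (m.writeI .out i z) .ds = m .ds := m.writeI_of_ne _ _ (by simp)
@[simp] theorem writeR_out_ds : (m.writeR .out i a) .ds = m .ds := m.writeR_of_ne _ _ (by simp)

end Memory

namespace Exp

variable (m : Memory)

@[simp] theorem eval_litI (z : ℤ) : (litI z).eval m = z := rfl
@[simp] theorem eval_litR (c : ℚ) : (litR c).eval m = (c : ℝ) := rfl
@[simp] theorem eval_getI (B : Bank) (a : Exp .int) :
    (getI B a).eval m = (m B).int (a.eval m).toNat := rfl
@[simp] theorem eval_getR (B : Bank) (a : Exp .int) :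
    (getR B a).eval m = (m B).real (a.eval m).toNat := rfl
@[simp] theorem eval_addI (x y : Exp .int) : (addI x y).eval m =
    @HAdd.hAdd ℤ ℤ ℤ _ (x.eval m) (y.eval m) := rfl
@[simp] theorem eval_subI (x y : Exp .int) : (subI x y).eval m =
    @HSub.hSub ℤ ℤ ℤ _ (x.eval m) (y.eval m) := rfl
@[simp] theorem eval_mulI (x y : Exp .int) : (mulI x y).eval m =
    @HMul.hMul ℤ ℤ ℤ _ (x.eval m) (y.eval m) := rfl
@[simp] theorem eval_divI (x y : Exp .int) : (divI x y).eval m =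
    @HDiv.hDiv ℤ ℤ ℤ _ (x.eval m) (y.eval m) := rfl
@[simp] theorem eval_addR (x y : Exp .real) : (addR x y).eval m =
    @HAdd.hAdd ℝ ℝ ℝ _ (x.eval m) (y.eval m) := rfl
@[simp] theorem eval_subR (x y : Exp .real) : (subR x y).eval m =
    @HSub.hSub ℝ ℝ ℝ _ (x.eval m) (y.eval m) := rfl
@[simp] theorem eval_mulR (x y : Exp .real) : (mulR x y).eval m =
    @HMul.hMul ℝ ℝ ℝ _ (x.eval m) (y.eval m) := rfl
@[simp] theorem eval_divR (x y : Exp .real) : (divR x y).eval m =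
    @HDiv.hDiv ℝ ℝ ℝ _ (x.eval m) (y.eval m) := rfl
@[simp] theorem eval_sqrt (x : Exp .real) : (sqrt x).eval m = Real.sqrt (x.eval m) := rfl
@[simp] theorem eval_ofInt (x : Exp .int) : (ofInt x).eval m = ((x.eval m : ℤ) : ℝ) := rfl
@[simp] theorem eval_floor (x : Exp .real) : (floor x).eval m = ⌊(x.eval m : ℝ)⌋ := rfl
@[simp] theorem eval_ivar (x : IVar) : x.e.eval m = m.I x := rfl
@[simp] theorem eval_get (x : RVar) (a : Exp .int) : (x.get a).eval m = m.R x (a.eval m) := rfl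
@[simp] theorem eval_rvar (x : RVar) : x.e.eval m = m.R x 0 := rfl

/-- The maximum of two numbers. -/
def max (x y : Exp .real) : Exp .real :=
  .divR (.addR (.addR x y) (.sqrt (.mulR (.subR x y) (.subR x y)))) (.litR 2)

/-- The minimum of two numbers. -/
def min (x y : Exp .real) : Exp .real :=
  .divR (.subR (.addR x y) (.sqrt (.mulR (.subR x y) (.subR x y)))) (.litR 2)

@[simp] theorem eval_max (x y : Exp .real) :
    (x.max y).eval m = @Max.max ℝ _ (x.eval m) (y.eval m) := by
  simp only [max, eval_divR, eval_addR, eval_sqrt, eval_mulR, eval_subR, eval_litR,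
    Real.sqrt_mul_self_eq_abs]
  rcases le_total (x.eval m : ℝ) (y.eval m) with h | h
  · rw [max_eq_right h, abs_of_nonpos (sub_nonpos.2 h)]
    push_cast
    ring
  · rw [max_eq_left h, abs_of_nonneg (sub_nonneg.2 h)]
    push_cast
    ring

@[simp] theorem eval_min (x y : Exp .real) :
    (x.min y).eval m = @Min.min ℝ _ (x.eval m) (y.eval m) := by
  simp only [min, eval_divR, eval_addR, eval_sqrt, eval_mulR, eval_subR, eval_litR,
    Real.sqrt_mul_self_eq_abs]
  rcases le_total (x.eval m : ℝ) (y.eval m) with h | h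
  · rw [min_eq_left h, abs_of_nonpos (sub_nonpos.2 h)]
    push_cast
    ring
  · rw [min_eq_right h, abs_of_nonneg (sub_nonneg.2 h)]
    push_cast
    ring

/-- The sum of the values of the first `d` expressions of a sequence. -/
def sum : ℕ → (ℕ → Exp .real) → Exp .real
  | 0, _ => .litR 0
  | d + 1, f => .addR (sum d f) (f d)

@[simp] theorem eval_sum (d : ℕ) (f : ℕ → Exp .real) :
    (sum d f).eval m = @Finset.sum ℕ ℝ _ (Finset.range d) (fun l => (f l).eval m) := by
  induction d with
  | zero => simp [sum]
  | succ d ih => simp [sum, Finset.sum_range_succ, ih]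

end Exp

namespace Test

variable (m : Memory)

@[simp] theorem holds_leI (x y : Exp .int) :
    (leI x y).Holds m ↔ @LE.le ℤ _ (x.eval m) (y.eval m) := Iff.rfl
@[simp] theorem holds_ltI (x y : Exp .int) :
    (ltI x y).Holds m ↔ @LT.lt ℤ _ (x.eval m) (y.eval m) := Iff.rfl
@[simp] theorem holds_leR (x y : Exp .real) :
    (leR x y).Holds m ↔ @LE.le ℝ _ (x.eval m) (y.eval m) := Iff.rfl
@[simp] theorem holds_ltR (x y : Exp .real) :
    (ltR x y).Holds m ↔ @LT.lt ℝ _ (x.eval m) (y.eval m) := Iff.rfl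

end Test

/-! ### Effects of loop-free programs, and counting loops with time bounds. -/

namespace Program

/-- Sequential composition. -/
scoped infixr:60 " ;; " => Program.seq

variable (m : Memory)

@[simp] theorem den_seq (P Q : Program) : (P ;; Q).den m = Q.den (P.den m) := rfl
@[simp] theorem den_skip : Program.skip.den m = m := rfl
@[simp] theorem den_branch (b : Test) (P Q : Program) [Decidable (b.Holds m)] :
    (Program.branch b P Q).den m = if b.Holds m then P.den m else Q.den m := by
  simp only [den]
  congr
@[simp] theorem den_setI (x : IVar) (a : Exp .int) :
    (x.set a).den m = m.putI x (a.eval m) := rfl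
@[simp] theorem den_put (x : RVar) (a : Exp .int) (y : Exp .real) :
    (x.put a y).den m = m.putR x (a.eval m) (y.eval m) := rfl
@[simp] theorem den_setR (x : RVar) (y : Exp .real) :
    (x.set y).den m = m.putR x 0 (y.eval m) := rfl
@[simp] theorem den_writeI (B : Bank) (a x : Exp .int) :
    (Program.setI B a x).den m = m.writeI B (a.eval m).toNat (x.eval m) := rfl
@[simp] theorem den_writeR (B : Bank) (a : Exp .int) (x : Exp .real) :
    (Program.setR B a x).den m = m.writeR B (a.eval m).toNat (x.eval m) := rfl

@[simp] theorem loopFree_seq (P Q : Program) :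
    (P ;; Q).LoopFree ↔ P.LoopFree ∧ Q.LoopFree := Iff.rfl
@[simp] theorem loopFree_branch (b : Test) (P Q : Program) :
    (Program.branch b P Q).LoopFree ↔ P.LoopFree ∧ Q.LoopFree := Iff.rfl
@[simp] theorem loopFree_skip : Program.skip.LoopFree := trivial
@[simp] theorem loopFree_ivar (x : IVar) (a : Exp .int) : (x.set a).LoopFree := trivial
@[simp] theorem loopFree_put (x : RVar) (a : Exp .int) (y : Exp .real) :
    (x.put a y).LoopFree := trivial
@[simp] theorem loopFree_rvar (x : RVar) (y : Exp .real) : (x.set y).LoopFree := trivial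
@[simp] theorem loopFree_setI (B : Bank) (a x : Exp .int) : (Program.setI B a x).LoopFree := trivial
@[simp] theorem loopFree_setR (B : Bank) (a : Exp .int) (x : Exp .real) :
    (Program.setR B a x).LoopFree := trivial

/-- `for x = 0, …, N - 1`. -/
def forLoop (x : IVar) (N : Exp .int) (P : Program) : Program :=
  x.set (.litI 0) ;; .loop (.ltI x.e N) (P ;; x.set (.addI x.e (.litI 1)))

/-- The rule for `forLoop`, with a potential that pays for a part of the time. -/
theorem Ends.forLoop {x : IVar} {N : Exp .int} {P : Program} {c K : ℕ}
    (Inv : ℕ → Memory → Prop) (Φ : Memory → ℕ) {m : Memory}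
    (hN : ∀ j m, Inv j m → N.eval m = (K : ℤ)) (hx : ∀ j m, Inv j m → m.I x = (j : ℤ))
    (h0 : Inv 0 (m.putI x 0))
    (hbody : ∀ j < K, ∀ m, Inv j m → P.Ends m fun t m' =>
      (m'.I x = (j : ℤ) ∧ Inv (j + 1) (m'.putI x ((j + 1 : ℕ) : ℤ))) ∧
        t + Φ (m'.putI x ((j + 1 : ℕ) : ℤ)) ≤ c + Φ m) :
    (forLoop x N P).Ends m fun t m' => Inv K m' ∧
      t + Φ m' ≤ K * (c + N.cost + 9) + N.cost + 6 + Φ (m.putI x 0) := by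
  have key := Ends.loop (b := .ltI x.e N) (P := P ;; x.set (.addI x.e (.litI 1)))
    (fun m => ∃ j ≤ K, Inv j m)
    -- A remaining round is charged `c` for the body, `N.cost + 3` for the test and 6 for the
    -- increment of the counter.
    (fun m => (K - (m.I x).toNat) * (c + N.cost + 9) + Φ m) (by
      rintro m ⟨j, hj, hm⟩ hb
      simp only [Test.holds_ltI, Exp.eval_ivar, hx j m hm, hN j m hm] at hb
      have hjK : j < K := by omega
      refine Ends.seq ((hbody j hjK m hm).mono ?_)
      rintro t m' ⟨⟨h1, h2⟩, h3⟩
      obtain ⟨t', ht', hr⟩ :=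
        (loopFree_ivar x (.addI x.e (.litI 1))).runs m'
      refine ⟨t', _, hr, ?_⟩
      have : (x.set (.addI x.e (.litI 1))).den m' = m'.putI x ((j + 1 : ℕ) : ℤ) := by
        simp [h1]
      rw [this]
      refine ⟨⟨j + 1, hjK, h2⟩, ?_⟩
      have ht2 : t' ≤ 6 := by
        simpa [IVar.set, IVar.e, cost, Exp.cost] using ht'
      have hcost : (Test.ltI x.e N).cost = N.cost + 3 := by
        simp only [Test.cost, IVar.e, Exp.cost]; omega
      rw [hx j m hm, hx _ _ h2, hcost]
      have : K - ((j : ℤ)).toNat = (K - ((j + 1 : ℕ) : ℤ).toNat) + 1 := by omega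
      rw [this, add_mul]
      omega) (m.putI x 0) ⟨0, Nat.zero_le _, h0⟩
  refine Ends.seq ⟨_, _, .setI _ _ _ _, ?_⟩
  change Ends _ (m.putI x 0) _
  refine Ends.mono key ?_
  rintro t m' ⟨⟨j, hj, h1⟩, h2, h3⟩
  simp only [Test.holds_ltI, Exp.eval_ivar, hx j m' h1, hN j m' h1] at h2
  have hjK : j = K := by omega
  subst hjK
  refine ⟨h1, ?_⟩
  have hcost : (Test.ltI x.e N).cost = N.cost + 3 := by
    simp only [Test.cost, IVar.e, Exp.cost]; omega
  rw [hcost, hx 0 _ h0, hx _ _ h1] at h3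
  simp only [Exp.cost]
  simp at h3 ⊢
  omega

/-- The rule for `forLoop`. -/
theorem Within.forLoop {x : IVar} {N : Exp .int} {P : Program} {c K : ℕ}
    (Inv : ℕ → Memory → Prop) {m : Memory}
    (hN : ∀ j m, Inv j m → N.eval m = (K : ℤ)) (hx : ∀ j m, Inv j m → m.I x = (j : ℤ))
    (h0 : Inv 0 (m.putI x 0))
    (hbody : ∀ j < K, ∀ m, Inv j m → P.Within m c fun m' =>
      m'.I x = (j : ℤ) ∧ Inv (j + 1) (m'.putI x ((j + 1 : ℕ) : ℤ))) :
    (forLoop x N P).Within m (K * (c + N.cost + 9) + N.cost + 6) (Inv K) := by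
  refine (Ends.forLoop (c := c) Inv (fun _ => 0) hN hx h0 ?_).mono ?_
  · intro j hj m hm
    exact Ends.mono (hbody j hj m hm) fun t m' h => ⟨h.2, by simpa using h.1⟩
  · rintro t m' ⟨h1, h2⟩
    exact ⟨by simpa using h2, h1⟩

end Program

/-! ### Monotone paths in the free space -/

/-- There is a monotone path from `(s, t)` to `(s', t')` in the set of points that satisfy `F`.
The point with coordinate sum `x` on the path is `(h x, x - h x)`. -/
def FreePath (F : ℝ → ℝ → Prop) (s t s' t' : ℝ) : Prop :=
  s ≤ s' ∧ t ≤ t' ∧ ∃ h : ℝ → ℝ, MonotoneOn h (Set.Icc (s + t) (s' + t')) ∧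
    MonotoneOn (fun x => x - h x) (Set.Icc (s + t) (s' + t')) ∧ h (s + t) = s ∧
    h (s' + t') = s' ∧ ∀ x ∈ Set.Icc (s + t) (s' + t'), F (h x) (x - h x)

/-- A function that is monotone together with its difference to the identity is continuous. -/
theorem continuousOn_of_monotoneOn_sub {h : ℝ → ℝ} {S : Set ℝ} (h1 : MonotoneOn h S)
    (h2 : MonotoneOn (fun x => x - h x) S) : ContinuousOn h S := by
  have : LipschitzOnWith 1 h S := by
    refine LipschitzOnWith.of_dist_le_mul fun x hx y hy => ?_
    rw [NNReal.coe_one, one_mul, Real.dist_eq, Real.dist_eq]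
    rcases le_total x y with hxy | hxy
    · have a1 := h1 hx hy hxy
      have a2 := h2 hx hy hxy
      simp only at a2
      rw [abs_of_nonpos (by linarith), abs_of_nonpos (by linarith)]
      linarith
    · have a1 := h1 hy hx hxy
      have a2 := h2 hy hx hxy
      simp only at a2
      rw [abs_of_nonneg (by linarith), abs_of_nonneg (by linarith)]
      linarith
  exact this.continuousOn

/-- Monotone functions on adjacent intervals that agree at the common end point can be glued. -/
theorem MonotoneOn.glue {f g : ℝ → ℝ} {a b c : ℝ} (hf : MonotoneOn f (Set.Icc a b))
    (hg : MonotoneOn g (Set.Icc b c)) (h : f b = g b) :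
    MonotoneOn (fun x => if x ≤ b then f x else g x) (Set.Icc a c) := by
  intro x hx y hy hxy
  simp only
  split_ifs with h1 h2 h2
  · exact hf ⟨hx.1, h1⟩ ⟨hy.1, h2⟩ hxy
  · push Not at h2
    calc f x ≤ f b := hf ⟨hx.1, h1⟩ ⟨hx.1.trans h1, le_rfl⟩ h1
      _ = g b := h
      _ ≤ g y := hg ⟨le_rfl, h2.le.trans hy.2⟩ ⟨h2.le, hy.2⟩ h2.le
  · exact absurd (hxy.trans h2) h1
  · push Not at h1 h2
    exact hg ⟨h1.le, hx.2⟩ ⟨h2.le, hy.2⟩ hxy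

namespace FreePath

variable {F : ℝ → ℝ → Prop} {s t s' t' s'' t'' : ℝ}

theorem refl (h : F s t) : FreePath F s t s t := by
  refine ⟨le_rfl, le_rfl, fun _ => s, fun _ _ _ _ _ => le_rfl, ?_, rfl, rfl, ?_⟩
  · intro x _ y _ hxy
    simpa using hxy
  · rintro x ⟨h1, h2⟩
    have : x - s = t := by linarith
    rwa [this]

theorem right (h : FreePath F s t s' t') : F s' t' := by
  obtain ⟨h1, h2, h, -, -, -, h3, h4⟩ := h
  have := h4 (s' + t') ⟨by linarith, le_rfl⟩
  rwa [h3, add_sub_cancel_left] at this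

theorem trans (h : FreePath F s t s' t') (h' : FreePath F s' t' s'' t'') :
    FreePath F s t s'' t'' := by
  obtain ⟨a1, a2, h, a3, a4, a5, a6, a7⟩ := h
  obtain ⟨b1, b2, g, b3, b4, b5, b6, b7⟩ := h'
  refine ⟨a1.trans b1, a2.trans b2, fun x => if x ≤ s' + t' then h x else g x,
    a3.glue b3 (a6.trans b5.symm), ?_, ?_, ?_, ?_⟩
  · convert a4.glue b4 (by simp [a6, b5]) using 2 with x
    simp only
    split_ifs <;> rfl
  · simp only
    rw [if_pos (by linarith), a5]
  · simp only
    split_ifs with hc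
    · have : s' + t' = s'' + t'' := by linarith
      rw [← this, a6]
      linarith
    · exact b6
  · intro x hx
    simp only
    split_ifs with hc
    · exact a7 x ⟨hx.1, hc⟩
    · exact b7 x ⟨(not_le.1 hc).le, hx.2⟩

/-- Along a segment the first coordinate is an affine function of the coordinate sum, with slope
between 0 and 1. A segment of length zero is treated separately because the slope divides by the
increase of the sum. -/
theorem segment (hs : s ≤ s') (ht : t ≤ t')
    (h : ∀ z ∈ Set.Icc (0 : ℝ) 1, F ((1 - z) * s + z * s') ((1 - z) * t + z * t')) :
    FreePath F s t s' t' := by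
  rcases eq_or_lt_of_le (add_le_add hs ht) with he | hlt
  · have h1 : s' = s := by linarith
    have h2 : t' = t := by linarith
    subst h1 h2
    exact refl (by simpa using h 0 (by simp))
  have hd : 0 < s' + t' - (s + t) := by linarith
  have hq : (s' - s) / (s' + t' - (s + t)) ≤ 1 := by
    rw [div_le_one hd]
    linarith
  have hq0 : 0 ≤ (s' - s) / (s' + t' - (s + t)) := div_nonneg (by linarith) hd.le
  refine ⟨hs, ht, fun x => s + (x - (s + t)) * ((s' - s) / (s' + t' - (s + t))), ?_, ?_, ?_, ?_, ?_⟩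
  · intro x _ y _ hxy
    have := mul_le_mul_of_nonneg_right hxy hq0
    simp only
    linarith
  · intro x _ y _ hxy
    have := mul_le_mul_of_nonneg_right hxy (sub_nonneg.2 hq)
    simp only
    linarith
  · simp
  · field_simp
    ring
  · intro x hx
    have := h ((x - (s + t)) / (s' + t' - (s + t)))
      ⟨div_nonneg (by linarith [hx.1]) hd.le, by rw [div_le_one hd]; linarith [hx.2]⟩
    convert this using 1 <;> field_simp <;> ring

/-- Parametrization by the coordinate sum makes cutting trivial: the same function `h`, restricted
to the two subintervals, describes both pieces. -/
theorem split {h : ℝ → ℝ} (hs : s ≤ s') (ht : t ≤ t')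
    (a1 : MonotoneOn h (Set.Icc (s + t) (s' + t')))
    (a2 : MonotoneOn (fun x => x - h x) (Set.Icc (s + t) (s' + t'))) (a3 : h (s + t) = s)
    (a4 : h (s' + t') = s') (a5 : ∀ x ∈ Set.Icc (s + t) (s' + t'), F (h x) (x - h x)) {x : ℝ}
    (hx : x ∈ Set.Icc (s + t) (s' + t')) :
    FreePath F s t (h x) (x - h x) ∧ FreePath F (h x) (x - h x) s' t' := by
  have l : s + t ∈ Set.Icc (s + t) (s' + t') := ⟨le_rfl, by linarith⟩
  have r : s' + t' ∈ Set.Icc (s + t) (s' + t') := ⟨by linarith, le_rfl⟩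
  have b1 := a1 l hx hx.1
  have b2 := a2 l hx hx.1
  have b3 := a1 hx r hx.2
  have b4 := a2 hx r hx.2
  simp only [a3, a4, add_sub_cancel_left] at b1 b2 b3 b4
  have e : h x + (x - h x) = x := by ring
  refine ⟨⟨b1, b2, h, ?_⟩, ⟨b3, b4, h, ?_⟩⟩
  · rw [e]
    have hsub : Set.Icc (s + t) x ⊆ Set.Icc (s + t) (s' + t') := Set.Icc_subset_Icc_right hx.2
    exact ⟨a1.mono hsub, a2.mono hsub, a3, rfl, fun y hy => a5 y (hsub hy)⟩
  · rw [e]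
    have hsub : Set.Icc x (s' + t') ⊆ Set.Icc (s + t) (s' + t') := Set.Icc_subset_Icc_left hx.1
    exact ⟨a1.mono hsub, a2.mono hsub, rfl, a4, fun y hy => a5 y (hsub hy)⟩

/-- A path meets every vertical line between its end points. -/
theorem split_fst (h : FreePath F s t s' t') {x : ℝ} (h1 : s ≤ x) (h2 : x ≤ s') :
    ∃ y, t ≤ y ∧ y ≤ t' ∧ FreePath F s t x y ∧ FreePath F x y s' t' := by
  obtain ⟨hs, ht, h, a1, a2, a3, a4, a5⟩ := h
  obtain ⟨z, hz, rfl⟩ := intermediate_value_Icc (by linarith)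
    (continuousOn_of_monotoneOn_sub a1 a2) (show x ∈ Set.Icc (h (s + t)) (h (s' + t')) by
      rw [a3, a4]; exact ⟨h1, h2⟩)
  obtain ⟨b1, b2⟩ := split hs ht a1 a2 a3 a4 a5 hz
  exact ⟨z - h z, b1.2.1, b2.2.1, b1, b2⟩

/-- A path meets every horizontal line between its end points. -/
theorem split_snd (h : FreePath F s t s' t') {y : ℝ} (h1 : t ≤ y) (h2 : y ≤ t') :
    ∃ x, s ≤ x ∧ x ≤ s' ∧ FreePath F s t x y ∧ FreePath F x y s' t' := by
  obtain ⟨hs, ht, h, a1, a2, a3, a4, a5⟩ := h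
  obtain ⟨z, hz, rfl⟩ := intermediate_value_Icc (by linarith)
    (continuousOn_id.sub (continuousOn_of_monotoneOn_sub a1 a2))
    (show y ∈ Set.Icc ((s + t) - h (s + t)) ((s' + t') - h (s' + t')) by
      rw [a3, a4]; exact ⟨by linarith, by linarith⟩)
  obtain ⟨b1, b2⟩ := split hs ht a1 a2 a3 a4 a5 hz
  exact ⟨h z, b1.1, b2.1, b1, b2⟩

theorem mono {F' : ℝ → ℝ → Prop} (h : FreePath F s t s' t')
    (hF : ∀ x y, s ≤ x → x ≤ s' → t ≤ y → y ≤ t' → F x y → F' x y) : FreePath F' s t s' t' := by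
  obtain ⟨hs, ht, h, a1, a2, a3, a4, a5⟩ := h
  refine ⟨hs, ht, h, a1, a2, a3, a4, fun x hx => ?_⟩
  obtain ⟨b1, b2⟩ := split hs ht a1 a2 a3 a4 a5 hx
  exact hF _ _ b1.1 b2.1 b1.2.1 b2.2.1 (a5 x hx)

end FreePath

/-! ### The Fréchet distance and paths -/

section Frechet

variable {d : ℕ} {f g : ℝ → EuclideanSpace ℝ (Fin d)} {a b a' b' : ℝ}

/-- Running through the coordinate sum at constant speed turns the path into a pair of
reparametrizations. Both are continuous, since `h` and its difference to the identity are monotone.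
-/
theorem frechetDist_le_of_freePath {ρ : ℝ}
    (h : FreePath (fun s t => ‖f s - g t‖ ≤ ρ) a a' b b') : frechetDist f a b g a' b' ≤ ρ := by
  obtain ⟨hs, ht, h, a1, a2, a3, a4, a5⟩ := h
  refine csInf_le ⟨0, ?_⟩ ?_
  · rintro r ⟨σ, θ, -, -, -, -, -, -, -, -, hr⟩
    exact (norm_nonneg _).trans (hr 0 (by simp))
  have hm : Set.MapsTo (fun z : ℝ => (a + a') + z * (b + b' - (a + a'))) (Set.Icc 0 1)
      (Set.Icc (a + a') (b + b')) := by
    rintro z ⟨h0, h1⟩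
    constructor
    · nlinarith
    · nlinarith
  have hc : ContinuousOn (fun z : ℝ => (a + a') + z * (b + b' - (a + a'))) (Set.Icc 0 1) := by
    fun_prop
  have hmono : MonotoneOn (fun z : ℝ => (a + a') + z * (b + b' - (a + a'))) (Set.Icc 0 1) := by
    intro x _ y _ hxy
    have := mul_le_mul_of_nonneg_right hxy (show 0 ≤ b + b' - (a + a') by linarith)
    simp only
    linarith
  have hcont := continuousOn_of_monotoneOn_sub a1 a2
  refine ⟨fun z => h ((a + a') + z * (b + b' - (a + a'))),
    fun z => ((a + a') + z * (b + b' - (a + a'))) - h ((a + a') + z * (b + b' - (a + a'))),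
    hcont.comp hc hm, a1.comp hmono hm, by simp [a3], by simp [a4],
    hc.sub (hcont.comp hc hm), a2.comp hmono hm, by simp [a3], by simp [a4],
    fun z hz => a5 _ (hm hz)⟩

/-- By the intermediate value theorem `σ + θ` attains every coordinate sum; let `τ x` be some time
at which it equals `x`. The choice is harmless: if `x ≤ y` but `τ y ≤ τ x`, monotonicity of both
functions forces `x = y`. Hence `σ ∘ τ` and `θ ∘ τ` are monotone. -/
theorem exists_path_of_reparam {F : ℝ → ℝ → Prop} {σ θ : ℝ → ℝ}
    (h1 : ContinuousOn σ (Set.Icc 0 1)) (h2 : MonotoneOn σ (Set.Icc 0 1)) (h3 : σ 0 = a)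
    (h4 : σ 1 = b) (h5 : ContinuousOn θ (Set.Icc 0 1)) (h6 : MonotoneOn θ (Set.Icc 0 1))
    (h7 : θ 0 = a') (h8 : θ 1 = b') (h9 : ∀ t ∈ Set.Icc (0 : ℝ) 1, F (σ t) (θ t)) :
    FreePath F a a' b b' := by
  have l : (0 : ℝ) ∈ Set.Icc (0 : ℝ) 1 := by simp
  have r : (1 : ℝ) ∈ Set.Icc (0 : ℝ) 1 := by simp
  have hab : a ≤ b := h3 ▸ h4 ▸ h2 l r zero_le_one
  have hab' : a' ≤ b' := h7 ▸ h8 ▸ h6 l r zero_le_one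
  have hsur : ∀ x ∈ Set.Icc (a + a') (b + b'), ∃ z ∈ Set.Icc (0 : ℝ) 1, σ z + θ z = x := by
    intro x hx
    obtain ⟨z, hz, e⟩ := intermediate_value_Icc zero_le_one (h1.add h5)
      (show x ∈ Set.Icc (σ 0 + θ 0) (σ 1 + θ 1) by rwa [h3, h4, h7, h8])
    exact ⟨z, hz, e⟩
  choose! τ hτ e using hsur
  have key : ∀ φ : ℝ → ℝ, MonotoneOn φ (Set.Icc 0 1) →
      MonotoneOn (fun x => φ (τ x)) (Set.Icc (a + a') (b + b')) := by
    intro φ hφ x hx y hy hxy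
    rcases le_total (τ x) (τ y) with h | h
    · exact hφ (hτ x hx) (hτ y hy) h
    · have u1 := h2 (hτ y hy) (hτ x hx) h
      have u2 := h6 (hτ y hy) (hτ x hx) h
      have : x = y := le_antisymm hxy (by rw [← e x hx, ← e y hy]; linarith)
      rw [this]
  have hθ : ∀ x ∈ Set.Icc (a + a') (b + b'), x - σ (τ x) = θ (τ x) := fun x hx => by
    linarith [e x hx]
  have bnd : ∀ x ∈ Set.Icc (a + a') (b + b'),
      a ≤ σ (τ x) ∧ σ (τ x) ≤ b ∧ a' ≤ θ (τ x) ∧ θ (τ x) ≤ b' := by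
    intro x hx
    have hz := hτ x hx
    exact ⟨h3 ▸ h2 l hz hz.1, h4 ▸ h2 hz r hz.2, h7 ▸ h6 l hz hz.1, h8 ▸ h6 hz r hz.2⟩
  refine ⟨hab, hab', fun x => σ (τ x), key σ h2, ?_, ?_, ?_, ?_⟩
  · intro x hx y hy hxy
    simp only
    rw [hθ x hx, hθ y hy]
    exact key θ h6 hx hy hxy
  · have hx : a + a' ∈ Set.Icc (a + a') (b + b') := ⟨le_rfl, by linarith⟩
    have := bnd _ hx
    have := e _ hx
    linarith
  · have hx : b + b' ∈ Set.Icc (a + a') (b + b') := ⟨by linarith, le_rfl⟩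
    have := bnd _ hx
    have := e _ hx
    linarith
  · intro x hx
    rw [hθ x hx]
    exact h9 _ (hτ x hx)

/-- If there are paths in the free spaces of all greater distances, then there is a path. -/
theorem freePath_of_forall_gt (hf : ContinuousOn f (Set.Icc a b))
    (hg : ContinuousOn g (Set.Icc a' b')) {ρ : ℝ} (hab : a ≤ b) (hab' : a' ≤ b')
    (H : ∀ r, ρ < r → FreePath (fun s t => ‖f s - g t‖ ≤ r) a a' b b') :
    FreePath (fun s t => ‖f s - g t‖ ≤ ρ) a a' b b' := by
  -- Constant extension beyond the end points gives globally continuous maps, so that the distance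
  -- condition at a fixed `x` is closed under pointwise convergence of `h`, without knowing that `x
  -- - h x` stays in range.
  set f' := Set.IccExtend hab ((Set.Icc a b).domRestrict f) with hf'
  set g' := Set.IccExtend hab' ((Set.Icc a' b').domRestrict g) with hg'
  have cf : Continuous f' := (continuousOn_iff_continuous_domRestrict.1 hf).Icc_extend'
  have cg : Continuous g' := (continuousOn_iff_continuous_domRestrict.1 hg).Icc_extend'
  have ef : ∀ x, a ≤ x → x ≤ b → f' x = f x := fun x h1 h2 => by
    rw [hf', Set.IccExtend_of_mem hab _ ⟨h1, h2⟩]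
    rfl
  have eg : ∀ x, a' ≤ x → x ≤ b' → g' x = g x := fun x h1 h2 => by
    rw [hg', Set.IccExtend_of_mem hab' _ ⟨h1, h2⟩]
    rfl
  let J := Set.Icc (a + a') (b + b')
  -- The paths for the radii `ρ + 1/(n+1)` form decreasing closed subsets of a product of compact
  -- intervals, hence have a common member by Tychonoff's theorem. The condition on `h x` is imposed
  -- for all real `x` to get compactness of the product.
  let S : ℕ → Set (ℝ → ℝ) := fun n => {h | (∀ x, h x ∈ Set.Icc a b) ∧
    (∀ x ∈ J, ∀ y ∈ J, x ≤ y → h x ≤ h y) ∧ (∀ x ∈ J, ∀ y ∈ J, x ≤ y → x - h x ≤ y - h y) ∧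
    h (a + a') = a ∧ h (b + b') = b ∧ ∀ x ∈ J, ‖f' (h x) - g' (x - h x)‖ ≤ ρ + 1 / ((n : ℝ) + 1)}
  have hclosed : ∀ n, IsClosed (S n) := by
    intro n
    simp only [S, Set.ofPred_and, Set.ofPred_forall]
    refine .inter ?_ (.inter ?_ (.inter ?_ (.inter ?_ (.inter ?_ ?_))))
    · exact isClosed_iInter fun x => isClosed_Icc.preimage (continuous_apply x)
    · exact isClosed_iInter fun x => isClosed_iInter fun _ => isClosed_iInter fun y =>
        isClosed_iInter fun _ => isClosed_iInter fun _ =>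
          isClosed_le (continuous_apply x) (continuous_apply y)
    · exact isClosed_iInter fun x => isClosed_iInter fun _ => isClosed_iInter fun y =>
        isClosed_iInter fun _ => isClosed_iInter fun _ =>
          isClosed_le (continuous_const.sub (continuous_apply x))
            (continuous_const.sub (continuous_apply y))
    · exact isClosed_eq (continuous_apply _) continuous_const
    · exact isClosed_eq (continuous_apply _) continuous_const
    · exact isClosed_iInter fun x => isClosed_iInter fun _ =>
        isClosed_le ((cf.comp (continuous_apply x)).sub
          (cg.comp (continuous_const.sub (continuous_apply x)))).norm continuous_const
  have hcompact : IsCompact (S 0) :=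
    (isCompact_univ_pi fun _ : ℝ => isCompact_Icc (a := a) (b := b)).of_isClosed_subset (hclosed 0)
      fun h hh => Set.mem_univ_pi.2 hh.1
  have hne : ∀ n, (S n).Nonempty := by
    intro n
    obtain ⟨-, -, h, a1, a2, a3, a4, a5⟩ := H (ρ + 1 / ((n : ℝ) + 1)) (by
      have : (0 : ℝ) < 1 / ((n : ℝ) + 1) := by positivity
      linarith)
    have bd : ∀ x ∈ J, (a ≤ h x ∧ h x ≤ b) ∧ a' ≤ x - h x ∧ x - h x ≤ b' := by
      intro x hx
      obtain ⟨b1, b2⟩ := FreePath.split (F := fun s t => ‖f s - g t‖ ≤ ρ + 1 / ((n : ℝ) + 1))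
        hab hab' a1 a2 a3 a4 a5 hx
      exact ⟨⟨b1.1, b2.1⟩, b1.2.1, b2.2.1⟩
    classical
    have e : ∀ x ∈ J, (if x ∈ J then h x else a) = h x := fun x hx => if_pos hx
    have l : a + a' ∈ J := ⟨le_rfl, by linarith⟩
    have r : b + b' ∈ J := ⟨by linarith, le_rfl⟩
    -- Outside `J` the path function is unconstrained, so it is reset to a value in `[a, b]`.
    refine ⟨fun x => if x ∈ J then h x else a, ?_, ?_, ?_, ?_, ?_, ?_⟩
    · intro x
      simp only
      split_ifs with hx
      · exact (bd x hx).1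
      · exact ⟨le_rfl, hab⟩
    · intro x hx y hy hxy
      simp only [e x hx, e y hy]
      exact a1 hx hy hxy
    · intro x hx y hy hxy
      simp only [e x hx, e y hy]
      exact a2 hx hy hxy
    · exact (e _ l).trans a3
    · exact (e _ r).trans a4
    · intro x hx
      simp only [e x hx]
      obtain ⟨⟨c1, c2⟩, c3, c4⟩ := bd x hx
      rw [ef _ c1 c2, eg _ c3 c4]
      exact a5 x hx
  obtain ⟨h, hh⟩ := IsCompact.nonempty_iInter_of_sequence_nonempty_isCompact_isClosed S
    (by
      rintro n h ⟨b1, b2, b3, b4, b5, b6⟩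
      refine ⟨b1, b2, b3, b4, b5, fun x hx => (b6 x hx).trans ?_⟩
      push_cast
      gcongr
      linarith) hne hcompact hclosed
  rw [Set.mem_iInter] at hh
  obtain ⟨b1, b2, b3, b4, b5, -⟩ := hh 0
  refine ⟨hab, hab', h, fun x hx y hy => b2 x hx y hy, fun x hx y hy => b3 x hx y hy, b4, b5,
    fun x hx => ?_⟩
  have c2 : a' ≤ x - h x := by
    have := b3 _ ⟨le_rfl, by linarith⟩ x hx hx.1
    rw [b4] at this
    linarith
  have c3 : x - h x ≤ b' := by
    have := b3 x hx _ ⟨by linarith, le_rfl⟩ hx.2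
    rw [b5] at this
    linarith
  have lim : Filter.Tendsto (fun n : ℕ => ρ + 1 / ((n : ℝ) + 1)) Filter.atTop (nhds (ρ + 0)) :=
    tendsto_const_nhds.add tendsto_one_div_add_atTop_nhds_zero_nat
  rw [add_zero] at lim
  change ‖f (h x) - g (x - h x)‖ ≤ ρ
  rw [← ef _ (b1 x).1 (b1 x).2, ← eg _ c2 c3]
  exact ge_of_tendsto' lim fun n => (hh n).2.2.2.2.2 x hx

/-- The infimum is attained: a distance at most `ρ` gives paths for all greater radii, and a limit
of these is a path for `ρ`. -/
theorem frechetDist_le_iff (hf : ContinuousOn f (Set.Icc a b))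
    (hg : ContinuousOn g (Set.Icc a' b')) {ρ : ℝ} (hab : a ≤ b) (hab' : a' ≤ b') :
    frechetDist f a b g a' b' ≤ ρ ↔ FreePath (fun s t => ‖f s - g t‖ ≤ ρ) a a' b b' := by
  refine ⟨fun h => freePath_of_forall_gt hf hg hab hab' fun r hr => ?_,
    frechetDist_le_of_freePath⟩
  -- Nonemptiness is needed because the infimum of the empty set of reals is 0 by convention. The
  -- affine reparametrizations give some finite bound by compactness.
  have hne : {r : ℝ | ∃ σ θ : ℝ → ℝ,
      ContinuousOn σ (Set.Icc 0 1) ∧ MonotoneOn σ (Set.Icc 0 1) ∧ σ 0 = a ∧ σ 1 = b ∧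
      ContinuousOn θ (Set.Icc 0 1) ∧ MonotoneOn θ (Set.Icc 0 1) ∧ θ 0 = a' ∧ θ 1 = b' ∧
      ∀ t ∈ Set.Icc (0 : ℝ) 1, ‖f (σ t) - g (θ t)‖ ≤ r}.Nonempty := by
    have aux : ∀ u v : ℝ, u ≤ v → Set.MapsTo (fun z : ℝ => u + z * (v - u)) (Set.Icc 0 1)
        (Set.Icc u v) ∧ MonotoneOn (fun z : ℝ => u + z * (v - u)) (Set.Icc 0 1) := by
      intro u v huv
      refine ⟨fun z hz => ⟨?_, ?_⟩, fun x _ y _ hxy => ?_⟩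
      · nlinarith [hz.1, hz.2]
      · nlinarith [hz.1, hz.2]
      · have := mul_le_mul_of_nonneg_right hxy (sub_nonneg.2 huv)
        simp only
        linarith
    have c1 : ∀ u v : ℝ, ContinuousOn (fun z : ℝ => u + z * (v - u)) (Set.Icc 0 1) := by
      intro u v
      fun_prop
    have cc : ContinuousOn (fun z : ℝ => ‖f (a + z * (b - a)) - g (a' + z * (b' - a'))‖)
        (Set.Icc 0 1) :=
      ((hf.comp (c1 a b) (aux a b hab).1).sub (hg.comp (c1 a' b') (aux a' b' hab').1)).norm
    obtain ⟨r, hr⟩ := (isCompact_Icc.image_of_continuousOn cc).bddAbove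
    exact ⟨r, _, _, c1 a b, (aux a b hab).2, by simp, by simp, c1 a' b', (aux a' b' hab').2,
      by simp, by simp, fun z hz => hr (Set.mem_image_of_mem _ hz)⟩
  obtain ⟨r', ⟨σ, θ, h1, h2, h3, h4, h5, h6, h7, h8, h9⟩, hr'⟩ :=
    exists_lt_of_csInf_lt hne (lt_of_le_of_lt h hr)
  exact exists_path_of_reparam h1 h2 h3 h4 h5 h6 h7 h8 fun t ht => (h9 t ht).trans hr'.le

end Frechet

/-! ### Polygonal curves -/

section Curve

variable {n k d : ℕ} (p : Fin n → EuclideanSpace ℝ (Fin d)) (q : Fin k → EuclideanSpace ℝ (Fin d))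

theorem curve_natCast (i : ℕ) : curve p i = vertex p i := by
  simp [curve]

theorem curve_natCast_add (i : ℕ) {x : ℝ} (h0 : 0 ≤ x) (h1 : x ≤ 1) :
    curve p (i + x) = (1 - x) • vertex p i + x • vertex p (i + 1) := by
  rcases eq_or_lt_of_le h1 with rfl | h1
  · have : (i : ℝ) + 1 = ((i + 1 : ℕ) : ℝ) := by push_cast; ring
    rw [this, curve_natCast]
    simp
  · have h2 : ⌊(i : ℝ) + x⌋₊ = i := by
      rw [Nat.floor_eq_iff (by positivity)]
      exact ⟨by linarith, by linarith⟩
    have h3 : Int.fract ((i : ℝ) + x) = x := by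
      rw [Int.fract_natCast_add, Int.fract_eq_self.2 ⟨h0, h1⟩]
    rw [curve, h2, h3]

theorem curve_convex (i : ℕ) {s s' z : ℝ} (h1 : (i : ℝ) ≤ s) (h2 : s ≤ i + 1) (h3 : (i : ℝ) ≤ s')
    (h4 : s' ≤ i + 1) (hz : z ∈ Set.Icc (0 : ℝ) 1) :
    curve p ((1 - z) * s + z * s') = (1 - z) • curve p s + z • curve p s' := by
  obtain ⟨x, rfl⟩ : ∃ x, s = i + x := ⟨s - i, by ring⟩
  obtain ⟨x', rfl⟩ : ∃ x, s' = i + x := ⟨s' - i, by ring⟩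
  have e : (1 - z) * (i + x) + z * (i + x') = i + ((1 - z) * x + z * x') := by ring
  obtain ⟨z0, z1⟩ := hz
  rw [e, curve_natCast_add p i (x := x) (by linarith) (by linarith),
    curve_natCast_add p i (x := x') (by linarith) (by linarith), curve_natCast_add p i (by nlinarith)
      (by nlinarith)]
  module

/-- The bound `N` is arbitrary: beyond the last vertex the curve continues through default vertices
at 0 and is still piecewise affine. -/
theorem continuousOn_curve (N : ℕ) : ContinuousOn (curve p) (Set.Icc 0 N) := by
  induction N with
  | zero => simp
  | succ N ih =>
    have e : Set.Icc (0 : ℝ) ((N + 1 : ℕ) : ℝ) = Set.Icc 0 (N : ℝ) ∪ Set.Icc (N : ℝ) (N + 1) := by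
      rw [Set.Icc_union_Icc_eq_Icc (by positivity) (by linarith)]
      push_cast
      rfl
    rw [e]
    refine ih.union_of_isClosed ?_ isClosed_Icc isClosed_Icc
    have : Set.EqOn (curve p)
        (fun s => (1 - (s - N)) • vertex p N + (s - N) • vertex p (N + 1))
        (Set.Icc (N : ℝ) (N + 1)) := by
      rintro s ⟨h1, h2⟩
      simp only
      rw [← curve_natCast_add p N (by linarith) (by linarith)]
      congr 1
      ring
    refine ContinuousOn.congr ?_ this
    fun_prop

/-- The free space of two curves. -/
def Free (ρ s t : ℝ) : Prop := ‖curve p s - curve q t‖ ≤ ρ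

/-- Within each cell of the unit grid, two points of `F` that are ordered are joined by a path. -/
def CellConvex (F : ℝ → ℝ → Prop) : Prop :=
  ∀ (i j : ℕ) (s s' t t' : ℝ), (i : ℝ) ≤ s → s ≤ s' → s' ≤ i + 1 → (j : ℝ) ≤ t → t ≤ t' →
    t' ≤ j + 1 → F s t → F s' t' → FreePath F s t s' t'

/-- Both curves are affine on a cell, so the difference of their points is affine along a segment
and its norm is convex. Later arguments about the dynamic program use only this property of the free
space. -/
theorem cellConvex_free (ρ : ℝ) : CellConvex (Free p q ρ) := by
  intro i j s s' t t' h1 h2 h3 h4 h5 h6 h7 h8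
  refine .segment h2 h5 fun z hz => ?_
  unfold Free at h7 h8 ⊢
  rw [curve_convex p i h1 (h2.trans h3) (h1.trans h2) h3 hz,
    curve_convex q j h4 (h5.trans h6) (h4.trans h5) h6 hz]
  have e : (1 - z) • curve p s + z • curve p s' - ((1 - z) • curve q t + z • curve q t') =
      (1 - z) • (curve p s - curve q t) + z • (curve p s' - curve q t') := by module
  rw [e]
  refine (norm_add_le _ _).trans ?_
  rw [norm_smul, norm_smul, Real.norm_of_nonneg hz.1, Real.norm_of_nonneg (sub_nonneg.2 hz.2)]
  nlinarith [hz.1, hz.2]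

variable {p q} in
theorem subFrechet_le_iff {ρ : ℝ} {x : ℝ × ℝ} (hx : IsSubcurve n x) (hk : 1 ≤ k) :
    subFrechet p x q ≤ ρ ↔ FreePath (Free p q ρ) x.1 0 x.2 ((k - 1 : ℕ) : ℝ) := by
  have hk' : ((k - 1 : ℕ) : ℝ) = (k : ℝ) - 1 := by push_cast [hk]; ring
  rw [hk']
  refine frechetDist_le_iff ?_ ?_ hx.2.1 ?_
  · refine (continuousOn_curve p n).mono (Set.Icc_subset_Icc hx.1 ?_)
    linarith [hx.2.2]
  · refine (continuousOn_curve q k).mono (Set.Icc_subset_Icc le_rfl ?_)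
    linarith
  · rw [← hk']
    positivity

end Curve

/-! ### Latest starts -/

/-- There is a path from the point with parameter `u` on the bottom line to `(s, t)`. -/
def Reach (F : ℝ → ℝ → Prop) (u s t : ℝ) : Prop := 0 ≤ u ∧ FreePath F u 0 s t

namespace Reach

variable {F : ℝ → ℝ → Prop} {u s t : ℝ}

theorem le (h : Reach F u s t) : u ≤ s := h.2.1

theorem free (h : Reach F u s t) : F s t := h.2.right

theorem step (h : Reach F u s t) (hF : CellConvex F) (i j : ℕ) {s' t' : ℝ} (h1 : (i : ℝ) ≤ s)
    (h2 : s ≤ s') (h3 : s' ≤ i + 1) (h4 : (j : ℝ) ≤ t) (h5 : t ≤ t') (h6 : t' ≤ j + 1)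
    (h7 : F s' t') : Reach F u s' t' :=
  ⟨h.1, h.2.trans (hF i j _ _ _ _ h1 h2 h3 h4 h5 h6 h.free h7)⟩

end Reach

/-- The pair `(a, b)` stands for the starts `u ≤ b` of paths to points `x ≥ a` with `u ≤ x` of the
line at height `t` in the column `[i, i + w]`. -/
structure IsEntry (F : ℝ → ℝ → Prop) (i : ℕ) (w t a b : ℝ) : Prop where
  left_le : (i : ℝ) ≤ a
  le_right : a ≤ i + w
  nonneg : 0 ≤ b
  start_le : b ≤ i + w
  reach : ∀ x, a ≤ x → x ≤ max a b → Reach F (min b x) x t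

/-- The entries `f` with `L ≤ f < R` describe the latest starts of paths to the points at height
`t` in the column `[i, i + w]`. Entries with negative second component are void. -/
structure ColumnOK (F : ℝ → ℝ → Prop) (i : ℕ) (w t : ℝ) (L R : ℕ) (a b : ℕ → ℝ) : Prop where
  sound : ∀ f, L ≤ f → f < R → b f ≤ -1 ∨ IsEntry F i w t (a f) (b f)
  complete : ∀ u x, (i : ℝ) ≤ x → x ≤ i + w → Reach F u x t → ∃ f, L ≤ f ∧ f < R ∧ a f ≤ x ∧ u ≤ b f
  sorted : ∀ f f', L ≤ f → f < f' → f' < R → 0 ≤ b f → 0 ≤ b f' → a f ≤ a f'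

/-- The entries `j` with `L ≤ j < R` describe the latest starts `S j` of paths to the points above
`(i, l + T j)` on the boundary of the column `[i, i + 1]` in row `l`. -/
structure QueueOK (F : ℝ → ℝ → Prop) (i l L R : ℕ) (T S : ℕ → ℝ) : Prop where
  sorted : ∀ j j', L ≤ j → j < j' → j' < R → T j' ≤ T j ∧ S j' ≤ S j
  sound : ∀ j, L ≤ j → j < R → 0 ≤ T j ∧ T j ≤ 1 ∧ Reach F (S j) i (l + T j)
  complete : ∀ u y : ℝ, 0 ≤ y → y ≤ 1 → u < i → Reach F u i (l + y) →
    ∃ j, L ≤ j ∧ j < R ∧ T j ≤ y ∧ u ≤ S j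

/-- The state of the queue while it is updated for the next column boundary. -/
structure Handover (F : ℝ → ℝ → Prop) (i l : ℕ) (lo : ℝ) (L R : ℕ) (T S : ℕ → ℝ) (σ : ℝ) :
    Prop where
  sorted : ∀ j j', L ≤ j → j < j' → j' < R → T j' ≤ T j ∧ S j' ≤ S j
  sound : ∀ j, L ≤ j → j < R → 0 ≤ T j ∧ T j ≤ 1 ∧ Reach F (S j) i (l + T j)
  out : σ ≤ -1 ∨ Reach F σ (i + 1) (l + lo)
  complete : ∀ u y : ℝ, 0 ≤ y → y ≤ 1 → u < i + 1 → Reach F u (i + 1) (l + y) →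
    (∃ j, L ≤ j ∧ j < R ∧ T j ≤ y ∧ u ≤ S j) ∨ u ≤ σ

/-! ### Propagation of latest starts through the cells of the free space. -/

section Dynamic

variable {F : ℝ → ℝ → Prop} {i l L R : ℕ} {w A B : ℝ} {a b T S : ℕ → ℝ}

/-- On the bottom line each free point is its own latest start, so the free interval itself serves
as the entry. -/
theorem isEntry_bottom (hAB : ∀ s, A ≤ s ∧ s ≤ B ↔ (i : ℝ) ≤ s ∧ s ≤ i + w ∧ F s 0) (h : A ≤ B) :
    IsEntry F i w 0 A B := by
  have hA := (hAB A).1 ⟨le_rfl, h⟩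
  have hB := (hAB B).1 ⟨h, le_rfl⟩
  have hi : (0 : ℝ) ≤ i := Nat.cast_nonneg i
  refine ⟨hA.1, hA.2.1, hi.trans hB.1, hB.2.1, fun x h1 h2 => ?_⟩
  rw [max_eq_right h] at h2
  rw [min_eq_right h2]
  exact ⟨hi.trans (hA.1.trans h1), .refl ((hAB x).1 ⟨h1, h2⟩).2.2⟩

theorem columnOK_bottom (hAB : ∀ s, A ≤ s ∧ s ≤ B ↔ (i : ℝ) ≤ s ∧ s ≤ i + w ∧ F s 0) {f : ℕ}
    (ha : A ≤ B → a f = A) (hb : A ≤ B → b f = B) (hb' : B < A → b f = -1) :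
    ColumnOK F i w 0 f (f + 1) a b := by
  constructor
  · intro g h1 h2
    obtain rfl : g = f := by omega
    rcases le_or_gt A B with h | h
    · right
      rw [ha h, hb h]
      exact isEntry_bottom hAB h
    · exact .inl (hb' h).le
  · intro u x h1 h2 h3
    have h4 := (hAB x).2 ⟨h1, h2, h3.free⟩
    have h5 := h4.1.trans h4.2
    exact ⟨f, le_rfl, by omega, by rw [ha h5]; exact h4.1, by rw [hb h5]; exact h3.le.trans h4.2⟩
  · intro g g' h1 h2 h3
    omega

/-- A point `x ≤ b` is reached by going straight up from `(x, l)`, which has start `x`. A point to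
the right of `max a b` is reached from `(max a b, l)`, which has start `b`. Starts beyond `B` may be
cut off, since no end point beyond `B` is free. -/
theorem IsEntry.next (hF : CellConvex F) (hw : w ≤ 1) {a b : ℝ} (h : IsEntry F i w l a b)
    (hAB : ∀ s, A ≤ s ∧ s ≤ B ↔ (i : ℝ) ≤ s ∧ s ≤ i + w ∧ F s ((l + 1 : ℕ) : ℝ))
    (hle : max a A ≤ B) : IsEntry F i w ((l + 1 : ℕ) : ℝ) (max a A) (min b B) := by
  have hi : (0 : ℝ) ≤ i := Nat.cast_nonneg i
  have haB := (le_max_left a A).trans hle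
  have hAB' := (le_max_right a A).trans hle
  have hB := (hAB B).1 ⟨hAB', le_rfl⟩
  refine ⟨h.left_le.trans (le_max_left _ _), hle.trans hB.2.1, le_min h.nonneg (hi.trans hB.1),
    (min_le_right _ _).trans hB.2.1, fun x h1 h2 => ?_⟩
  have hax := (le_max_left _ _).trans h1
  have hAx := (le_max_right _ _).trans h1
  have hxB : x ≤ B := h2.trans (max_le hle (min_le_right _ _))
  have hx := (hAB x).1 ⟨hAx, hxB⟩
  have hl : ((l + 1 : ℕ) : ℝ) = (l : ℝ) + 1 := by push_cast; rfl
  rw [min_assoc, min_eq_right hxB]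
  have hm : max a b ≤ x ∨ x ≤ b := by
    rcases le_total x b with h | h
    · exact .inr h
    · exact .inl (max_le hax h)
  rcases hm with hm | hm
  · have h3 := h.reach (max a b) (le_max_left _ _) le_rfl
    rw [min_eq_left (le_max_right _ _)] at h3
    rw [min_eq_left ((le_max_right _ _).trans hm)]
    exact h3.step hF i l (h.left_le.trans (le_max_left _ _)) hm (by linarith) le_rfl (by linarith)
      hl.le hx.2.2
  · rw [min_eq_right hm]
    have h3 := h.reach x hax (hm.trans (le_max_right _ _))
    rw [min_eq_right hm] at h3
    exact h3.step hF i l hx.1 le_rfl (by linarith) le_rfl (by linarith) hl.le hx.2.2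

/-- A path that crosses the left side of the cell started no later than `i ≤ A`. So `[A, max A σ]`
consists of `A` alone, and a single segment inside the cell suffices. -/
theorem IsEntry.of_reach (hF : CellConvex F) (hw : w ≤ 1) {σ y : ℝ} (hy0 : 0 ≤ y) (hy1 : y ≤ 1)
    (h : Reach F σ i (l + y))
    (hAB : ∀ s, A ≤ s ∧ s ≤ B ↔ (i : ℝ) ≤ s ∧ s ≤ i + w ∧ F s ((l + 1 : ℕ) : ℝ))
    (hle : A ≤ B) : IsEntry F i w ((l + 1 : ℕ) : ℝ) A σ := by
  have hA := (hAB A).1 ⟨le_rfl, hle⟩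
  have hl : ((l + 1 : ℕ) : ℝ) = (l : ℝ) + 1 := by push_cast; rfl
  refine ⟨hA.1, hA.2.1, h.1, h.le.trans (hA.1.trans hA.2.1), fun x h1 h2 => ?_⟩
  have hσA := h.le.trans hA.1
  obtain rfl : x = A := le_antisymm (h2.trans (max_le le_rfl hσA)) h1
  rw [min_eq_left hσA]
  exact h.step hF i l le_rfl hA.1 (by linarith [hA.2.1]) (by linarith) (by linarith) hl.le hA.2.2

/-- The next level of a column: the old entries are clipped to the free interval `[A, B]`, and the
front of the queue of the row gives a new entry. -/
theorem ColumnOK.next (hF : CellConvex F) (hw : w ≤ 1) (h : ColumnOK F i w l (L + 1) R a b)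
    (hAB : ∀ s, A ≤ s ∧ s ≤ B ↔ (i : ℝ) ≤ s ∧ s ≤ i + w ∧ F s ((l + 1 : ℕ) : ℝ))
    {L' R' : ℕ} (hq : QueueOK F i l L' R' T S) {σ : ℝ} (hσ : L' < R' → σ = S L')
    (hσ' : R' ≤ L' → σ = -1) (hLR : L + 1 ≤ R) {a' b' : ℕ → ℝ}
    (h1 : ∀ f, L + 1 ≤ f → f < R → max (a f) A ≤ B → a' f = max (a f) A ∧ b' f = min (b f) B)
    (h2 : ∀ f, L + 1 ≤ f → f < R → B < max (a f) A → b' f = -1)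
    (h3 : A ≤ B → a' L = A ∧ b' L = σ) (h4 : B < A → b' L = -1) :
    ColumnOK F i w ((l + 1 : ℕ) : ℝ) L R a' b' := by
  have hl : ((l + 1 : ℕ) : ℝ) = (l : ℝ) + 1 := by push_cast; rfl
  have hl0 : (0 : ℝ) ≤ l := Nat.cast_nonneg l
  have old : ∀ f, L + 1 ≤ f → f < R → 0 ≤ b' f →
      a' f = max (a f) A ∧ b' f = min (b f) B ∧ max (a f) A ≤ B ∧ 0 ≤ b f := by
    intro f hf1 hf2 hf3
    rcases le_or_gt (max (a f) A) B with hc | hc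
    · obtain ⟨e1, e2⟩ := h1 f hf1 hf2 hc
      exact ⟨e1, e2, hc, by rw [e2] at hf3; exact hf3.trans (min_le_left _ _)⟩
    · rw [h2 f hf1 hf2 hc] at hf3
      norm_num at hf3
  have new : 0 ≤ b' L → A ≤ B ∧ a' L = A := by
    intro h
    rcases le_or_gt A B with hc | hc
    · exact ⟨hc, (h3 hc).1⟩
    · rw [h4 hc] at h
      norm_num at h
  -- Paths that cross the level `l` inside the column, at `x₀`, are covered by the clipped old
  -- entries.
  have key : ∀ u x x₀ : ℝ, (i : ℝ) ≤ x₀ → x₀ ≤ x → x ≤ i + w → Reach F u x₀ l →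
      F x ((l + 1 : ℕ) : ℝ) → ∃ f, L ≤ f ∧ f < R ∧ a' f ≤ x ∧ u ≤ b' f := by
    intro u x x₀ g1 g2 g3 g4 g5
    obtain ⟨f, f1, f2, f3, f4⟩ := h.complete u x₀ g1 (g2.trans g3) g4
    have hx := (hAB x).2 ⟨g1.trans g2, g3, g5⟩
    have hm : max (a f) A ≤ x := max_le (f3.trans g2) hx.1
    obtain ⟨e1, e2⟩ := h1 f f1 f2 (hm.trans hx.2)
    exact ⟨f, by omega, f2, e1 ▸ hm, e2 ▸ le_min f4 (g4.le.trans (g2.trans hx.2))⟩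
  constructor
  · intro f hf1 hf2
    rcases Nat.lt_or_ge L f with hf | hf
    · rcases le_or_gt (max (a f) A) B with hc | hc
      · obtain ⟨e1, e2⟩ := h1 f hf hf2 hc
        rw [e1, e2]
        rcases h.sound f hf hf2 with hs | hs
        · exact .inl ((min_le_left _ _).trans hs)
        · exact .inr (hs.next hF hw hAB hc)
      · exact .inl (h2 f hf hf2 hc).le
    · obtain rfl : f = L := by omega
      rcases le_or_gt A B with hc | hc
      · obtain ⟨e1, e2⟩ := h3 hc
        rw [e1, e2]
        rcases Nat.lt_or_ge L' R' with hr | hr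
        · obtain ⟨g1, g2, g3⟩ := hq.sound L' le_rfl hr
          rw [hσ hr]
          exact .inr (.of_reach hF hw g1 g2 g3 hAB hc)
        · exact .inl (hσ' hr).le
      · exact .inl (h4 hc).le
  · intro u x g1 g2 g3
    -- A path that starts left of the column crosses the line `i`. If it does so below level `l`, it
    -- meets level `l` inside the column; otherwise it enters through the left side of the cell and
    -- is covered by the queue, whose front has the latest start. A path that starts in the column
    -- meets level `l` there.
    rcases lt_or_ge u i with hu | hu
    · obtain ⟨y, y1, y2, y3, y4⟩ := g3.2.split_fst hu.le g1
      rcases le_total y l with hy | hy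
      · obtain ⟨x₀, x1, x2, x3, x4⟩ := y4.split_snd hy (by linarith)
        exact key u x x₀ x1 x2 g2 ⟨g3.1, y3.trans x3⟩ g3.free
      · obtain ⟨j, j1, j2, j3, j4⟩ := hq.complete u (y - l) (by linarith) (by linarith) hu
          ⟨g3.1, by rwa [add_sub_cancel]⟩
        have hr : L' < R' := by omega
        have hSj : S j ≤ S L' := by
          rcases Nat.lt_or_ge L' j with hj | hj
          · exact (hq.sorted L' j le_rfl hj j2).2
          · obtain rfl : j = L' := by omega
            exact le_rfl
        have hx := (hAB x).2 ⟨g1, g2, g3.free⟩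
        obtain ⟨e1, e2⟩ := h3 (hx.1.trans hx.2)
        exact ⟨L, le_rfl, by omega, e1 ▸ hx.1, by rw [e2, hσ hr]; exact j4.trans hSj⟩
    · obtain ⟨x₀, x1, x2, x3, x4⟩ := g3.2.split_snd hl0 (by linarith)
      exact key u x x₀ (hu.trans x1) x2 g2 ⟨g3.1, x3⟩ g3.free
  · intro f f' g1 g2 g3 g4 g5
    obtain ⟨e1, e2, e3, e4⟩ := old f' (by omega) g3 g5
    rw [e1]
    rcases Nat.lt_or_ge L f with hf | hf
    · obtain ⟨e1', e2', e3', e4'⟩ := old f (by omega) (by omega) g4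
      rw [e1']
      exact max_le_max (h.sorted f f' hf g2 g3 e4' e4) le_rfl
    · obtain rfl : f = L := by omega
      rw [(new g4).2]
      exact le_max_right _ _

theorem queueOK_zero (l L : ℕ) : QueueOK F 0 l L L T S := by
  refine ⟨fun j j' h1 h2 h3 => by omega, fun j h1 h2 => by omega, fun u y h1 h2 h3 h4 => ?_⟩
  have := h4.1
  simp only [Nat.cast_zero] at h3
  linarith

/-- Besides the paths in the queue, the right side of the cell is reached by paths that cross level
`l` in this column. From that level every free height on the right side is within reach, in
particular the lowest one, so only the maximum `σ` of their starts matters. -/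
theorem Handover.start (hF : CellConvex F) (hq : QueueOK F i l L R T S) {L' R' : ℕ}
    (hc : ColumnOK F i 1 l L' R' a b) {lo hi σ : ℝ}
    (hlh : ∀ y, lo ≤ y ∧ y ≤ hi ↔ 0 ≤ y ∧ y ≤ 1 ∧ F ((i : ℝ) + 1) (l + y)) (hle : lo ≤ hi)
    (h1 : ∀ f, L' ≤ f → f < R' → b f ≤ σ) (h2 : σ ≤ -1 ∨ ∃ f, L' ≤ f ∧ f < R' ∧ σ = b f) :
    Handover F i l lo L R T S σ := by
  have hlo := (hlh lo).1 ⟨le_rfl, hle⟩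
  have hl0 : (0 : ℝ) ≤ l := Nat.cast_nonneg l
  refine ⟨hq.sorted, hq.sound, ?_, fun u y g1 g2 g3 g4 => ?_⟩
  · rcases h2 with h2 | ⟨f, f1, f2, rfl⟩
    · exact .inl h2
    · refine (hc.sound f f1 f2).imp id fun hs => ?_
      have h3 := hs.reach (max (a f) (b f)) (le_max_left _ _) le_rfl
      rw [min_eq_left (le_max_right _ _)] at h3
      exact h3.step hF i l (hs.left_le.trans (le_max_left _ _)) (max_le hs.le_right hs.start_le)
        le_rfl le_rfl (by linarith) (by linarith) hlo.2.2
  · have key : ∀ x₀ : ℝ, (i : ℝ) ≤ x₀ → x₀ ≤ i + 1 → Reach F u x₀ l → u ≤ σ := by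
      intro x₀ x1 x2 x3
      obtain ⟨f, f1, f2, -, f4⟩ := hc.complete u x₀ x1 x2 x3
      exact f4.trans (h1 f f1 f2)
    rcases lt_or_ge u i with hu | hu
    · obtain ⟨y', y1, y2, y3, y4⟩ := g4.2.split_fst hu.le (by linarith)
      rcases le_total y' l with hy | hy
      · obtain ⟨x₀, x1, x2, x3, x4⟩ := y4.split_snd hy (by linarith)
        exact .inr (key x₀ x1 x2 ⟨g4.1, y3.trans x3⟩)
      · obtain ⟨j, j1, j2, j3, j4⟩ := hq.complete u (y' - l) (by linarith) (by linarith) hu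
          ⟨g4.1, by rwa [add_sub_cancel]⟩
        exact .inl ⟨j, j1, j2, by linarith, j4⟩
    · obtain ⟨x₀, x1, x2, x3, x4⟩ := g4.2.split_snd hl0 (by linarith)
      exact .inr (key x₀ (hu.trans x1) x2 ⟨g4.1, x3⟩)

/-- A path through the front element arrives at height at least `T L`, where the right side is no
longer free. -/
theorem Handover.pop_front {lo hi σ : ℝ} (h : Handover F i l lo L R T S σ)
    (hlh : ∀ y, lo ≤ y ∧ y ≤ hi ↔ 0 ≤ y ∧ y ≤ 1 ∧ F ((i : ℝ) + 1) (l + y)) (hT : hi < T L) :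
    Handover F i l lo (L + 1) R T S σ := by
  refine ⟨fun j j' h1 => h.sorted j j' (by omega), fun j h1 => h.sound j (by omega), h.out, ?_⟩
  intro u y g1 g2 g3 g4
  refine (h.complete u y g1 g2 g3 g4).imp ?_ id
  rintro ⟨j, j1, j2, j3, j4⟩
  refine ⟨j, ?_, j2, j3, j4⟩
  have := ((hlh y).2 ⟨g1, g2, g4.free⟩).2
  rcases Nat.lt_or_ge L j with hj | hj
  · exact hj
  · obtain rfl : j = L := by omega
    linarith

/-- An element with `T R ≤ lo` can only arrive at `lo` or above, and it does reach `lo`, so its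
start is absorbed into `σ`. An element with `S R ≤ σ` is superseded by `(lo, σ)`, because no free
height lies below `lo`. -/
theorem Handover.pop_back (hF : CellConvex F) {lo hi σ : ℝ}
    (h : Handover F i l lo L (R + 1) T S σ)
    (hlh : ∀ y, lo ≤ y ∧ y ≤ hi ↔ 0 ≤ y ∧ y ≤ 1 ∧ F ((i : ℝ) + 1) (l + y)) (hle : lo ≤ hi)
    (hLR : L ≤ R) (hT : T R ≤ lo ∨ S R ≤ σ) : Handover F i l lo L R T S (max σ (S R)) := by
  have hlo := (hlh lo).1 ⟨le_rfl, hle⟩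
  refine ⟨fun j j' h1 h2 h3 => h.sorted j j' h1 h2 (by omega),
    fun j h1 h2 => h.sound j h1 (by omega), ?_, ?_⟩
  · rcases le_total (S R) σ with hS | hS
    · rw [max_eq_left hS]
      exact h.out
    rcases hT with hT | hT
    · rw [max_eq_right hS]
      obtain ⟨g1, g2, g3⟩ := h.sound R hLR (by omega)
      exact .inr (g3.step hF i l le_rfl (by linarith) le_rfl (by linarith) (by linarith)
        (by linarith) hlo.2.2)
    · rw [max_eq_left hT]
      exact h.out
  · intro u y g1 g2 g3 g4
    rcases h.complete u y g1 g2 g3 g4 with ⟨j, j1, j2, j3, j4⟩ | h'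
    · rcases Nat.lt_or_ge j R with hj | hj
      · exact .inl ⟨j, j1, hj, j3, j4⟩
      · obtain rfl : j = R := by omega
        exact .inr (j4.trans (le_max_right _ _))
    · exact .inr (h'.trans (le_max_left _ _))

/-- The surviving heights lie in the free interval of the right side, so each element moves there
horizontally. With `σ ≤ -1` there is nothing to append, as starts are nonnegative. -/
theorem Handover.queueOK (hF : CellConvex F) {lo hi σ : ℝ} (h : Handover F i l lo L R T S σ)
    (hlh : ∀ y, lo ≤ y ∧ y ≤ hi ↔ 0 ≤ y ∧ y ≤ 1 ∧ F ((i : ℝ) + 1) (l + y))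
    (h1 : L < R → T L ≤ hi) (h2 : L < R → lo < T (R - 1)) (h3 : σ ≤ -1) :
    QueueOK F (i + 1) l L R T S := by
  refine ⟨h.sorted, fun j j1 j2 => ?_, fun u y g1 g2 g3 g4 => ?_⟩
  · obtain ⟨t1, t2, t3⟩ := h.sound j j1 j2
    have hhi : T j ≤ hi := by
      rcases Nat.lt_or_ge L j with hj | hj
      · exact (h.sorted L j le_rfl hj j2).1.trans (h1 (by omega))
      · obtain rfl : j = L := by omega
        exact h1 j2
    have hlo : lo ≤ T j := by
      refine (h2 (by omega)).le.trans ?_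
      rcases Nat.lt_or_ge j (R - 1) with hj | hj
      · exact (h.sorted j (R - 1) j1 hj (by omega)).1
      · obtain rfl : j = R - 1 := by omega
        exact le_rfl
    have := (hlh (T j)).1 ⟨hlo, hhi⟩
    refine ⟨t1, t2, ?_⟩
    push_cast
    exact t3.step hF i l le_rfl (by linarith) le_rfl (by linarith) le_rfl (by linarith) this.2.2
  · push_cast at g3 g4
    rcases h.complete u y g1 g2 g3 g4 with h' | h'
    · exact h'
    · have := g4.1
      linarith

/-- After the removals every element has height above `lo` and start above `σ`. So `(lo, σ)` fits at
the back, and the queue stays decreasing in both components. -/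
theorem Handover.push (hF : CellConvex F) {lo hi σ : ℝ} (h : Handover F i l lo L R T S σ)
    (hlh : ∀ y, lo ≤ y ∧ y ≤ hi ↔ 0 ≤ y ∧ y ≤ 1 ∧ F ((i : ℝ) + 1) (l + y)) (hle : lo ≤ hi)
    (h1 : L < R → T L ≤ hi) (h2 : L < R → lo < T (R - 1)) (h3 : L < R → σ < S (R - 1))
    (h4 : 0 ≤ σ) (hLR : L ≤ R) {T' S' : ℕ → ℝ} (hT : ∀ j < R, T' j = T j) (hT' : T' R = lo)
    (hS : ∀ j < R, S' j = S j) (hS' : S' R = σ) : QueueOK F (i + 1) l L (R + 1) T' S' := by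
  have hlo := (hlh lo).1 ⟨le_rfl, hle⟩
  have low : ∀ j, L ≤ j → j < R → lo < T j ∧ σ < S j := by
    intro j j1 j2
    rcases Nat.lt_or_ge j (R - 1) with hj | hj
    · have := h.sorted j (R - 1) j1 hj (by omega)
      exact ⟨(h2 (by omega)).trans_le this.1, (h3 (by omega)).trans_le this.2⟩
    · obtain rfl : j = R - 1 := by omega
      exact ⟨h2 (by omega), h3 (by omega)⟩
  refine ⟨fun j j' j1 j2 j3 => ?_, fun j j1 j2 => ?_, fun u y g1 g2 g3 g4 => ?_⟩
  · rw [hT j (by omega), hS j (by omega)]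
    rcases Nat.lt_or_ge j' R with hj | hj
    · rw [hT j' hj, hS j' hj]
      exact h.sorted j j' j1 j2 hj
    · obtain rfl : j' = R := by omega
      rw [hT', hS']
      have := low j j1 (by omega)
      exact ⟨this.1.le, this.2.le⟩
  · rcases Nat.lt_or_ge j R with hj | hj
    · rw [hT j hj, hS j hj]
      obtain ⟨t1, t2, t3⟩ := h.sound j j1 hj
      have hhi : T j ≤ hi := by
        rcases Nat.lt_or_ge L j with hj' | hj'
        · exact (h.sorted L j le_rfl hj' hj).1.trans (h1 (by omega))
        · obtain rfl : j = L := by omega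
          exact h1 hj
      have := (hlh (T j)).1 ⟨(low j j1 hj).1.le, hhi⟩
      refine ⟨t1, t2, ?_⟩
      push_cast
      exact t3.step hF i l le_rfl (by linarith) le_rfl (by linarith) le_rfl (by linarith) this.2.2
    · obtain rfl : j = R := by omega
      rw [hT', hS']
      refine ⟨hlo.1, hlo.2.1, ?_⟩
      rcases h.out with h' | h'
      · linarith
      · push_cast
        exact h'
  · push_cast at g3 g4
    rcases h.complete u y g1 g2 g3 g4 with ⟨j, j1, j2, j3, j4⟩ | h'
    · exact ⟨j, j1, by omega, by rw [hT j j2]; exact j3, by rw [hS j j2]; exact j4⟩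
    · exact ⟨R, hLR, by omega, by rw [hT']; exact ((hlh y).2 ⟨g1, g2, g4.free⟩).1,
        by rw [hS']; exact h'⟩

theorem queueOK_of_empty {lo hi : ℝ}
    (hlh : ∀ y, lo ≤ y ∧ y ≤ hi ↔ 0 ≤ y ∧ y ≤ 1 ∧ F ((i : ℝ) + 1) (l + y)) (h : hi < lo) :
    QueueOK F (i + 1) l L L T S := by
  refine ⟨fun j j' h1 h2 h3 => by omega, fun j h1 h2 => by omega, fun u y g1 g2 g3 g4 => ?_⟩
  push_cast at g4
  have := (hlh y).2 ⟨g1, g2, g4.free⟩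
  linarith [this.1, this.2]

end Dynamic

open scoped Program

/-! ### The intersection of a segment and a ball -/

theorem norm_le_iff_sum_range {d : ℕ} (v : EuclideanSpace ℝ (Fin d)) {f : ℕ → ℝ}
    (hf : ∀ (l : ℕ) (h : l < d), v ⟨l, h⟩ = f l) {ρ : ℝ} (hρ : 0 ≤ ρ) :
    ‖v‖ ≤ ρ ↔ ∑ l ∈ Finset.range d, f l ^ 2 ≤ ρ ^ 2 := by
  rw [EuclideanSpace.norm_eq, Real.sqrt_le_left hρ, ← Fin.sum_univ_eq_sum_range (fun l => f l ^ 2)]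
  simp only [Real.norm_eq_abs, sq_abs]
  rw [Finset.sum_congr rfl fun (l : Fin d) _ => by rw [hf l.1 l.2]]

/-- Beyond the last vertex both sides have the default value 0, so no bound on `i` is required. -/
theorem coords_mul_add {n d : ℕ} (p : Fin n → EuclideanSpace ℝ (Fin d)) (i l : ℕ) (hl : l < d) :
    coords p (i * d + l) = vertex p i ⟨l, hl⟩ := by
  have hd : 0 < d := by omega
  unfold coords vertex
  by_cases hi : i < n
  · have h : i * d + l < n * d := by
      calc i * d + l < i * d + d := by omega
        _ = (i + 1) * d := by ring
        _ ≤ n * d := Nat.mul_le_mul_right _ hi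
    rw [dif_pos h, dif_pos hi]
    have e1 : (⟨i * d + l, h⟩ : Fin (n * d)).divNat = ⟨i, hi⟩ := by
      ext
      simp only [Fin.coe_divNat]
      rw [add_comm, Nat.add_mul_div_right _ _ hd, Nat.div_eq_of_lt hl, zero_add]
    have e2 : (⟨i * d + l, h⟩ : Fin (n * d)).modNat = ⟨l, hl⟩ := by
      ext
      simp only [Fin.coe_modNat]
      rw [add_comm, Nat.add_mul_mod_self_right, Nat.mod_eq_of_lt hl]
    rw [e1, e2]
  · have h : ¬ i * d + l < n * d := by
      have : n * d ≤ i * d := Nat.mul_le_mul_right _ (by omega)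
      omega
    rw [dif_neg h, dif_neg hi]
    rfl

theorem quadratic_le_iff {a b c y : ℝ} (ha : 0 < a) (hd : 0 ≤ b * b - a * c) :
    a * y ^ 2 - 2 * b * y + c ≤ 0 ↔
      (b - √(b * b - a * c)) / a ≤ y ∧ y ≤ (b + √(b * b - a * c)) / a := by
  have h1 : a * y ^ 2 - 2 * b * y + c ≤ 0 ↔ (a * y - b) ^ 2 ≤ √(b * b - a * c) ^ 2 := by
    rw [Real.sq_sqrt hd]
    constructor
    · intro h
      nlinarith
    · intro h
      by_contra! h'
      nlinarith [mul_pos ha h']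
  rw [h1, sq_le_sq, abs_of_nonneg (Real.sqrt_nonneg _), abs_le, div_le_iff₀ ha, le_div_iff₀ ha]
  constructor <;> rintro ⟨h2, h3⟩ <;> constructor <;> linarith

theorem quadratic_pos {a b c : ℝ} (y : ℝ) (ha : 0 < a) (hd : b * b - a * c < 0) :
    0 < a * y ^ 2 - 2 * b * y + c := by
  by_contra! h
  nlinarith [sq_nonneg (a * y - b)]

/-- The memories agree in the input, the integer variables and the array `q`. -/
structure Memory.SameInput (m m' : Memory) : Prop where
  inp : m' .inp = m .inp
  int : ∀ x, m'.I x = m.I x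
  q : ∀ i : ℕ, m'.R .q i = m.R .q i

/-- The parameters in `[0, w]` of the points of the segment from `x` to `y` whose distance to `z`
is at most `rho` form the interval from `lo` to `hi`. -/
def clipProg (d : ℕ) (x y z : ℕ → Exp .real) (w : Exp .real) : Program :=
  RVar.aa.set (.sum d fun l => .mulR (.subR (y l) (x l)) (.subR (y l) (x l))) ;;
  RVar.bb.set (.sum d fun l => .mulR (.subR (y l) (x l)) (.subR (z l) (x l))) ;;
  RVar.cc.set (.subR (.sum d fun l => .mulR (.subR (z l) (x l)) (.subR (z l) (x l)))
    (.mulR RVar.rho.e RVar.rho.e)) ;;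
  .branch (.leR RVar.aa.e (.litR 0))
    (.branch (.leR RVar.cc.e (.litR 0))
      (RVar.lo.set (.litR 0) ;; RVar.hi.set w)
      (RVar.lo.set (.litR 1) ;; RVar.hi.set (.litR (-1))))
    (.branch (.ltR (.subR (.mulR RVar.bb.e RVar.bb.e) (.mulR RVar.aa.e RVar.cc.e)) (.litR 0))
      (RVar.lo.set (.litR 1) ;; RVar.hi.set (.litR (-1)))
      (RVar.lo.set (.max (.litR 0) (.divR (.subR RVar.bb.e
        (.sqrt (.subR (.mulR RVar.bb.e RVar.bb.e) (.mulR RVar.aa.e RVar.cc.e)))) RVar.aa.e)) ;;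
      RVar.hi.set (.min w (.divR (.addR RVar.bb.e
        (.sqrt (.subR (.mulR RVar.bb.e RVar.bb.e) (.mulR RVar.aa.e RVar.cc.e)))) RVar.aa.e))))

theorem loopFree_clipProg (d : ℕ) (x y z : ℕ → Exp .real) (w : Exp .real) :
    (clipProg d x y z w).LoopFree := by
  simp [clipProg]

/-- The squared distance from `z`, minus the squared radius, is the quadratic `a t² - 2 b t + c` in
the parameter `t`. Its solution set is read off from the discriminant and intersected with `[0,
w']`. -/
theorem den_clipProg {d : ℕ} {x y z : ℕ → Exp .real} {w : Exp .real} {m : Memory}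
    {x' y' z' : ℕ → ℝ} {w' : ℝ}
    (hx : ∀ m', m.SameInput m' → ∀ l < d, (x l).eval m' = x' l)
    (hy : ∀ m', m.SameInput m' → ∀ l < d, (y l).eval m' = y' l)
    (hz : ∀ m', m.SameInput m' → ∀ l < d, (z l).eval m' = z' l)
    (hw : ∀ m', m.SameInput m' → w.eval m' = w') :
    ∃ a b c lo hi : ℝ, (clipProg d x y z w).den m = ((((m.putR .aa 0 a).putR .bb 0 b).putR .cc 0
        c).putR .lo 0 lo).putR .hi 0 hi ∧
      ∀ t, lo ≤ t ∧ t ≤ hi ↔ 0 ≤ t ∧ t ≤ w' ∧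
        ∑ l ∈ Finset.range d, ((1 - t) * x' l + t * y' l - z' l) ^ 2 ≤ m.R .rho 0 ^ 2 := by
  set a := ∑ l ∈ Finset.range d, (y' l - x' l) * (y' l - x' l) with ha
  set b := ∑ l ∈ Finset.range d, (y' l - x' l) * (z' l - x' l) with hb
  set c := (∑ l ∈ Finset.range d, (z' l - x' l) * (z' l - x' l)) - m.R .rho 0 * m.R .rho 0 with hc
  have e1 : (RVar.aa.set (.sum d fun l => .mulR (.subR (y l) (x l)) (.subR (y l) (x l)))).den m =
      m.putR .aa 0 a := by
    simp only [Program.den_setR, Exp.eval_sum, Exp.eval_mulR, Exp.eval_subR]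
    congr 1
    refine Finset.sum_congr rfl fun l hl => ?_
    rw [hx m ⟨rfl, fun _ => rfl, fun _ => rfl⟩ l (Finset.mem_range.1 hl),
      hy m ⟨rfl, fun _ => rfl, fun _ => rfl⟩ l (Finset.mem_range.1 hl)]
  set m1 := m.putR .aa 0 a with hm1
  have s1 : m.SameInput m1 := ⟨by simp [hm1], by simp [hm1], by simp [hm1]⟩
  have e2 : (RVar.bb.set (.sum d fun l => .mulR (.subR (y l) (x l)) (.subR (z l) (x l)))).den m1 =
      m1.putR .bb 0 b := by
    simp only [Program.den_setR, Exp.eval_sum, Exp.eval_mulR, Exp.eval_subR]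
    congr 1
    refine Finset.sum_congr rfl fun l hl => ?_
    rw [hx m1 s1 l (Finset.mem_range.1 hl), hy m1 s1 l (Finset.mem_range.1 hl),
      hz m1 s1 l (Finset.mem_range.1 hl)]
  set m2 := m1.putR .bb 0 b with hm2
  have s2 : m.SameInput m2 := ⟨by simp [hm2, hm1], by simp [hm2, hm1], by simp [hm2, hm1]⟩
  have e3 : (RVar.cc.set (.subR (.sum d fun l => .mulR (.subR (z l) (x l)) (.subR (z l) (x l)))
      (.mulR RVar.rho.e RVar.rho.e))).den m2 = m2.putR .cc 0 c := by
    simp only [Program.den_setR, Exp.eval_sum, Exp.eval_mulR, Exp.eval_subR, Exp.eval_rvar]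
    have : m2.R .rho 0 = m.R .rho 0 := by simp [hm2, hm1]
    rw [this, hc]
    congr 2
    refine Finset.sum_congr rfl fun l hl => ?_
    rw [hx m2 s2 l (Finset.mem_range.1 hl), hz m2 s2 l (Finset.mem_range.1 hl)]
  set m3 := m2.putR .cc 0 c with hm3
  have s4 : ∀ v, m.SameInput (m3.putR .lo 0 v) := fun v =>
    ⟨by simp [hm3, hm2, hm1], by simp [hm3, hm2, hm1], by simp [hm3, hm2, hm1]⟩
  have hsum : ∀ t, ∑ l ∈ Finset.range d, ((1 - t) * x' l + t * y' l - z' l) ^ 2 ≤ m.R .rho 0 ^ 2 ↔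
      a * t ^ 2 - 2 * b * t + c ≤ 0 := by
    intro t
    have : ∑ l ∈ Finset.range d, ((1 - t) * x' l + t * y' l - z' l) ^ 2 =
        a * t ^ 2 - 2 * b * t + (c + m.R .rho 0 * m.R .rho 0) := by
      rw [ha, hb, hc, sub_add_cancel, Finset.sum_mul, Finset.mul_sum, Finset.sum_mul,
        ← Finset.sum_sub_distrib, ← Finset.sum_add_distrib]
      exact Finset.sum_congr rfl fun l _ => by ring
    rw [this]
    constructor <;> intro h <;> nlinarith
  have va : m3.R .aa 0 = a := by simp [hm3, hm2, hm1]
  have vb : m3.R .bb 0 = b := by simp [hm3, hm2]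
  have vc : m3.R .cc 0 = c := by simp [hm3]
  have ha0 : 0 ≤ a := Finset.sum_nonneg fun l _ => mul_self_nonneg _
  classical
  simp only [clipProg, Program.den_seq, e1, e2, e3, Program.den_branch, Test.holds_leR,
    Test.holds_ltR, Exp.eval_rvar, Exp.eval_subR, Exp.eval_mulR, Exp.eval_litR, va, vb, vc,
    Program.den_setR, Rat.cast_zero, Rat.cast_one, Rat.cast_neg, hw _ (s4 _), Exp.eval_max,
    Exp.eval_min, Exp.eval_divR, Exp.eval_addR, Exp.eval_sqrt, Memory.R_putR_zero, reduceCtorEq,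
    false_and, if_false]
  -- Here the segment is a single point: `a = 0` forces `b = 0`, and the condition no longer depends
  -- on `t`.
  by_cases h0 : a ≤ 0
  · have ha' : a = 0 := le_antisymm h0 ha0
    have hb' : b = 0 := by
      refine Finset.sum_eq_zero fun l hl => ?_
      have := (Finset.sum_eq_zero_iff_of_nonneg fun l _ => mul_self_nonneg (y' l - x' l)).1 ha' l hl
      rw [mul_self_eq_zero.1 this, zero_mul]
    rw [if_pos h0]
    by_cases h1 : c ≤ 0
    · rw [if_pos h1]
      refine ⟨a, b, c, 0, w', rfl, fun t => ?_⟩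
      rw [hsum t, ha', hb']
      constructor
      · rintro ⟨g1, g2⟩
        exact ⟨g1, g2, by linarith⟩
      · rintro ⟨g1, g2, -⟩
        exact ⟨g1, g2⟩
    · rw [if_neg h1]
      -- The pair `1, -1` encodes the empty interval.
      refine ⟨a, b, c, 1, -1, rfl, fun t => ?_⟩
      rw [hsum t, ha', hb']
      constructor
      · rintro ⟨g1, g2⟩
        linarith
      · rintro ⟨-, -, g⟩
        exact absurd (by linarith) h1
  · rw [if_neg h0]
    push Not at h0
    by_cases h1 : b * b - a * c < 0
    · rw [if_pos h1]
      refine ⟨a, b, c, 1, -1, rfl, fun t => ?_⟩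
      rw [hsum t]
      constructor
      · rintro ⟨g1, g2⟩
        linarith
      · rintro ⟨-, -, g⟩
        exact absurd g (not_le.2 (quadratic_pos t h0 h1))
    · rw [if_neg h1]
      refine ⟨a, b, c, _, _, rfl, fun t => ?_⟩
      rw [hsum t, quadratic_le_iff h0 (not_lt.1 h1), max_le_iff, le_min_iff]
      tauto

/-! ### Free intervals of a column -/

/-- The second memory agrees with the first one except in the working variables of the algorithm
for a single curve. -/
structure Memory.Kept (m m' : Memory) : Prop where
  inp : m' .inp = m .inp
  ds : m' .ds = m .ds
  idx : m'.I .idx = m.I .idx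
  num : m'.I .num = m.I .num
  side : m'.I .side = m.I .side
  rho : m'.R .rho 0 = m.R .rho 0
  base : m'.I .base = m.I .base
  step : m'.R .step 0 = m.R .step 0
  q : ∀ i : ℕ, m'.R .q i = m.R .q i

theorem Memory.Kept.refl (m : Memory) : m.Kept m :=
  ⟨rfl, rfl, rfl, rfl, rfl, rfl, rfl, rfl, fun _ => rfl⟩

theorem Memory.Kept.trans {m m' m'' : Memory} (h : m.Kept m') (h' : m'.Kept m'') : m.Kept m'' :=
  ⟨h'.inp.trans h.inp, h'.ds.trans h.ds, h'.idx.trans h.idx, h'.num.trans h.num,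
    h'.side.trans h.side, h'.rho.trans h.rho, h'.base.trans h.base, h'.step.trans h.step,
    fun i => (h'.q i).trans (h.q i)⟩

/-- The input bank holds `p` and `k`, the array `q` holds the curve `c`, and `rho` is the
distance. -/
structure Holds {n k d : ℕ} (p : Fin n → EuclideanSpace ℝ (Fin d)) (δ ε : ℝ)
    (c : Fin k → EuclideanSpace ℝ (Fin d)) (ρ : ℝ) (m : Memory) : Prop where
  inp : m .inp = constructionStart p k δ ε .inp
  q : ∀ j < k, ∀ (l : ℕ) (h : l < d), m.R .q (j * d + l : ℕ) = vertex c j ⟨l, h⟩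
  rho : m.R .rho 0 = ρ
  nonneg : 0 ≤ ρ

theorem Holds.kept {n k d : ℕ} {p : Fin n → EuclideanSpace ℝ (Fin d)} {δ ε : ℝ}
    {c : Fin k → EuclideanSpace ℝ (Fin d)} {ρ : ℝ} {m m' : Memory} (h : Holds p δ ε c ρ m)
    (h' : m.Kept m') : Holds p δ ε c ρ m' :=
  ⟨h'.inp.trans h.inp, fun j hj l hl => (h'.q _).trans (h.q j hj l hl), h'.rho.trans h.rho,
    h.nonneg⟩

/-- The number of vertices of the input curve. -/
def numE : Exp .int := .getI .inp (.litI 0)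

/-- The number of vertices of the query curves. -/
def lenE : Exp .int := .getI .inp (.litI 1)

/-- Coordinate `l` of vertex `i` of the input curve. -/
def vertP (d : ℕ) (i : Exp .int) (l : ℕ) : Exp .real :=
  .getR .inp (.addI (.mulI i (.litI d)) (.litI (l + 2 : ℕ)))

/-- Coordinate `l` of vertex `j` of the curve in the array `q`. -/
def vertQ (d : ℕ) (j : Exp .int) (l : ℕ) : Exp .real :=
  RVar.q.get (.addI (.mulI j (.litI d)) (.litI l))

/-- The width of column `i` of a curve with `n` vertices. -/
noncomputable def width (n i : ℕ) : ℝ := min 1 ((n : ℝ) - 1 - i)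

theorem width_le_one (n i : ℕ) : width n i ≤ 1 := min_le_left _ _

theorem width_eq_one {n i : ℕ} (h : i + 1 < n) : width n i = 1 := by
  have : (i : ℝ) + 2 ≤ n := by exact_mod_cast h
  exact min_eq_left (by linarith)

/-- The free interval of the current column at height `lev`, as the interval from `ca` to `cb`. -/
def levelProg (d : ℕ) (lev : Exp .int) : Program :=
  clipProg d (vertP d IVar.col.e) (vertP d (.addI IVar.col.e (.litI 1))) (vertQ d lev)
    (.min (.litR 1) (.ofInt (.subI (.subI numE (.litI 1)) IVar.col.e))) ;;
  RVar.ca.set (.addR (.ofInt IVar.col.e) RVar.lo.e) ;;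
  RVar.cb.set (.addR (.ofInt IVar.col.e) RVar.hi.e)

/-- The free interval in the row `lev` of the boundary after the current column. -/
def boundaryProg (d : ℕ) : Program :=
  clipProg d (vertQ d IVar.lev.e) (vertQ d (.addI IVar.lev.e (.litI 1)))
    (vertP d (.addI IVar.col.e (.litI 1))) (.litR 1)

section

variable {n k d : ℕ} {p : Fin n → EuclideanSpace ℝ (Fin d)} {δ ε : ℝ}
  {c : Fin k → EuclideanSpace ℝ (Fin d)} {ρ : ℝ} {m : Memory}

theorem Holds.eval_numE (h : m .inp = constructionStart p k δ ε .inp) : numE.eval m = (n : ℤ) := by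
  simp [numE, h, constructionStart]

theorem Holds.eval_lenE (h : m .inp = constructionStart p k δ ε .inp) : lenE.eval m = (k : ℤ) := by
  simp [lenE, h, constructionStart]

theorem eval_vertP (h : m .inp = constructionStart p k δ ε .inp) {e : Exp .int} {i : ℕ}
    (he : e.eval m = (i : ℤ)) {l : ℕ} (hl : l < d) :
    (vertP d e l).eval m = vertex p i ⟨l, hl⟩ := by
  have e1 : (i : ℤ) * d + ((l + 2 : ℕ) : ℤ) = ((i * d + l + 2 : ℕ) : ℤ) := by push_cast; ring
  simp only [vertP, Exp.eval_getR, Exp.eval_addI, Exp.eval_mulI, Exp.eval_litI, he, e1, h,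
    Int.toNat_natCast]
  rw [← coords_mul_add]
  simp [constructionStart]

theorem Holds.eval_vertQ (h : Holds p δ ε c ρ m) {m' : Memory} (hm : m.SameInput m') {e : Exp .int}
    {j : ℕ} (he : e.eval m' = (j : ℤ)) (hj : j < k) {l : ℕ} (hl : l < d) :
    (vertQ d e l).eval m' = if h : l < d then vertex c j ⟨l, h⟩ else 0 := by
  have e1 : (j : ℤ) * d + (l : ℤ) = ((j * d + l : ℕ) : ℤ) := by push_cast; ring
  simp only [vertQ, Exp.eval_get, Exp.eval_addI, Exp.eval_mulI, Exp.eval_litI, he, e1, hl,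
    dite_true, hm.q]
  exact h.q j hj l hl

/-- The formula also covers column `n - 1`, which has width 0 and consists of the last vertex alone.
There the vertex with index `n` is the default 0 in the memory as well as in `vertex`. -/
theorem den_levelProg (h : Holds p δ ε c ρ m) {i l : ℕ} (hi : m.I .col = (i : ℤ)) (hl : l < k)
    {e : Exp .int} (he : ∀ m', m.SameInput m' → e.eval m' = (l : ℤ)) :
    ∃ a b c' lo hi A B : ℝ, (levelProg d e).den m = ((((((m.putR .aa 0 a).putR .bb 0 b).putR .cc 0
        c').putR .lo 0 lo).putR .hi 0 hi).putR .ca 0 A).putR .cb 0 B ∧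
      ∀ s, A ≤ s ∧ s ≤ B ↔ (i : ℝ) ≤ s ∧ s ≤ i + width n i ∧ Free p c ρ s l := by
  have hp : ∀ m', m.SameInput m' → ∀ (j : ℕ) (e : Exp .int), e.eval m' = (j : ℤ) →
      ∀ l < d, (vertP d e l).eval m' = if h : l < d then vertex p j ⟨l, h⟩ else 0 := by
    intro m' hm' j e he l hl
    rw [dif_pos hl]
    exact eval_vertP (hm'.inp.trans h.inp) he hl
  obtain ⟨a, b, c', lo, hi', e1, e2⟩ := den_clipProg (d := d)
    (x := vertP d IVar.col.e) (y := vertP d (.addI IVar.col.e (.litI 1))) (z := vertQ d e)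
    (w := .min (.litR 1) (.ofInt (.subI (.subI numE (.litI 1)) IVar.col.e))) (w' := width n i)
    (fun m' hm' => hp m' hm' i _ (by simp [hm'.int, hi]))
    (fun m' hm' => hp m' hm' (i + 1) _ (by simp [hm'.int, hi]))
    (fun m' hm' _ => h.eval_vertQ hm' (he m' hm') hl) (by
      intro m' hm'
      simp only [Exp.eval_min, Exp.eval_litR, Exp.eval_ofInt, Exp.eval_subI,
        Holds.eval_numE (hm'.inp.trans h.inp), Exp.eval_litI, Exp.eval_ivar, hm'.int, hi, width]
      push_cast
      rfl)
  refine ⟨a, b, c', lo, hi', i + lo, i + hi', ?_, fun s => ?_⟩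
  · simp [levelProg, e1, hi]
  · obtain ⟨t, rfl⟩ : ∃ t, s = i + t := ⟨s - i, by ring⟩
    have h1 := e2 t
    simp only [add_le_add_iff_left, le_add_iff_nonneg_right]
    rw [h1]
    refine and_congr_right fun h0 => and_congr_right fun hw => ?_
    have ht1 : t ≤ 1 := hw.trans (width_le_one n i)
    rw [Free, curve_natCast_add p i h0 ht1, curve_natCast, h.rho,
      norm_le_iff_sum_range _ _ h.nonneg]
    intro l' hl'
    simp [hl']

theorem den_boundaryProg (h : Holds p δ ε c ρ m) {i l : ℕ} (hi : m.I .col = (i : ℤ))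
    (hl : m.I .lev = (l : ℤ)) (hlk : l + 1 < k) :
    ∃ a b c' lo hi : ℝ, (boundaryProg d).den m = ((((m.putR .aa 0 a).putR .bb 0 b).putR .cc 0
        c').putR .lo 0 lo).putR .hi 0 hi ∧
      ∀ y, lo ≤ y ∧ y ≤ hi ↔ 0 ≤ y ∧ y ≤ 1 ∧ Free p c ρ ((i : ℝ) + 1) (l + y) := by
  obtain ⟨a, b, c', lo, hi', e1, e2⟩ := den_clipProg (d := d) (m := m)
    (x := vertQ d IVar.lev.e) (y := vertQ d (.addI IVar.lev.e (.litI 1)))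
    (z := vertP d (.addI IVar.col.e (.litI 1))) (w := .litR 1) (w' := 1)
    (z' := fun l => if h : l < d then vertex p (i + 1) ⟨l, h⟩ else 0)
    (fun m' hm' _ => h.eval_vertQ (j := l) hm' (by simp [hm'.int, hl]) (by omega))
    (fun m' hm' _ => h.eval_vertQ (j := l + 1) hm' (by simp [hm'.int, hl]) hlk)
    (fun m' hm' l hl => by
      rw [dif_pos hl]
      exact eval_vertP (hm'.inp.trans h.inp) (by simp [hm'.int, hi]) hl)
    (by simp)
  refine ⟨a, b, c', lo, hi', e1, fun y => ?_⟩
  rw [e2 y]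
  refine and_congr_right fun h0 => and_congr_right fun h1 => ?_
  have hi1 : (i : ℝ) + 1 = ((i + 1 : ℕ) : ℝ) := by push_cast; rfl
  rw [Free, curve_natCast_add c l h0 h1, hi1, curve_natCast, h.rho, norm_sub_rev,
    norm_le_iff_sum_range _ _ h.nonneg]
  intro l' hl'
  simp [hl']

end

/-! ### The update of the queue of a row -/

/-- Remove the front entries above `hi`. -/
def popFrontProg : Program :=
  .loop (.ltR (.litR 0) (.min (.subR (RVar.qt.get IVar.lft.e) RVar.hi.e)
      (.ofInt (.subI IVar.rgt.e IVar.lft.e))))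
    (IVar.lft.set (.addI IVar.lft.e (.litI 1)))

/-- Remove the back entries that are dominated by an entry at `lo`, and let `best` be the latest
start at `lo`. -/
def popBackProg : Program :=
  .loop (.leR (.litR 0) (.min (.ofInt (.subI (.subI IVar.rgt.e IVar.lft.e) (.litI 1)))
      (.max (.subR RVar.lo.e (RVar.qt.get (.subI IVar.rgt.e (.litI 1))))
        (.subR RVar.best.e (RVar.qs.get (.subI IVar.rgt.e (.litI 1)))))))
    (IVar.rgt.set (.subI IVar.rgt.e (.litI 1)) ;;
      RVar.best.set (.max RVar.best.e (RVar.qs.get IVar.rgt.e)))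

/-- Append the entry `(lo, best)`. -/
def pushProg : Program :=
  .branch (.leR (.litR 0) RVar.best.e)
    (RVar.qt.put IVar.rgt.e RVar.lo.e ;; RVar.qs.put IVar.rgt.e RVar.best.e ;;
      IVar.rgt.set (.addI IVar.rgt.e (.litI 1)))
    .skip

/-- The update of the queue for the next boundary, whose free interval is given by `lo`, `hi`. -/
def queueProg : Program :=
  .branch (.leR RVar.lo.e RVar.hi.e) (popFrontProg ;; popBackProg ;; pushProg)
    (IVar.lft.set (.litI 0) ;; IVar.rgt.set (.litI 0))

/-- The second memory agrees with the first one except in the variables of the queue update. -/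
structure Memory.KeptV (m m' : Memory) : Prop extends m.Kept m' where
  col : m'.I .col = m.I .col
  lev : m'.I .lev = m.I .lev
  va : ∀ i : ℕ, m'.R .va i = m.R .va i
  vb : ∀ i : ℕ, m'.R .vb i = m.R .vb i

theorem Memory.KeptV.refl (m : Memory) : m.KeptV m :=
  ⟨.refl m, rfl, rfl, fun _ => rfl, fun _ => rfl⟩

theorem Memory.KeptV.trans {m m' m'' : Memory} (h : m.KeptV m') (h' : m'.KeptV m'') :
    m.KeptV m'' :=
  ⟨h.toKept.trans h'.toKept, h'.col.trans h.col, h'.lev.trans h.lev,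
    fun i => (h'.va i).trans (h.va i), fun i => (h'.vb i).trans (h.vb i)⟩

/-- The memory represents a queue that is being updated. -/
structure QueueState (F : ℝ → ℝ → Prop) (i l : ℕ) (lo hi : ℝ) (m₀ m : Memory) (L R : ℕ) : Prop where
  kept : m₀.KeptV m
  lft : m.I .lft = (L : ℤ)
  rgt : m.I .rgt = (R : ℤ)
  le : L ≤ R
  lo_eq : m.R .lo 0 = lo
  hi_eq : m.R .hi 0 = hi
  handover : Handover F i l lo L R (fun j => m.R .qt j) (fun j => m.R .qs j) (m.R .best 0)

section

variable {F : ℝ → ℝ → Prop} {i l : ℕ} {lo hi : ℝ} {m₀ m : Memory}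

/-- The number of entries of the queue. -/
noncomputable def Memory.queueLength (m : Memory) : ℕ := (m.I .rgt - m.I .lft).toNat

theorem QueueState.queueLength_eq {L R : ℕ} (h : QueueState F i l lo hi m₀ m L R) :
    m.queueLength = R - L := by
  rw [Memory.queueLength, h.lft, h.rgt]
  omega

/-- The loop test expresses a conjunction as positivity of a minimum; the second term makes it fail
on an empty queue, where the cell that is read is meaningless. Each removed element pays for its own
round. -/
theorem ends_popFrontProg
    (hlh : ∀ y, lo ≤ y ∧ y ≤ hi ↔ 0 ≤ y ∧ y ≤ 1 ∧ F ((i : ℝ) + 1) (l + y)) {L R : ℕ}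
    (h : QueueState F i l lo hi m₀ m L R) :
    popFrontProg.Ends m fun t m' =>
      t + 1500 * m'.queueLength ≤ 1500 + 1500 * m.queueLength ∧
      ∃ L R, QueueState F i l lo hi m₀ m' L R ∧ (L < R → m'.R .qt L ≤ hi) := by
  refine (Program.Ends.loop (fun m => ∃ L R, QueueState F i l lo hi m₀ m L R)
    (fun m => 1500 * m.queueLength) ?_ m ⟨L, R, h⟩).mono ?_
  · rintro m ⟨L, R, h⟩ hb
    simp only [Test.holds_ltR, Exp.eval_litR, Exp.eval_min, Exp.eval_subR, Exp.eval_get,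
      Exp.eval_ivar, Exp.eval_rvar, Exp.eval_ofInt, Exp.eval_subI, h.lft, h.rgt, h.hi_eq, lt_min_iff,
      Rat.cast_zero] at hb
    have hLR : L < R := by
      have := hb.2
      push_cast at this
      exact_mod_cast (sub_pos.1 this)
    obtain ⟨t, ht, hr⟩ := (Program.loopFree_ivar .lft (.addI IVar.lft.e (.litI 1))).runs m
    refine ⟨t, _, hr, ?_⟩
    have e : (IVar.lft.set (.addI IVar.lft.e (.litI 1))).den m = m.putI .lft ((L + 1 : ℕ) : ℤ) := by
      simp [h.lft]
    rw [e]
    have h' : QueueState F i l lo hi m₀ (m.putI .lft ((L + 1 : ℕ) : ℤ)) (L + 1) R := by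
      refine ⟨h.kept.trans ?_, by simp, by simp [h.rgt], hLR, by simp [h.lo_eq], by simp [h.hi_eq], ?_⟩
      · constructor
        · constructor <;> simp
        all_goals simp
      · simp only [Memory.R_putI]
        exact h.handover.pop_front hlh (by linarith [hb.1])
    refine ⟨⟨L + 1, R, h'⟩, ?_⟩
    rw [h'.queueLength_eq, h.queueLength_eq]
    have : t ≤ 6 := ht
    have hc : (Test.ltR (.litR 0) (.min (.subR (RVar.qt.get IVar.lft.e) RVar.hi.e)
      (.ofInt (.subI IVar.rgt.e IVar.lft.e)))).cost ≤ 500 := by decide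
    omega
  · rintro t m' ⟨⟨L, R, h'⟩, hb, ht⟩
    have hc : (Test.ltR (.litR 0) (.min (.subR (RVar.qt.get IVar.lft.e) RVar.hi.e)
      (.ofInt (.subI IVar.rgt.e IVar.lft.e)))).cost ≤ 500 := by decide
    refine ⟨by omega, L, R, h', fun hLR => ?_⟩
    by_contra! hlt
    apply hb
    simp only [Test.holds_ltR, Exp.eval_litR, Exp.eval_min, Exp.eval_subR, Exp.eval_get,
      Exp.eval_ivar, Exp.eval_rvar, Exp.eval_ofInt, Exp.eval_subI, h'.lft, h'.rgt, h'.hi_eq,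
      lt_min_iff, Rat.cast_zero]
    refine ⟨by linarith, ?_⟩
    have : (L : ℝ) < R := by exact_mod_cast hLR
    push_cast
    linarith

/-- Here the maximum plays the role of the disjunction in `Handover.pop_back`, and the minimum
guards against an empty queue. At exit both comparisons fail for the last element, which gives the
strict inequalities needed by `Handover.push`. -/
theorem ends_popBackProg (hF : CellConvex F)
    (hlh : ∀ y, lo ≤ y ∧ y ≤ hi ↔ 0 ≤ y ∧ y ≤ 1 ∧ F ((i : ℝ) + 1) (l + y)) (hle : lo ≤ hi) {L R : ℕ}
    (h : QueueState F i l lo hi m₀ m L R) (hT : L < R → m.R .qt L ≤ hi) :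
    popBackProg.Ends m fun t m' =>
      t + 1500 * m'.queueLength ≤ 1500 + 1500 * m.queueLength ∧
      ∃ L R, QueueState F i l lo hi m₀ m' L R ∧ (L < R → m'.R .qt L ≤ hi) ∧
        (L < R → lo < m'.R .qt (R - 1 : ℕ)) ∧ (L < R → m'.R .best 0 < m'.R .qs (R - 1 : ℕ)) := by
  have hc : (Test.leR (.litR 0) (.min (.ofInt (.subI (.subI IVar.rgt.e IVar.lft.e) (.litI 1)))
      (.max (.subR RVar.lo.e (RVar.qt.get (.subI IVar.rgt.e (.litI 1))))
        (.subR RVar.best.e (RVar.qs.get (.subI IVar.rgt.e (.litI 1))))))).cost ≤ 500 := by decide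
  have test : ∀ {m : Memory} {L R : ℕ}, QueueState F i l lo hi m₀ m L (R + 1) →
      ((Test.leR (.litR 0) (.min (.ofInt (.subI (.subI IVar.rgt.e IVar.lft.e) (.litI 1)))
      (.max (.subR RVar.lo.e (RVar.qt.get (.subI IVar.rgt.e (.litI 1))))
        (.subR RVar.best.e (RVar.qs.get (.subI IVar.rgt.e (.litI 1))))))).Holds m ↔
        L ≤ R ∧ (m.R .qt R ≤ lo ∨ m.R .qs R ≤ m.R .best 0)) := by
    intro m L R h
    have e : ((R + 1 : ℕ) : ℤ) - 1 = (R : ℤ) := by push_cast; ring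
    have e' : (0 : ℝ) ≤ (((R + 1 : ℕ) : ℤ) - (L : ℤ) - 1 : ℤ) ↔ L ≤ R := by
      rw [← Int.cast_zero, Int.cast_le]
      omega
    simp only [Test.holds_leR, Exp.eval_litR, Exp.eval_min, Exp.eval_max, Exp.eval_subR,
      Exp.eval_get, Exp.eval_ivar, Exp.eval_rvar, Exp.eval_ofInt, Exp.eval_subI, Exp.eval_litI,
      h.lft, h.rgt, h.lo_eq, le_min_iff, le_max_iff, Rat.cast_zero, sub_nonneg, e, e']
  refine (Program.Ends.loop
    (fun m => ∃ L R, QueueState F i l lo hi m₀ m L R ∧ (L < R → m.R .qt L ≤ hi))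
    (fun m => 1500 * m.queueLength) ?_ m ⟨L, R, h, hT⟩).mono ?_
  · rintro m ⟨L, R, h, hT⟩ hb
    have hR : R ≠ 0 := by
      rintro rfl
      have := h.le
      simp only [Test.holds_leR, Exp.eval_litR, Exp.eval_min, Exp.eval_max, Exp.eval_subR,
        Exp.eval_get, Exp.eval_ivar, Exp.eval_rvar, Exp.eval_ofInt, Exp.eval_subI, Exp.eval_litI,
        h.lft, h.rgt, h.lo_eq, le_min_iff, Rat.cast_zero] at hb
      have h1 := hb.1
      rw [← Int.cast_zero, Int.cast_le] at h1
      omega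
    obtain ⟨R, rfl⟩ := Nat.exists_eq_succ_of_ne_zero hR
    obtain ⟨h1, h2⟩ := (test h).1 hb
    obtain ⟨t, ht, hr⟩ := (show (IVar.rgt.set (.subI IVar.rgt.e (.litI 1)) ;;
      RVar.best.set (.max RVar.best.e (RVar.qs.get IVar.rgt.e))).LoopFree by simp).runs m
    refine ⟨t, _, hr, ?_⟩
    have e : (IVar.rgt.set (.subI IVar.rgt.e (.litI 1)) ;;
        RVar.best.set (.max RVar.best.e (RVar.qs.get IVar.rgt.e))).den m =
        (m.putI .rgt R).putR .best 0 (max (m.R .best 0) (m.R .qs R)) := by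
      simp [h.rgt]
    rw [e]
    have h' : QueueState F i l lo hi m₀
        ((m.putI .rgt R).putR .best 0 (max (m.R .best 0) (m.R .qs R))) L R := by
      refine ⟨h.kept.trans ?_, by simp [h.lft], by simp, h1, by simp [h.lo_eq], by simp [h.hi_eq], ?_⟩
      · constructor
        · constructor <;> simp
        all_goals simp
      · have := h.handover.pop_back hF hlh hle h1 h2
        simpa using this
    refine ⟨⟨L, R, h', fun hLR => ?_⟩, ?_⟩
    · simpa using hT (by omega)
    · rw [h'.queueLength_eq, h.queueLength_eq]
      have : t ≤ 500 := ht.trans (by decide)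
      omega
  · rintro t m' ⟨⟨L, R, h', hT'⟩, hb, ht⟩
    refine ⟨by omega, L, R, h', hT', ?_⟩
    rcases R with - | R
    · simp
    · have := (test h').not.1 hb
      push Not at this
      simp only [Nat.add_sub_cancel]
      exact ⟨fun hLR => (this (by omega)).1, fun hLR => (this (by omega)).2⟩

/-- The two removal phases are paid by the elements that they remove, and at most one element is
appended. The amortized cost is therefore a constant, which includes the potential of the new
element. -/
theorem ends_queueProg (hF : CellConvex F) {L R L' R' : ℕ} {a b : ℕ → ℝ} (hL : m.I .lft = (L : ℤ))
    (hR : m.I .rgt = (R : ℤ)) (hLR : L ≤ R)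
    (hq : QueueOK F i l L R (fun j => m.R .qt j) (fun j => m.R .qs j))
    (hc : ColumnOK F i 1 l L' R' a b)
    (hlh : ∀ y, m.R .lo 0 ≤ y ∧ y ≤ m.R .hi 0 ↔ 0 ≤ y ∧ y ≤ 1 ∧ F ((i : ℝ) + 1) (l + y))
    (h1 : ∀ f, L' ≤ f → f < R' → b f ≤ m.R .best 0)
    (h2 : m.R .best 0 ≤ -1 ∨ ∃ f, L' ≤ f ∧ f < R' ∧ m.R .best 0 = b f) :
    queueProg.Ends m fun t m' =>
      t + 1500 * m'.queueLength ≤ 9000 + 1500 * m.queueLength ∧ m.KeptV m' ∧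
      ∃ L R : ℕ, m'.I .lft = (L : ℤ) ∧ m'.I .rgt = (R : ℤ) ∧ L ≤ R ∧
        QueueOK F (i + 1) l L R (fun j => m'.R .qt j) (fun j => m'.R .qs j) := by
  by_cases hle : m.R .lo 0 ≤ m.R .hi 0
  · have hs : QueueState F i l (m.R .lo 0) (m.R .hi 0) m m L R :=
      ⟨.refl m, hL, hR, hLR, rfl, rfl, .start hF hq hc hlh hle h1 h2⟩
    have main : (popFrontProg ;; popBackProg ;; pushProg).Ends m fun t m' =>
        t + 1500 * m'.queueLength ≤ 8000 + 1500 * m.queueLength ∧ m.KeptV m' ∧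
        ∃ L R : ℕ, m'.I .lft = (L : ℤ) ∧ m'.I .rgt = (R : ℤ) ∧ L ≤ R ∧
          QueueOK F (i + 1) l L R (fun j => m'.R .qt j) (fun j => m'.R .qs j) := by
      refine Program.Ends.seq ((ends_popFrontProg hlh hs).mono ?_)
      rintro t₁ m₁ ⟨ht₁, L₁, R₁, hs₁, hT₁⟩
      refine Program.Ends.seq ((ends_popBackProg hF hlh hle hs₁ hT₁).mono ?_)
      rintro t₂ m₂ ⟨ht₂, L₂, R₂, hs₂, hT₂, hT₃, hS₂⟩
      obtain ⟨t, ht, hr⟩ := (show pushProg.LoopFree by simp [pushProg]).runs m₂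
      refine ⟨t, _, hr, ?_⟩
      have ht' : t ≤ 500 := ht.trans (by decide)
      classical
      have hden : pushProg.den m₂ = if 0 ≤ m₂.R .best 0 then
          ((m₂.putR .qt R₂ (m.R .lo 0)).putR .qs R₂ (m₂.R .best 0)).putI .rgt ((R₂ + 1 : ℕ) : ℤ)
          else m₂ := by
        simp [pushProg, hs₂.rgt, hs₂.lo_eq]
      by_cases hb : 0 ≤ m₂.R .best 0
      · rw [hden, if_pos hb]
        refine ⟨?_, hs₂.kept.trans ?_, L₂, R₂ + 1, by simp [hs₂.lft], by simp,
          hs₂.le.trans (Nat.le_succ _), ?_⟩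
        · have : (((m₂.putR .qt R₂ (m.R .lo 0)).putR .qs R₂ (m₂.R .best 0)).putI .rgt
              ((R₂ + 1 : ℕ) : ℤ)).queueLength = m₂.queueLength + 1 := by
            have := hs₂.le
            simp [Memory.queueLength, hs₂.lft, hs₂.rgt]
            omega
          rw [this]
          omega
        · constructor
          · constructor <;> simp
          all_goals simp
        · refine hs₂.handover.push hF hlh hle hT₂ hT₃ hS₂ hb hs₂.le ?_ ?_ ?_ ?_
          · intro j hj
            have : j ≠ R₂ := by omega
            simp [this]
          · simp
          · intro j hj
            have : j ≠ R₂ := by omega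
            simp [this]
          · simp
      · rw [hden, if_neg hb]
        refine ⟨by omega, hs₂.kept, L₂, R₂, hs₂.lft, hs₂.rgt, hs₂.le, ?_⟩
        refine hs₂.handover.queueOK hF hlh hT₂ hT₃ ?_
        rcases hs₂.handover.out with h | h
        · exact h
        · exact absurd h.1 hb
    obtain ⟨t, m', hr, ht, h⟩ := main
    refine ⟨_, m', .branch_true (by simpa using hle) hr, ?_, h⟩
    have : (Test.leR RVar.lo.e RVar.hi.e).cost ≤ 20 := by decide
    omega
  · obtain ⟨t, ht, hr⟩ := (show (IVar.lft.set (.litI 0) ;; IVar.rgt.set (.litI 0)).LoopFree by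
      simp).runs m
    refine ⟨_, _, .branch_false (by simpa using hle) hr, ?_⟩
    have h3 : (Test.leR RVar.lo.e RVar.hi.e).cost ≤ 20 := by decide
    have h4 : t ≤ 20 := ht.trans (by decide)
    have e : (IVar.lft.set (.litI 0) ;; IVar.rgt.set (.litI 0)).den m =
        (m.putI .lft 0).putI .rgt 0 := by simp
    rw [e]
    refine ⟨?_, ?_, 0, 0, by simp, by simp, le_rfl, ?_⟩
    · have : ((m.putI .lft 0).putI .rgt 0).queueLength = 0 := by simp [Memory.queueLength]
      rw [this]
      omega
    · constructor
      · constructor <;> simp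
      all_goals simp
    · exact queueOK_of_empty hlh (not_le.1 hle)

end

/-! ### The entries of a column -/

/-- The address of the entry with index `f` of the current column. -/
def slotE (f : Exp .int) : Exp .int := .addI (.mulI IVar.col.e lenE) f

/-- Clip an entry to the interval from `ca` to `cb`, and update the latest start `best`. -/
def clipSlotProg : Program :=
  RVar.best.set (.max RVar.best.e
    (RVar.vb.get (slotE (.subI (.subI lenE (.litI 1)) IVar.slot.e)))) ;;
  .branch (.leR (.max (RVar.va.get (slotE (.subI (.subI lenE (.litI 1)) IVar.slot.e))) RVar.ca.e)
      RVar.cb.e)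
    (RVar.va.put (slotE (.subI (.subI lenE (.litI 1)) IVar.slot.e))
        (.max (RVar.va.get (slotE (.subI (.subI lenE (.litI 1)) IVar.slot.e))) RVar.ca.e) ;;
      RVar.vb.put (slotE (.subI (.subI lenE (.litI 1)) IVar.slot.e))
        (.min (RVar.vb.get (slotE (.subI (.subI lenE (.litI 1)) IVar.slot.e))) RVar.cb.e))
    (RVar.vb.put (slotE (.subI (.subI lenE (.litI 1)) IVar.slot.e)) (.litR (-1)))

/-- Clip all entries of the current column. -/
def slotsProg : Program :=
  .forLoop .slot (.addI IVar.lev.e (.litI 1)) clipSlotProg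

/-- The second memory agrees with the first one except in the entries of the columns and some
temporary variables. -/
structure Memory.KeptQ (m m' : Memory) : Prop extends m.Kept m' where
  col : m'.I .col = m.I .col
  lev : m'.I .lev = m.I .lev
  lft : m'.I .lft = m.I .lft
  rgt : m'.I .rgt = m.I .rgt
  front : m'.R .front 0 = m.R .front 0
  ca : m'.R .ca 0 = m.R .ca 0
  cb : m'.R .cb 0 = m.R .cb 0
  qt : ∀ i : ℕ, m'.R .qt i = m.R .qt i
  qs : ∀ i : ℕ, m'.R .qs i = m.R .qs i

theorem Memory.KeptQ.trans {m m' m'' : Memory} (h : m.KeptQ m') (h' : m'.KeptQ m'') :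
    m.KeptQ m'' :=
  ⟨h.toKept.trans h'.toKept, h'.col.trans h.col, h'.lev.trans h.lev, h'.lft.trans h.lft,
    h'.rgt.trans h.rgt, h'.front.trans h.front, h'.ca.trans h.ca, h'.cb.trans h.cb,
    fun i => (h'.qt i).trans (h.qt i), fun i => (h'.qs i).trans (h.qs i)⟩

section

variable {n k d : ℕ} {p : Fin n → EuclideanSpace ℝ (Fin d)} {δ ε : ℝ}
  {c : Fin k → EuclideanSpace ℝ (Fin d)} {ρ : ℝ} {m : Memory}

/-- The state after the entries `f ≥ k - e` of column `i` have been clipped. -/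
structure Clipped (k i e : ℕ) (m₀ m : Memory) : Prop where
  kept : m₀.KeptQ m
  le : ∀ f < k, k ≤ f + e →
    max (m₀.R .va (i * k + f : ℕ)) (m₀.R .ca 0) ≤ m₀.R .cb 0 →
      m.R .va (i * k + f : ℕ) = max (m₀.R .va (i * k + f : ℕ)) (m₀.R .ca 0) ∧
      m.R .vb (i * k + f : ℕ) = min (m₀.R .vb (i * k + f : ℕ)) (m₀.R .cb 0)
  lt : ∀ f < k, k ≤ f + e →
    m₀.R .cb 0 < max (m₀.R .va (i * k + f : ℕ)) (m₀.R .ca 0) → m.R .vb (i * k + f : ℕ) = -1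
  other : ∀ z : ℕ, (∀ f < k, k ≤ f + e → z ≠ i * k + f) →
    m.R .va z = m₀.R .va z ∧ m.R .vb z = m₀.R .vb z
  best_ge : ∀ f < k, k ≤ f + e → m₀.R .vb (i * k + f : ℕ) ≤ m.R .best 0
  best : m.R .best 0 ≤ -1 ∨ ∃ f < k, k ≤ f + e ∧ m.R .best 0 = m₀.R .vb (i * k + f : ℕ)

theorem slot_address {i k f e : ℕ} (h : f + e + 1 = k) :
    (i : ℤ) * k + ((k : ℤ) - 1 - e) = ((i * k + f : ℕ) : ℤ) := by
  have : (f : ℤ) = k - 1 - e := by omega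
  push_cast
  rw [this]

/-- The slots of a column are filled from the top down: round `e` treats slot `k - 1 - e`, so `l +
1` rounds treat exactly the slots in use at level `l`. -/
theorem within_slotsProg (hin : m .inp = constructionStart p k δ ε .inp) {i l : ℕ}
    (hi : m.I .col = (i : ℤ)) (hl : m.I .lev = (l : ℤ)) (hlk : l < k)
    (hb : m.R .best 0 ≤ -1) :
    slotsProg.Within m ((l + 1) * (clipSlotProg.cost + 13) + 10) (Clipped k i (l + 1) m) := by
  refine (Program.Within.forLoop (c := clipSlotProg.cost) (K := l + 1)
    (fun e m' => m'.I .slot = (e : ℤ) ∧ Clipped k i e m m') ?_ (fun _ _ h => h.1) ?_ ?_).mono ?_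
    (fun m' h => h.2)
  · rintro e m' ⟨h1, h2⟩
    simp [h2.kept.lev, hl]
  · refine ⟨by simp, ⟨⟨?_, ?_, ?_, ?_, ?_, ?_, ?_, ?_, ?_, ?_⟩, ?_, ?_, ?_, ?_, ?_⟩⟩
    · constructor <;> simp
    all_goals first
      | simp; done
      | (intro f h1 h2; omega)
      | skip
    simpa using .inl hb
  · rintro e he m' ⟨h1, h2⟩
    refine Program.LoopFree.within (by simp [clipSlotProg]) ?_
    obtain ⟨f, hf⟩ : ∃ f, f + e + 1 = k := ⟨k - 1 - e, by omega⟩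
    have hlen : lenE.eval m' = (k : ℤ) := Holds.eval_lenE (h2.kept.inp.trans hin)
    have hcol : m'.I .col = (i : ℤ) := h2.kept.col.trans hi
    have haddr : ∀ m'' : Memory, m'' .inp = m' .inp → m''.I .col = m'.I .col →
        m''.I .slot = m'.I .slot →
        (slotE (.subI (.subI lenE (.litI 1)) IVar.slot.e)).eval m'' = ((i * k + f : ℕ) : ℤ) := by
      intro m'' g1 g2 g3
      have hlen' : lenE.eval m'' = (k : ℤ) := by
        rw [← hlen]
        simp [lenE, g1]
      simp only [slotE, Exp.eval_addI, Exp.eval_mulI, Exp.eval_subI, Exp.eval_ivar, Exp.eval_litI,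
        hlen', g2, g3, h1, hcol]
      exact slot_address hf
    -- The slot of this round has not been touched so far and still holds its original contents.
    have hz := h2.other (i * k + f) (fun g g1 g2 g3 => by
      have : f = g := by simpa using g3
      omega)
    classical
    set z := i * k + f with hzdef
    have hden : clipSlotProg.den m' =
        if max (m.R .va z) (m.R .ca 0) ≤ m.R .cb 0 then
          ((m'.putR .best 0 (max (m'.R .best 0) (m.R .vb z))).putR .va z
            (max (m.R .va z) (m.R .ca 0))).putR .vb z (min (m.R .vb z) (m.R .cb 0))
        else (m'.putR .best 0 (max (m'.R .best 0) (m.R .vb z))).putR .vb z (-1) := by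
      simp [clipSlotProg, haddr, hz, h2.kept.ca, h2.kept.cb]
    have hne : ∀ g < k, k ≤ g + (e + 1) → g = f ∨ (k ≤ g + e ∧ i * k + g ≠ z) := by
      intro g g1 g2
      rcases Nat.lt_or_ge (g + e) k with hg | hg
      · left
        omega
      · exact .inr ⟨hg, by omega⟩
    rw [hden]
    split_ifs with hc
    · refine ⟨by simp [h1], by simp, ⟨h2.kept.trans ⟨?_, ?_, ?_, ?_, ?_, ?_, ?_, ?_, ?_, ?_⟩,
        ?_, ?_, ?_, ?_, ?_⟩⟩
      · constructor <;> simp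
      iterate 9 simp
      · intro g g1 g2 g3
        rcases hne g g1 g2 with rfl | ⟨g4, g5⟩
        · simp [← hzdef]
        · have g6 : ((i * k + g : ℕ) : ℤ) ≠ z := by exact_mod_cast g5
          simpa only [Memory.R_putI, Memory.R_putR_natCast, g6, and_false, if_false, reduceCtorEq,
            false_and] using h2.le g g1 g4 g3
      · intro g g1 g2 g3
        rcases hne g g1 g2 with rfl | ⟨g4, g5⟩
        · exact absurd hc (not_le.2 g3)
        · have g6 : ((i * k + g : ℕ) : ℤ) ≠ z := by exact_mod_cast g5
          simpa only [Memory.R_putI, Memory.R_putR_natCast, g6, and_false, if_false, reduceCtorEq,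
            false_and] using h2.lt g g1 g4 g3
      · intro y hy
        have g5 : y ≠ z := hy f (by omega) (by omega)
        have g6 : ((y : ℕ) : ℤ) ≠ z := by exact_mod_cast g5
        simpa only [Memory.R_putI, Memory.R_putR_natCast, g6, and_false, if_false, reduceCtorEq,
            false_and] using h2.other y fun g g1 g2 => hy g g1 (by omega)
      · intro g g1 g2
        simp only [Memory.R_putI, Memory.R_putR_zero, reduceCtorEq, false_and, if_false, true_and,
          if_true]
        rcases hne g g1 g2 with rfl | ⟨g4, g5⟩
        · exact le_max_right _ _
        · exact (h2.best_ge g g1 g4).trans (le_max_left _ _)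
      · simp only [Memory.R_putI, Memory.R_putR_zero, reduceCtorEq, false_and, if_false, true_and,
          if_true]
        rcases le_total (m'.R .best 0) (m.R .vb z) with h | h
        · rw [max_eq_right h]
          exact .inr ⟨f, by omega, by omega, rfl⟩
        · rw [max_eq_left h]
          refine h2.best.imp id ?_
          rintro ⟨g, g1, g2, g3⟩
          exact ⟨g, g1, by omega, g3⟩
    · refine ⟨by simp [h1], by simp, ⟨h2.kept.trans ⟨?_, ?_, ?_, ?_, ?_, ?_, ?_, ?_, ?_, ?_⟩,
        ?_, ?_, ?_, ?_, ?_⟩⟩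
      · constructor <;> simp
      iterate 9 simp
      · intro g g1 g2 g3
        rcases hne g g1 g2 with rfl | ⟨g4, g5⟩
        · exact absurd g3 hc
        · have g6 : ((i * k + g : ℕ) : ℤ) ≠ z := by exact_mod_cast g5
          simpa only [Memory.R_putI, Memory.R_putR_natCast, g6, and_false, if_false, reduceCtorEq,
            false_and] using h2.le g g1 g4 g3
      · intro g g1 g2 g3
        rcases hne g g1 g2 with rfl | ⟨g4, g5⟩
        · simp [← hzdef]
        · have g6 : ((i * k + g : ℕ) : ℤ) ≠ z := by exact_mod_cast g5
          simpa only [Memory.R_putI, Memory.R_putR_natCast, g6, and_false, if_false, reduceCtorEq,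
            false_and] using h2.lt g g1 g4 g3
      · intro y hy
        have g5 : y ≠ z := hy f (by omega) (by omega)
        have g6 : ((y : ℕ) : ℤ) ≠ z := by exact_mod_cast g5
        simpa only [Memory.R_putI, Memory.R_putR_natCast, g6, and_false, if_false, reduceCtorEq,
            false_and] using h2.other y fun g g1 g2 => hy g g1 (by omega)
      · intro g g1 g2
        simp only [Memory.R_putI, Memory.R_putR_zero, reduceCtorEq, false_and, if_false, true_and,
          if_true]
        rcases hne g g1 g2 with rfl | ⟨g4, g5⟩
        · exact le_max_right _ _
        · exact (h2.best_ge g g1 g4).trans (le_max_left _ _)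
      · simp only [Memory.R_putI, Memory.R_putR_zero, reduceCtorEq, false_and, if_false, true_and,
          if_true]
        rcases le_total (m'.R .best 0) (m.R .vb z) with h | h
        · rw [max_eq_right h]
          exact .inr ⟨f, by omega, by omega, rfl⟩
        · rw [max_eq_left h]
          refine h2.best.imp id ?_
          rintro ⟨g, g1, g2, g3⟩
          exact ⟨g, g1, by omega, g3⟩
  · have : (Exp.addI IVar.lev.e (.litI 1)).cost = 4 := rfl
    rw [this]

end

/-! ### The pass over a row of cells -/

/-- The latest start at the left boundary of the column, and the free interval at the next level. -/
def prepProg (d : ℕ) : Program :=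
  .branch (.ltI IVar.lft.e IVar.rgt.e) (RVar.front.set (RVar.qs.get IVar.lft.e))
    (RVar.front.set (.litR (-1))) ;;
  RVar.best.set (.litR (-1)) ;; levelProg d (.addI IVar.lev.e (.litI 1))

/-- The entry for the paths that enter the row from the left and leave it in the current column. -/
def newSlotProg : Program :=
  RVar.va.put (slotE (.subI (.subI lenE (.litI 2)) IVar.lev.e)) RVar.ca.e ;;
  .branch (.leR RVar.ca.e RVar.cb.e)
    (RVar.vb.put (slotE (.subI (.subI lenE (.litI 2)) IVar.lev.e)) RVar.front.e)
    (RVar.vb.put (slotE (.subI (.subI lenE (.litI 2)) IVar.lev.e)) (.litR (-1)))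

/-- One column of a row. -/
def columnProg (d : ℕ) : Program :=
  prepProg d ;; slotsProg ;; newSlotProg ;; boundaryProg d ;;
    .branch (.ltI (.addI IVar.col.e (.litI 1)) numE) queueProg .skip

/-- One row. -/
def rowProg (d : ℕ) : Program :=
  IVar.lft.set (.litI 0) ;; IVar.rgt.set (.litI 0) ;; .forLoop .col numE (columnProg d)

section

variable {n k d : ℕ} {p : Fin n → EuclideanSpace ℝ (Fin d)} {δ ε : ℝ}
  {c : Fin k → EuclideanSpace ℝ (Fin d)} {ρ : ℝ} {m : Memory}

theorem within_prepProg (h : Holds p δ ε c ρ m) {i l : ℕ} (hi : m.I .col = (i : ℤ))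
    (hl : m.I .lev = (l : ℤ)) (hlk : l + 1 < k) {L R : ℕ} (hL : m.I .lft = (L : ℤ))
    (hR : m.I .rgt = (R : ℤ)) :
    (prepProg d).Within m (prepProg d).cost fun m' =>
      m.Kept m' ∧ m'.I .col = (i : ℤ) ∧ m'.I .lev = (l : ℤ) ∧ m'.I .lft = (L : ℤ) ∧
      m'.I .rgt = (R : ℤ) ∧ (∀ z : ℕ, m'.R .qt z = m.R .qt z ∧ m'.R .qs z = m.R .qs z ∧
        m'.R .va z = m.R .va z ∧ m'.R .vb z = m.R .vb z) ∧
      (L < R → m'.R .front 0 = m.R .qs L) ∧ (R ≤ L → m'.R .front 0 = -1) ∧ m'.R .best 0 = -1 ∧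
      ∀ s, m'.R .ca 0 ≤ s ∧ s ≤ m'.R .cb 0 ↔
        (i : ℝ) ≤ s ∧ s ≤ i + width n i ∧ Free p c ρ s (l + 1 : ℕ) := by
  refine Program.LoopFree.within (by simp [prepProg, levelProg, loopFree_clipProg]) ?_
  classical
  set f : ℝ := if L < R then m.R .qs L else -1 with hf
  have e : (RVar.best.set (.litR (-1))).den ((Program.branch (.ltI IVar.lft.e IVar.rgt.e)
      (RVar.front.set (RVar.qs.get IVar.lft.e)) (RVar.front.set (.litR (-1)))).den m) =
      (m.putR .front 0 f).putR .best 0 (-1) := by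
    by_cases hLR : L < R <;> simp [hL, hR, hLR, hf]
  set m1 := (m.putR .front 0 f).putR .best 0 (-1) with hm1
  have k1 : m.Kept m1 := by constructor <;> simp [hm1]
  obtain ⟨a, b, c', lo, hi', A, B, e1, e2⟩ := den_levelProg (h.kept k1) (i := i) (l := l + 1)
    (by simp [hm1, hi]) hlk (e := .addI IVar.lev.e (.litI 1)) (fun m' hm' => by
      simp [hm'.int, hm1, hl])
  have e3 : (prepProg d).den m = (levelProg d (.addI IVar.lev.e (.litI 1))).den m1 := by
    simp only [prepProg, Program.den_seq, e]
  rw [e3, e1]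
  refine ⟨?_, by simp [hm1, hi], by simp [hm1, hl], by simp [hm1, hL], by simp [hm1, hR],
    by simp [hm1], fun hLR => by simp [hm1, hf, hLR], fun hLR => by simp [hm1, hf, not_lt.2 hLR],
    by simp [hm1], ?_⟩
  · constructor <;> simp [hm1]
  · simpa using e2

/-- The new entry goes to slot `k - 2 - l`, just below those in use. Its first component is the left
end of the free interval, below all clipped ones, so the slots stay sorted without any work. -/
theorem within_newSlotProg (hin : m .inp = constructionStart p k δ ε .inp) {i l f : ℕ}
    (hi : m.I .col = (i : ℤ)) (hl : m.I .lev = (l : ℤ)) (hf : f + l + 2 = k) :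
    newSlotProg.Within m newSlotProg.cost fun m' => m.KeptQ m' ∧ m'.R .best 0 = m.R .best 0 ∧
      m'.R .va (i * k + f : ℕ) = m.R .ca 0 ∧
      (m.R .ca 0 ≤ m.R .cb 0 → m'.R .vb (i * k + f : ℕ) = m.R .front 0) ∧
      (m.R .cb 0 < m.R .ca 0 → m'.R .vb (i * k + f : ℕ) = -1) ∧
      ∀ z : ℕ, z ≠ i * k + f → m'.R .va z = m.R .va z ∧ m'.R .vb z = m.R .vb z := by
  refine Program.LoopFree.within (by simp [newSlotProg]) ?_
  have haddr : ∀ m' : Memory, m' .inp = m .inp → m'.I .col = m.I .col →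
      m'.I .lev = m.I .lev →
      (slotE (.subI (.subI lenE (.litI 2)) IVar.lev.e)).eval m' = ((i * k + f : ℕ) : ℤ) := by
    intro m' g1 g2 g3
    simp only [slotE, Exp.eval_addI, Exp.eval_mulI, Exp.eval_subI, Exp.eval_ivar, Exp.eval_litI,
      Holds.eval_lenE (g1.trans hin), g2, g3, hi, hl]
    have : (f : ℤ) = k - 2 - l := by omega
    push_cast
    rw [this]
  classical
  have hden : newSlotProg.den m = (m.putR .va (i * k + f : ℕ) (m.R .ca 0)).putR .vb
      (i * k + f : ℕ) (if m.R .ca 0 ≤ m.R .cb 0 then m.R .front 0 else -1) := by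
    simp only [newSlotProg, Program.den_seq, Program.den_put, haddr m rfl rfl rfl, Exp.eval_rvar,
      Program.den_branch, Test.holds_leR]
    split_ifs with h1 h2 h2
    · simp [haddr]
    · exact absurd h1 (by simpa using h2)
    · exact absurd h2 (by simpa using h1)
    · simp [haddr]
  rw [hden]
  generalize i * k + f = y
  refine ⟨?_, by simp, by simp, fun h => by simp [h], fun h => by simp [not_le.2 h], ?_⟩
  · constructor
    · constructor <;> simp
    all_goals simp
  · intro z hz
    have hz' : (z : ℤ) ≠ (y : ℤ) := by exact_mod_cast hz
    simp only [Memory.R_putR_natCast, hz', and_false, if_false, reduceCtorEq, and_self]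

theorem within_boundaryProg (h : Holds p δ ε c ρ m) {i l : ℕ} (hi : m.I .col = (i : ℤ))
    (hl : m.I .lev = (l : ℤ)) (hlk : l + 1 < k) :
    (boundaryProg d).Within m (boundaryProg d).cost fun m' =>
      m.KeptV m' ∧ m'.I .lft = m.I .lft ∧ m'.I .rgt = m.I .rgt ∧ m'.R .best 0 = m.R .best 0 ∧
      (∀ z : ℕ, m'.R .qt z = m.R .qt z ∧ m'.R .qs z = m.R .qs z) ∧
      ∀ y, m'.R .lo 0 ≤ y ∧ y ≤ m'.R .hi 0 ↔
        0 ≤ y ∧ y ≤ 1 ∧ Free p c ρ ((i : ℝ) + 1) (l + y) := by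
  refine Program.LoopFree.within (by simp [boundaryProg, loopFree_clipProg]) ?_
  obtain ⟨a, b, c', lo, hi', e1, e2⟩ := den_boundaryProg h hi hl hlk
  rw [e1]
  refine ⟨?_, by simp, by simp, by simp, by simp, by simpa using e2⟩
  constructor
  · constructor <;> simp
  all_goals simp

/-- The entries of column `i` in the memory are correct at level `l`. -/
def SlotsOK (p : Fin n → EuclideanSpace ℝ (Fin d)) (c : Fin k → EuclideanSpace ℝ (Fin d)) (ρ : ℝ)
    (m : Memory) (i l : ℕ) : Prop :=
  ColumnOK (Free p c ρ) i (width n i) l (k - 1 - l) k (fun f => m.R .va (i * k + f : ℕ))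
    (fun f => m.R .vb (i * k + f : ℕ))

theorem SlotsOK.congr {m' : Memory} {i l : ℕ} (h : SlotsOK p c ρ m i l)
    (h' : ∀ f < k, m'.R .va (i * k + f : ℕ) = m.R .va (i * k + f : ℕ) ∧
      m'.R .vb (i * k + f : ℕ) = m.R .vb (i * k + f : ℕ)) : SlotsOK p c ρ m' i l := by
  refine ⟨fun f h1 h2 => ?_, fun u x h1 h2 h3 => ?_, fun f f' h1 h2 h3 => ?_⟩
  · rw [(h' f h2).1, (h' f h2).2]
    exact h.sound f h1 h2
  · obtain ⟨f, f1, f2, f3, f4⟩ := h.complete u x h1 h2 h3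
    exact ⟨f, f1, f2, by rwa [(h' f f2).1], by rwa [(h' f f2).2]⟩
  · rw [(h' f (by omega)).1, (h' f (by omega)).2, (h' f' h3).1, (h' f' h3).2]
    exact h.sorted f f' h1 h2 h3

/-- The queue of row `l` at the left boundary of column `i` is correct. -/
def QueueHolds (F : ℝ → ℝ → Prop) (m : Memory) (i l : ℕ) : Prop :=
  ∃ L R : ℕ, m.I .lft = (L : ℤ) ∧ m.I .rgt = (R : ℤ) ∧ L ≤ R ∧
    QueueOK F i l L R (fun j => m.R .qt j) (fun j => m.R .qs j)

/-- A bound for the time needed per entry in the pass over a row. -/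
def columnCost (d : ℕ) : ℕ :=
  (prepProg d).cost + clipSlotProg.cost + 30 + newSlotProg.cost + (boundaryProg d).cost + 10000

theorem column_time {a b e g k l u t₁ t₂ t₃ t₄ : ℕ} (h₁ : t₁ ≤ a)
    (h₂ : t₂ ≤ (l + 1) * (b + 13) + 10) (h₃ : t₃ ≤ e) (h₄ : t₄ ≤ g) (hl : l + 1 ≤ k) :
    t₁ + (t₂ + (t₃ + (t₄ + u))) ≤ k * (a + b + 30 + e + g + u) := by
  have e1 : (l + 1) * (b + 13) ≤ k * (b + 13) := Nat.mul_le_mul_right _ hl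
  have e2 : a + 17 + e + g + u ≤ k * (a + 17 + e + g + u) :=
    Nat.le_mul_of_pos_left _ (by omega)
  have e3 : k * (a + b + 30 + e + g + u) = k * (b + 13) + k * (a + 17 + e + g + u) := by
    ring
  rw [e3]
  generalize k * (b + 13) = x at *
  generalize k * (a + 17 + e + g + u) = y at *
  generalize (l + 1) * (b + 13) = z at *
  omega

/-- One column combines `ColumnOK.next` for the entries with the queue update for the next boundary.
Clipping costs time proportional to the number of entries, at most `k`; everything else is constant
in the amortized sense. -/
theorem ends_columnProg (h : Holds p δ ε c ρ m) {i l : ℕ} (hi : m.I .col = (i : ℤ))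
    (hin : i < n) (hl : m.I .lev = (l : ℤ)) (hlk : l + 1 < k) (hq : QueueHolds (Free p c ρ) m i l)
    (hc : SlotsOK p c ρ m i l) :
    (columnProg d).Ends m fun t m' =>
      t + 1500 * m'.queueLength ≤ k * columnCost d + 1500 * m.queueLength ∧
      m.Kept m' ∧ m'.I .col = (i : ℤ) ∧ m'.I .lev = (l : ℤ) ∧ SlotsOK p c ρ m' i (l + 1) ∧
      (i + 1 < n → QueueHolds (Free p c ρ) m' (i + 1) l) ∧
      ∀ z : ℕ, (∀ f < k, z ≠ i * k + f) → m'.R .va z = m.R .va z ∧ m'.R .vb z = m.R .vb z := by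
  obtain ⟨L, R, hL, hR, hLR, hq⟩ := hq
  have hF := cellConvex_free p c ρ
  obtain ⟨t₁, m₁, r₁, ht₁, K₁, col₁, lev₁, lft₁, rgt₁, A₁, fr₁, fr₁', b₁, lv₁⟩ :=
    within_prepProg h hi hl hlk hL hR
  obtain ⟨t₂, m₂, r₂, ht₂, Z₂⟩ := within_slotsProg (K₁.inp.trans h.inp) col₁ lev₁
    (by omega : l < k) b₁.le
  obtain ⟨f₀, hf₀⟩ : ∃ f, f + l + 2 = k := ⟨k - 2 - l, by omega⟩
  obtain ⟨t₃, m₃, r₃, ht₃, K₃, b₃, va₃, vb₃, vb₃', o₃⟩ := within_newSlotProg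
    (Z₂.kept.inp.trans (K₁.inp.trans h.inp)) (Z₂.kept.col.trans col₁) (Z₂.kept.lev.trans lev₁) hf₀
  have h₃ := ((h.kept K₁).kept Z₂.kept.toKept).kept K₃.toKept
  have col₃ := K₃.col.trans (Z₂.kept.col.trans col₁)
  have lev₃ := K₃.lev.trans (Z₂.kept.lev.trans lev₁)
  obtain ⟨t₄, m₄, r₄, ht₄, K₄, lft₄, rgt₄, b₄, q₄, bd₄⟩ := within_boundaryProg h₃ col₃ lev₃ hlk
  have kept₄ : m.Kept m₄ := ((K₁.trans Z₂.kept.toKept).trans K₃.toKept).trans K₄.toKept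
  have col₄ := K₄.col.trans col₃
  have lev₄ := K₄.lev.trans lev₃
  have lft₄' := lft₄.trans (K₃.lft.trans (Z₂.kept.lft.trans lft₁))
  have rgt₄' := rgt₄.trans (K₃.rgt.trans (Z₂.kept.rgt.trans rgt₁))
  have hqt : ∀ z : ℕ, m₄.R .qt z = m.R .qt z := fun z =>
    (q₄ z).1.trans ((K₃.qt z).trans ((Z₂.kept.qt z).trans (A₁ z).1))
  have hqs : ∀ z : ℕ, m₄.R .qs z = m.R .qs z := fun z =>
    (q₄ z).2.trans ((K₃.qs z).trans ((Z₂.kept.qs z).trans (A₁ z).2.1))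
  have len₄ : m₄.queueLength = m.queueLength := by
    rw [Memory.queueLength, Memory.queueLength, lft₄', rgt₄', hL, hR]
  have hk1 : k - 1 - l = f₀ + 1 := by omega
  have hk2 : k - 1 - (l + 1) = f₀ := by omega
  have hne : ∀ f, f₀ + 1 ≤ f → i * k + f ≠ i * k + f₀ := fun f hf => by omega
  have other₄ : ∀ z : ℕ, (∀ f < k, z ≠ i * k + f) →
      m₄.R .va z = m.R .va z ∧ m₄.R .vb z = m.R .vb z := by
    intro z hz
    obtain ⟨g1, g2⟩ := o₃ z (hz f₀ (by omega))
    obtain ⟨g3, g4⟩ := Z₂.other z fun f f1 _ => hz f f1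
    exact ⟨(K₄.va z).trans (g1.trans (g3.trans (A₁ z).2.2.1)),
      (K₄.vb z).trans (g2.trans (g4.trans (A₁ z).2.2.2))⟩
  unfold SlotsOK at hc
  rw [hk1] at hc
  have slots₄ : SlotsOK p c ρ m₄ i (l + 1) := by
    unfold SlotsOK
    rw [hk2]
    refine hc.next hF (width_le_one n i) (A := m₁.R .ca 0) (B := m₁.R .cb 0)
      (by exact_mod_cast lv₁) hq (σ := m₁.R .front 0) fr₁ fr₁' (by omega) ?_ ?_ ?_ ?_
    · intro f g1 g2 g3
      have e := o₃ (i * k + f) (hne f g1)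
      rw [K₄.va, K₄.vb, e.1, e.2]
      rw [← (A₁ (i * k + f)).2.2.1] at g3 ⊢
      rw [← (A₁ (i * k + f)).2.2.2]
      exact Z₂.le f g2 (by omega) g3
    · intro f g1 g2 g3
      rw [K₄.vb, (o₃ (i * k + f) (hne f g1)).2]
      rw [← (A₁ (i * k + f)).2.2.1] at g3
      exact Z₂.lt f g2 (by omega) g3
    · intro hAB
      rw [K₄.va, K₄.vb, va₃, vb₃ (by rw [Z₂.kept.ca, Z₂.kept.cb]; exact hAB)]
      exact ⟨Z₂.kept.ca, Z₂.kept.front⟩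
    · intro hAB
      rw [K₄.vb, vb₃' (by rw [Z₂.kept.ca, Z₂.kept.cb]; exact hAB)]
  have hbest : m₄.R .best 0 = m₂.R .best 0 := b₄.trans b₃
  have time : t₁ + (t₂ + (t₃ + (t₄ + 10000))) ≤ k * columnCost d :=
    column_time ht₁ ht₂ ht₃ ht₄ (by omega)
  have tcost : (Test.ltI (.addI IVar.col.e (.litI 1)) numE).cost ≤ 20 := by decide
  have last : (Program.branch (.ltI (.addI IVar.col.e (.litI 1)) numE) queueProg .skip).Ends m₄
      fun t m' => t + 1500 * m'.queueLength ≤ 9800 + 1500 * m₄.queueLength ∧ m₄.KeptV m' ∧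
        (i + 1 < n → QueueHolds (Free p c ρ) m' (i + 1) l) := by
    have htest : (Test.ltI (.addI IVar.col.e (.litI 1)) numE).Holds m₄ ↔ i + 1 < n := by
      simp only [Test.holds_ltI, Exp.eval_addI, Exp.eval_ivar, Exp.eval_litI, col₄,
        Holds.eval_numE (kept₄.inp.trans h.inp)]
      omega
    -- The queue is needed only if another column follows; in that case the current column has width
    -- 1.
    by_cases hn : i + 1 < n
    · rw [width_eq_one hn] at hc
      obtain ⟨t, m', r, ht, K, Q⟩ := ends_queueProg hF (i := i) (l := l) (m := m₄) (L := L)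
        (R := R) (lft₄'.trans (by simp)) (rgt₄'.trans (by simp)) hLR (by simpa only [hqt, hqs] using hq)
        hc bd₄
        -- The maximum `best` is taken over the starts before clipping: paths to the right side of
        -- row `l` leave from level `l`, and they need not be able to reach level `l + 1`.
        (fun f g1 g2 => by
          rw [hbest, ← (A₁ (i * k + f)).2.2.2]
          exact Z₂.best_ge f g2 (by omega))
        (by
          rw [hbest]
          refine Z₂.best.imp id ?_
          rintro ⟨f, g1, g2, g3⟩
          exact ⟨f, by omega, g1, by rw [← (A₁ (i * k + f)).2.2.2]; exact g3⟩)
      exact ⟨_, m', .branch_true (htest.2 hn) r, by omega, K, fun _ => Q⟩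
    · refine ⟨_, m₄, .branch_false (fun h => hn (htest.1 h)) (.skip m₄), by omega, .refl _,
        fun h => absurd h hn⟩
  obtain ⟨t₅, m₅, r₅, ht₅, K₅, Q₅⟩ := last
  refine ⟨_, m₅, .seq r₁ (.seq r₂ (.seq r₃ (.seq r₄ r₅))), by omega, kept₄.trans K₅.toKept,
    K₅.col.trans col₄, K₅.lev.trans lev₄, slots₄.congr fun f _ => ⟨K₅.va _, K₅.vb _⟩, Q₅,
    fun z hz => ?_⟩
  rw [K₅.va, K₅.vb]
  exact other₄ z hz

/-- A bound for the time of the pass over a row, divided by the number of entries. -/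
def rowCost (d : ℕ) : ℕ := columnCost d + 50

/-- The invariant splits the columns: those already passed are correct at level `l + 1`, the others
still at level `l`, and the queue belongs to the boundary between the two groups. -/
theorem within_rowProg (h : Holds p δ ε c ρ m) {l : ℕ} (hn : 1 ≤ n) (hl : m.I .lev = (l : ℤ))
    (hlk : l + 1 < k) (hc : ∀ i < n, SlotsOK p c ρ m i l) :
    (rowProg d).Within m (n * (k * rowCost d)) fun m' =>
      m.Kept m' ∧ m'.I .lev = (l : ℤ) ∧ ∀ i < n, SlotsOK p c ρ m' i (l + 1) := by
  refine Program.Ends.seq ⟨_, _, .setI _ _ _ _, Program.Ends.seq ⟨_, _, .setI _ _ _ _, ?_⟩⟩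
  change Program.Ends _ ((m.putI .lft 0).putI .rgt 0) _
  have e : ∀ (m' : Memory) (x : IVar) (z : ℤ), x = .col → (m'.putI x z).queueLength =
      m'.queueLength := by
    rintro m' _ z rfl
    simp [Memory.queueLength]
  refine (Program.Ends.forLoop (c := k * columnCost d) (K := n) (fun i m' => m.Kept m' ∧
    m'.I .col = (i : ℤ) ∧ m'.I .lev = (l : ℤ) ∧ (i < n → QueueHolds (Free p c ρ) m' i l) ∧
    (∀ j < i, SlotsOK p c ρ m' j (l + 1)) ∧ ∀ j < n, i ≤ j → SlotsOK p c ρ m' j l)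
    (fun m => 1500 * m.queueLength)
    (fun j m' h' => Holds.eval_numE (h'.1.inp.trans h.inp)) (fun j m' h' => h'.2.1) ?_ ?_).mono ?_
  · refine ⟨?_, by simp, by simp [hl], fun _ => ⟨0, 0, by simp, by simp, le_rfl, ?_⟩, by simp,
      fun j hj _ => (hc j hj).congr (by simp)⟩
    · constructor <;> simp
    · exact queueOK_zero l 0
  · rintro i hi m' ⟨K, col, lev, Q, S, S'⟩
    refine (ends_columnProg (h.kept K) col hi lev hlk (Q hi) (S' i hi le_rfl)).mono ?_
    rintro t m'' ⟨ht, K', col', lev', S'', Q', O⟩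
    have hother : ∀ j, j ≠ i → ∀ f < k, m''.R .va (j * k + f : ℕ) = m'.R .va (j * k + f : ℕ) ∧
        m''.R .vb (j * k + f : ℕ) = m'.R .vb (j * k + f : ℕ) := by
      intro j hj f hf
      refine O _ fun g hg hfg => hj ?_
      have h1 : (j * k + f) / k = j := by
        rw [add_comm, Nat.add_mul_div_right _ _ (by omega), Nat.div_eq_of_lt hf, zero_add]
      have h2 : (i * k + g) / k = i := by
        rw [add_comm, Nat.add_mul_div_right _ _ (by omega), Nat.div_eq_of_lt hg, zero_add]
      rw [← h1, hfg, h2]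
    refine ⟨⟨col', (K.trans K').trans ?_, by simp, by simp [lev'], ?_, ?_, ?_⟩, ?_⟩
    · constructor <;> simp
    · intro hi'
      obtain ⟨L, R, g1, g2, g3, g4⟩ := Q' hi'
      exact ⟨L, R, by simp [g1], by simp [g2], g3, by simpa using g4⟩
    · intro j hj
      refine SlotsOK.congr (m := m'') ?_ (by simp)
      rcases Nat.lt_or_ge j i with hji | hji
      · exact (S j hji).congr (hother j (by omega))
      · obtain rfl : j = i := by omega
        exact S''
    · intro j hj hji
      refine SlotsOK.congr (m := m'') ?_ (by simp)
      exact (S' j hj (by omega)).congr (hother j (by omega))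
    · rw [e _ _ _ rfl]
      exact ht
  · rintro t m' ⟨⟨K, -, lev, -, S, -⟩, ht⟩
    refine ⟨?_, K, lev, S⟩
    -- The row starts with an empty queue, so the potential contributes nothing to the total time.
    have h0 : (((m.putI .lft 0).putI .rgt 0).putI .col 0).queueLength = 0 := by
      simp [Memory.queueLength]
    rw [h0] at ht
    have hN : numE.cost = 2 := rfl
    rw [hN] at ht
    have e1 : n * (k * columnCost d + 2 + 9) = n * (k * columnCost d) + n * 11 := by ring
    have e2 : n * (k * rowCost d) = n * (k * columnCost d) + n * (k * 50) := by
      rw [rowCost]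
      ring
    have e3 : n * 50 ≤ n * (k * 50) := Nat.mul_le_mul_left _ (by omega)
    simp only [Exp.cost]
    omega

end

/-! ### The inclusion-minimal pairs -/

/-- The pair of parameters describes a feasible subcurve. -/
def Feasible {n k d : ℕ} (p : Fin n → EuclideanSpace ℝ (Fin d))
    (c : Fin k → EuclideanSpace ℝ (Fin d)) (ρ u v : ℝ) : Prop :=
  IsSubcurve n (u, v) ∧ FreePath (Free p c ρ) u 0 v ((k - 1 : ℕ) : ℝ)

/-- The set of pairs that a record stands for: the pair `(b, a)` if `b < a`, and all pairs `(x, x)`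
with `a ≤ x ≤ b` otherwise. -/
def recordSet (a b : ℝ) : Set (ℝ × ℝ) :=
  {x | (b < a ∧ x = (b, a)) ∨ (a ≤ b ∧ x.1 = x.2 ∧ a ≤ x.1 ∧ x.1 ≤ b)}

/-- A sequence of candidates, ordered by their first components, that dominates all feasible
pairs. Candidates with negative second component are void. -/
structure IsStream (Q : ℝ → ℝ → Prop) (N : ℕ) (a b : ℕ → ℝ) : Prop where
  sound : ∀ g < N, b g ≤ -1 ∨ (0 ≤ a g ∧ 0 ≤ b g ∧ ∀ x ∈ recordSet (a g) (b g), Q x.1 x.2)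
  sorted : ∀ g g', g < g' → g' < N → 0 ≤ b g → 0 ≤ b g' → a g ≤ a g'
  complete : ∀ u v, Q u v → 0 ≤ u ∧ u ≤ v ∧ ∃ g < N, a g ≤ v ∧ u ≤ b g

/-- The records after the first `g` candidates. -/
structure IsFront (Q : ℝ → ℝ → Prop) (a b : ℕ → ℝ) (g r : ℕ) (A B : ℕ → ℝ) : Prop where
  mono : ∀ j j', j < j' → j' < r → A j < A j' ∧ B j < B j' ∧ B j < A j'
  sound : ∀ j < r, ∀ x ∈ recordSet (A j) (B j), Q x.1 x.2
  nonneg : ∀ j < r, 0 ≤ A j ∧ 0 ≤ B j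
  source : ∀ j < r, ∃ g' < g, 0 ≤ b g' ∧ A j = a g'
  complete : ∀ g' < g, b g' ≤ -1 ∨ ∃ j < r, A j ≤ a g' ∧ b g' ≤ B j
  le : r ≤ g

/-- The last entry of the first `r` entries of a sequence, or `-1`. -/
noncomputable def lastOr (r : ℕ) (A : ℕ → ℝ) : ℝ := if r = 0 then -1 else A (r - 1)

/-! ### The sweep that extracts the inclusion-minimal pairs from a sorted stream. -/

section

variable {Q : ℝ → ℝ → Prop} {N g r : ℕ} {a b A B : ℕ → ℝ}

theorem isFront_zero : IsFront Q a b 0 0 A B := by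
  constructor <;> intros <;> omega

theorem lastOr_succ (r : ℕ) (A : ℕ → ℝ) : lastOr (r + 1) A = A r := by simp [lastOr]

theorem lastOr_ge (hA : ∀ j < r, 0 ≤ A j) : -1 ≤ lastOr r A := by
  unfold lastOr
  split_ifs with h
  · exact le_rfl
  · linarith [hA (r - 1) (by omega)]

/-- The last record stems from an earlier candidate, so its end is no later; if its start is no
earlier either, it dominates the new candidate. Without records the comparison value is -1, and the
candidate must be void. -/
theorem IsFront.skip (hs : IsStream Q N a b) (hg : g < N) (h : IsFront Q a b g r A B)
    (hb : b g ≤ lastOr r B) : IsFront Q a b (g + 1) r A B := by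
  refine ⟨h.mono, h.sound, h.nonneg, fun j hj => ?_, fun g' hg' => ?_, h.le.trans (by omega)⟩
  · obtain ⟨g', h1, h2⟩ := h.source j hj
    exact ⟨g', by omega, h2⟩
  · rcases Nat.lt_or_ge g' g with h1 | h1
    · exact h.complete g' h1
    obtain rfl : g' = g := by omega
    unfold lastOr at hb
    split_ifs at hb with hr
    · exact .inl hb
    · refine (hs.sound g' hg).imp id fun hv => ⟨r - 1, by omega, ?_, hb⟩
      obtain ⟨g'', h2, h3, h4⟩ := h.source (r - 1) (by omega)
      rw [h4]
      exact hs.sorted g'' g' h2 hg h3 hv.2.1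

theorem IsFront.valid (hs : IsStream Q N a b) (hg : g < N) (h : IsFront Q a b g r A B)
    (hb : lastOr r B < b g) :
    0 ≤ a g ∧ 0 ≤ b g ∧ ∀ x ∈ recordSet (a g) (b g), Q x.1 x.2 := by
  have := lastOr_ge fun j hj => (h.nonneg j hj).2
  rcases hs.sound g hg with h1 | h1
  · linarith
  · exact h1

/-- There are two cases. If `a g` equals the last `A`, the candidate has the same end and a later
start, and replaces the record. Otherwise `a g` is at most the last `B`, both stand for one-point
subcurves, and the overlapping intervals unite to the one from the last `A` to `b g`. Raising the
last `B` to `b g` is right in both. -/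
theorem IsFront.merge (hs : IsStream Q N a b) (hg : g < N) (h : IsFront Q a b g r A B)
    (hb : lastOr r B < b g) (ha : a g ≤ max (lastOr r A) (lastOr r B)) :
    0 < r ∧ IsFront Q a b (g + 1) r A (Function.update B (r - 1) (b g)) := by
  obtain ⟨v1, v2, v3⟩ := h.valid hs hg hb
  have hr : r ≠ 0 := by
    rintro rfl
    simp only [lastOr, if_true, max_self] at ha
    linarith
  obtain ⟨r, rfl⟩ := Nat.exists_eq_succ_of_ne_zero hr
  simp only [Nat.succ_eq_add_one, lastOr_succ, Nat.add_sub_cancel] at *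
  have hAa : A r ≤ a g := by
    obtain ⟨g'', h2, h3, h4⟩ := h.source r (by omega)
    rw [h4]
    exact hs.sorted g'' g h2 hg h3 v2
  refine ⟨by omega, ⟨fun j j' h1 h2 => ?_, fun j hj => ?_, fun j hj => ?_, fun j hj => ?_,
    fun g' hg' => ?_, h.le.trans (by omega)⟩⟩
  · obtain ⟨m1, m2, m3⟩ := h.mono j j' h1 h2
    rw [Function.update_of_ne (by omega : j ≠ r)]
    refine ⟨m1, ?_, m3⟩
    by_cases hj : j' = r
    · subst hj
      rw [Function.update_self]
      exact m2.trans hb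
    · rwa [Function.update_of_ne hj]
  · by_cases hjr : j = r
    · subst hjr
      rw [Function.update_self]
      rintro ⟨x1, x2⟩ (⟨h1, h2⟩ | ⟨h1, h2, h3, h4⟩)
      · have : a g = A j := by
          rcases le_max_iff.1 ha with h' | h'
          · exact le_antisymm h' hAa
          · linarith
        exact v3 _ (.inl ⟨by rwa [this], by rw [this]; exact h2⟩)
      · simp only at h2 h3 h4
        subst h2
        rcases le_total (a g) x1 with h5 | h5
        · exact v3 (x1, x1) (.inr ⟨h5.trans h4, rfl, h5, h4⟩)
        · rcases le_max_iff.1 ha with h' | h'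
          · exact v3 (x1, x1) (.inr ⟨by linarith, rfl, by linarith, h4⟩)
          · exact h.sound j hj (x1, x1)
              (.inr ⟨by linarith, rfl, h3, h5.trans h'⟩)
    · rw [Function.update_of_ne hjr]
      exact h.sound j hj
  · by_cases hjr : j = r
    · subst hjr
      rw [Function.update_self]
      exact ⟨(h.nonneg j hj).1, v2⟩
    · rw [Function.update_of_ne hjr]
      exact h.nonneg j hj
  · obtain ⟨g', h1, h2⟩ := h.source j hj
    exact ⟨g', by omega, h2⟩
  · rcases Nat.lt_or_ge g' g with h1 | h1
    · refine (h.complete g' h1).imp id ?_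
      rintro ⟨j, j1, j2, j3⟩
      refine ⟨j, j1, j2, ?_⟩
      by_cases hjr : j = r
      · subst hjr
        rw [Function.update_self]
        exact j3.trans hb.le
      · rwa [Function.update_of_ne hjr]
    · obtain rfl : g' = g := by omega
      exact .inr ⟨r, by omega, hAa, by rw [Function.update_self]⟩

/-- The candidate ends later than the last record and beyond its interval of points, so it is
comparable to no earlier record. The bound by the last `B` keeps the records disjoint. -/
theorem IsFront.push (hs : IsStream Q N a b) (hg : g < N) (h : IsFront Q a b g r A B)
    (hb : lastOr r B < b g) (ha : max (lastOr r A) (lastOr r B) < a g) :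
    IsFront Q a b (g + 1) (r + 1) (Function.update A r (a g)) (Function.update B r (b g)) := by
  obtain ⟨v1, v2, v3⟩ := h.valid hs hg hb
  have hlast : ∀ j < r, A j ≤ lastOr r A ∧ B j ≤ lastOr r B := by
    intro j hj
    rw [lastOr, lastOr, if_neg (by omega), if_neg (by omega)]
    rcases Nat.lt_or_ge j (r - 1) with h1 | h1
    · have := h.mono j (r - 1) h1 (by omega)
      exact ⟨this.1.le, this.2.1.le⟩
    · obtain rfl : j = r - 1 := by omega
      exact ⟨le_rfl, le_rfl⟩
  rw [max_lt_iff] at ha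
  refine ⟨fun j j' h1 h2 => ?_, fun j hj => ?_, fun j hj => ?_, fun j hj => ?_,
    fun g' hg' => ?_, by have := h.le; omega⟩
  · rw [Function.update_of_ne (by omega : j ≠ r), Function.update_of_ne (by omega : j ≠ r)]
    by_cases hj : j' = r
    · subst hj
      rw [Function.update_self, Function.update_self]
      obtain ⟨l1, l2⟩ := hlast j h1
      exact ⟨by linarith, by linarith, by linarith⟩
    · rw [Function.update_of_ne hj, Function.update_of_ne hj]
      exact h.mono j j' h1 (by omega)
  · by_cases hjr : j = r
    · subst hjr
      rwa [Function.update_self, Function.update_self]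
    · rw [Function.update_of_ne hjr, Function.update_of_ne hjr]
      exact h.sound j (by omega)
  · by_cases hjr : j = r
    · subst hjr
      rw [Function.update_self, Function.update_self]
      exact ⟨v1, v2⟩
    · rw [Function.update_of_ne hjr, Function.update_of_ne hjr]
      exact h.nonneg j (by omega)
  · by_cases hjr : j = r
    · subst hjr
      rw [Function.update_self]
      exact ⟨g, by omega, v2, rfl⟩
    · rw [Function.update_of_ne hjr]
      obtain ⟨g', h1, h2⟩ := h.source j (by omega)
      exact ⟨g', by omega, h2⟩
  · rcases Nat.lt_or_ge g' g with h1 | h1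
    · refine (h.complete g' h1).imp id ?_
      rintro ⟨j, j1, j2, j3⟩
      refine ⟨j, by omega, ?_⟩
      rw [Function.update_of_ne (by omega : j ≠ r), Function.update_of_ne (by omega : j ≠ r)]
      exact ⟨j2, j3⟩
    · obtain rfl : g' = g := by omega
      exact .inr ⟨r, by omega, by rw [Function.update_self], by rw [Function.update_self]⟩

/-- The final records dominate all feasible pairs. -/
theorem IsFront.dominates (hs : IsStream Q N a b) (h : IsFront Q a b N r A B) {u v : ℝ}
    (hQ : Q u v) : ∃ j < r, A j ≤ v ∧ u ≤ B j := by
  obtain ⟨h0, h1, g, hg, h2, h3⟩ := hs.complete u v hQ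
  rcases h.complete g hg with h4 | ⟨j, j1, j2, j3⟩
  · linarith
  · exact ⟨j, j1, j2.trans h2, h3.trans j3⟩

theorem recordSet_nonempty (x y : ℝ) : (recordSet x y).Nonempty := by
  rcases lt_or_ge y x with h | h
  · exact ⟨(y, x), .inl ⟨h, rfl⟩⟩
  · exact ⟨(x, x), .inr ⟨h, rfl, le_rfl, h⟩⟩

/-- A proper pair never equals a one-point subcurve, two proper pairs differ in the strictly
increasing `B`, and two intervals of points are separated by `B j < A j'`. -/
theorem IsFront.disjoint (h : IsFront Q a b g r A B) {j j' : ℕ} (hjj : j < j') (hj' : j' < r) :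
    Disjoint (recordSet (A j) (B j)) (recordSet (A j') (B j')) := by
  obtain ⟨m1, m2, m3⟩ := h.mono j j' hjj hj'
  rw [Set.disjoint_left]
  rintro ⟨x1, x2⟩ (⟨h1, h2⟩ | ⟨h1, h2, h3, h4⟩) (⟨h5, h6⟩ | ⟨h5, h6, h7, h8⟩)
  · rw [h2, Prod.mk.injEq] at h6
    linarith [h6.1]
  · rw [Prod.mk.injEq] at h2
    simp only at h6
    linarith [h2.1, h2.2]
  · rw [Prod.mk.injEq] at h6
    simp only at h2
    linarith [h6.1, h6.2]
  · simp only at h4 h7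
    linarith

/-- The final records stand for exactly the inclusion-minimal feasible pairs. -/
theorem IsFront.minimal (hs : IsStream Q N a b) (h : IsFront Q a b N r A B) (x : ℝ × ℝ) :
    (∃ j < r, x ∈ recordSet (A j) (B j)) ↔
      Q x.1 x.2 ∧ ∀ y : ℝ × ℝ, Q y.1 y.2 → x.1 ≤ y.1 → y.2 ≤ x.2 → y = x := by
  constructor
  · rintro ⟨j, hj, hx⟩
    refine ⟨h.sound j hj x hx, fun y hy h1 h2 => ?_⟩
    have hy' := (hs.complete _ _ hy).2.1
    rcases hx with ⟨h3, rfl⟩ | ⟨h3, h4, h5, h6⟩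
    · obtain ⟨j', j1, j2, j3⟩ := h.dominates hs hy
      simp only at h1 h2
      -- The competitor inside the record is itself dominated by some record `j'`. Since both
      -- components increase strictly, `j'` can be neither smaller nor greater than `j`.
      have : j' = j := by
        rcases lt_trichotomy j' j with hl | hl | hl
        · have := (h.mono j' j hl hj).2.1
          linarith
        · exact hl
        · have := (h.mono j j' hl j1).1
          linarith
      subst this
      ext <;> simp only <;> linarith
    · ext <;> linarith
  · rintro ⟨hx, hmin⟩
    have hx' := (hs.complete _ _ hx).2.1
    obtain ⟨j, hj, h1, h2⟩ := h.dominates hs hx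
    refine ⟨j, hj, ?_⟩
    rcases lt_or_ge (B j) (A j) with h3 | h3
    · have h4 : (B j, A j) ∈ recordSet (A j) (B j) := .inl ⟨h3, rfl⟩
      rwa [hmin _ (h.sound j hj _ h4) h2 h1] at h4
    -- The dominating record contains a one-point subcurve inside `x`, and minimality forces `x` to
    -- be that point.
    · have h4 : (max x.1 (A j), max x.1 (A j)) ∈ recordSet (A j) (B j) :=
        .inr ⟨h3, rfl, le_max_right _ _, max_le h2 h3⟩
      rwa [hmin _ (h.sound j hj _ h4) (le_max_left _ _) (max_le hx' h1)] at h4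

/-- The feasible pairs contain members of the records. -/
theorem IsFront.exists_mem (hs : IsStream Q N a b) (h : IsFront Q a b N r A B) {u v : ℝ}
    (hQ : Q u v) : ∃ j < r, ∃ x ∈ recordSet (A j) (B j), u ≤ x.1 ∧ x.2 ≤ v := by
  have hx' := (hs.complete _ _ hQ).2.1
  obtain ⟨j, hj, h1, h2⟩ := h.dominates hs hQ
  refine ⟨j, hj, ?_⟩
  rcases lt_or_ge (B j) (A j) with h3 | h3
  · exact ⟨(B j, A j), .inl ⟨h3, rfl⟩, h2, h1⟩
  · exact ⟨(max u (A j), max u (A j)), .inr ⟨h3, rfl, le_max_right _ _, max_le h2 h3⟩,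
      le_max_left _ _, max_le hx' h1⟩

end

/-- The store holds `r` records with the components `A`, `B`. -/
structure Store.HoldsRecords (O : Store) (r : ℕ) (A B : ℕ → ℝ) : Prop where
  flag : ∀ j < r, O.int (j + 1) = if A j ≤ B j then 1 else 0
  fst : ∀ j < r, O.real (2 * j) = min (A j) (B j)
  snd : ∀ j < r, O.real (2 * j + 1) = max (A j) (B j)

/-- The cells hold minimum and maximum of `A j` and `B j`: this is the pair `(B j, A j)` if `B j < A
j`, and the range of the one-point subcurves otherwise. The flag tells the cases apart. -/
theorem Store.HoldsRecords.record_eq {O : Store} {r : ℕ} {A B : ℕ → ℝ}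
    (h : O.HoldsRecords r A B) {j : ℕ} (hj : j < r) : O.record j = recordSet (A j) (B j) := by
  ext x
  simp only [Store.record, recordSet, Set.mem_ofPred_eq, h.flag j hj, h.fst j hj, h.snd j hj]
  rcases lt_or_ge (B j) (A j) with h1 | h1
  · simp [h1, not_le.2 h1, h1.le]
  · simp [h1, not_lt.2 h1]

theorem Store.HoldsRecords.reports {Q : ℝ → ℝ → Prop} {N r : ℕ} {a b A B : ℕ → ℝ} {O : Store}
    (h : O.HoldsRecords r A B) (h0 : O.int 0 = (r : ℤ)) (hs : IsStream Q N a b)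
    (hf : IsFront Q a b N r A B) :
    O.Reports r {x | Q x.1 x.2 ∧ ∀ y : ℝ × ℝ, Q y.1 y.2 → x.1 ≤ y.1 → y.2 ≤ x.2 → y = x} := by
  refine ⟨h0, fun j hj => ?_, fun j hj j' hj' hne => ?_, ?_⟩
  · rw [h.record_eq hj]
    exact recordSet_nonempty _ _
  · rw [h.record_eq hj, h.record_eq hj']
    rcases Nat.lt_or_gt_of_ne hne with hlt | hlt
    · exact hf.disjoint hlt hj'
    · exact (hf.disjoint hlt hj).symm
  · ext x
    simp only [Set.mem_ofPred_eq]
    rw [← hf.minimal hs x]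
    exact exists_congr fun j => and_congr_right fun hj => by rw [h.record_eq hj]

/-! ### The candidates of a curve -/

/-- The entries at the bottom level of the current column. -/
def bottomProg (d : ℕ) : Program :=
  levelProg d (.litI 0) ;;
  RVar.va.put (slotE (.subI lenE (.litI 1))) RVar.ca.e ;;
  .branch (.leR RVar.ca.e RVar.cb.e)
    (RVar.vb.put (slotE (.subI lenE (.litI 1))) RVar.cb.e)
    (RVar.vb.put (slotE (.subI lenE (.litI 1))) (.litR (-1)))

/-- The entries of all columns at the top level. -/
def candidatesProg (d : ℕ) : Program :=
  .forLoop .col numE (bottomProg d) ;; .forLoop .lev (.subI lenE (.litI 1)) (rowProg d)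

section

variable {n k d : ℕ} {p : Fin n → EuclideanSpace ℝ (Fin d)} {δ ε : ℝ}
  {c : Fin k → EuclideanSpace ℝ (Fin d)} {ρ : ℝ} {m : Memory}

theorem within_bottomProg (h : Holds p δ ε c ρ m) (hk : 1 ≤ k) {i : ℕ} (hi : m.I .col = (i : ℤ)) :
    (bottomProg d).Within m (bottomProg d).cost fun m' =>
      m.Kept m' ∧ m'.I .col = (i : ℤ) ∧ SlotsOK p c ρ m' i 0 ∧
      ∀ z : ℕ, z ≠ i * k + (k - 1) → m'.R .va z = m.R .va z ∧ m'.R .vb z = m.R .vb z := by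
  refine Program.LoopFree.within (by simp [bottomProg, levelProg, loopFree_clipProg]) ?_
  obtain ⟨a, b, c', lo, hi', A, B, e1, e2⟩ := den_levelProg h hi (by omega : 0 < k)
    (e := .litI 0) (fun m' hm' => rfl)
  set m1 := ((((((m.putR .aa 0 a).putR .bb 0 b).putR .cc 0
        c').putR .lo 0 lo).putR .hi 0 hi').putR .ca 0 A).putR .cb 0 B with hm1
  have haddr : ∀ m' : Memory, m' .inp = m .inp → m'.I .col = m.I .col →
      (slotE (.subI lenE (.litI 1))).eval m' = ((i * k + (k - 1) : ℕ) : ℤ) := by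
    intro m' g1 g2
    simp only [slotE, Exp.eval_addI, Exp.eval_mulI, Exp.eval_subI, Exp.eval_ivar, Exp.eval_litI,
      Holds.eval_lenE (g1.trans h.inp), g2, hi]
    push_cast [hk]
    ring
  classical
  have hden : (bottomProg d).den m = (m1.putR .va (i * k + (k - 1) : ℕ) A).putR .vb
      (i * k + (k - 1) : ℕ) (if A ≤ B then B else -1) := by
    have v1 : m1.R .ca 0 = A := by simp [hm1]
    have v2 : m1.R .cb 0 = B := by simp [hm1]
    simp only [bottomProg, Program.den_seq, e1, Program.den_put,
      haddr m1 (by simp [hm1]) (by simp [hm1]), Exp.eval_rvar,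
      Program.den_branch, Test.holds_leR, v1, Memory.R_putR_zero, reduceCtorEq, false_and, if_false,
      v2]
    split_ifs with h1
    · rw [haddr _ (by simp [hm1]) (by simp [hm1])]
    · rw [haddr _ (by simp [hm1]) (by simp [hm1])]
      simp
  rw [hden]
  refine ⟨?_, by simp [hm1, hi], ?_, ?_⟩
  · constructor <;> simp [hm1]
  · have hk' : k - 1 - 0 = k - 1 := rfl
    have hk2 : k = k - 1 + 1 := by omega
    unfold SlotsOK
    rw [hk']
    have := columnOK_bottom (f := k - 1) (by simpa using e2)
      (a := fun f => ((m1.putR .va (i * k + (k - 1) : ℕ) A).putR .vb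
        (i * k + (k - 1) : ℕ) (if A ≤ B then B else -1)).R .va (i * k + f : ℕ))
      (b := fun f => ((m1.putR .va (i * k + (k - 1) : ℕ) A).putR .vb
        (i * k + (k - 1) : ℕ) (if A ≤ B then B else -1)).R .vb (i * k + f : ℕ))
      (fun h => by
        generalize i * k + (k - 1) = y
        simp) (fun h => by
        generalize i * k + (k - 1) = y
        simp [h]) (fun h => by
        generalize i * k + (k - 1) = y
        simp [not_le.2 h])
    rw [← hk2] at this
    simpa using this
  · generalize i * k + (k - 1) = y
    intro z hz
    have hz' : (z : ℤ) ≠ (y : ℤ) := by exact_mod_cast hz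
    simp only [Memory.R_putR_natCast, hz', and_false, if_false, hm1, reduceCtorEq, false_and,
      and_self]

/-- A bound for the time of the computation of the candidates, divided by `n * k * k`. -/
def candidatesCost (d : ℕ) : ℕ := (bottomProg d).cost + rowCost d + 100

theorem candidates_time {n k b r t₁ t₂ : ℕ} (hn : 1 ≤ n) (hk : 1 ≤ k)
    (h1 : t₁ ≤ n * (b + 2 + 9) + 2 + 6) (h2 : t₂ ≤ (k - 1) * (n * (k * r) + 4 + 9) + 4 + 6) :
    t₁ + t₂ ≤ n * (k * (k * (b + r + 100))) := by
  have e1 : n * (b + 11) ≤ n * (k * (k * (b + 11))) :=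
    Nat.mul_le_mul_left _ ((Nat.le_mul_of_pos_left _ hk).trans
      (Nat.mul_le_mul_left _ (Nat.le_mul_of_pos_left _ hk)))
  have e2 : (k - 1) * (n * (k * r) + 13) ≤ k * (n * (k * r) + 13) :=
    Nat.mul_le_mul_right _ (Nat.sub_le _ _)
  have e3 : k * 13 ≤ n * (k * (k * 13)) :=
    (Nat.mul_le_mul_left _ (Nat.le_mul_of_pos_left _ hk)).trans (Nat.le_mul_of_pos_left _ hn)
  have e4 : 1 ≤ n * (k * k) := Nat.mul_pos hn (Nat.mul_pos hk hk)
  nlinarith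

/-- The bottom level is set up for all columns, and then `k - 1` rows lift all columns by one level
each. -/
theorem within_candidatesProg (h : Holds p δ ε c ρ m) (hn : 1 ≤ n) (hk : 1 ≤ k) :
    (candidatesProg d).Within m (n * (k * (k * candidatesCost d))) fun m' =>
      m.Kept m' ∧ ∀ i < n, SlotsOK p c ρ m' i (k - 1) := by
  have first : (Program.forLoop .col numE (bottomProg d)).Within m
      (n * ((bottomProg d).cost + 2 + 9) + 2 + 6) fun m' =>
      m.Kept m' ∧ ∀ i < n, SlotsOK p c ρ m' i 0 := by
    refine (Program.Within.forLoop (c := (bottomProg d).cost) (K := n)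
      (fun i m' => m'.I .col = (i : ℤ) ∧ m.Kept m' ∧ ∀ j < i, SlotsOK p c ρ m' j 0)
      (fun j m' h' => Holds.eval_numE (h'.2.1.inp.trans h.inp)) (fun j m' h' => h'.1) ?_ ?_).mono
      le_rfl (fun m' h' => h'.2)
    · refine ⟨by simp, ?_, by simp⟩
      constructor <;> simp
    · rintro i hi m' ⟨col, K, S⟩
      refine (within_bottomProg (h.kept K) hk col).mono le_rfl ?_
      rintro m'' ⟨K', col', S', O⟩
      refine ⟨col', by simp, (K.trans K').trans ?_, fun j hj => ?_⟩
      · constructor <;> simp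
      · refine SlotsOK.congr (m := m'') ?_ (by simp)
        rcases Nat.lt_or_ge j i with hji | hji
        · refine (S j hji).congr fun f hf => O _ ?_
          have : (j + 1) * k ≤ i * k := Nat.mul_le_mul_right _ hji
          have : (j + 1) * k = j * k + k := by ring
          omega
        · obtain rfl : j = i := by omega
          exact S'
  obtain ⟨t₁, m₁, r₁, ht₁, K₁, S₁⟩ := first
  have h₁ := h.kept K₁
  have second : (Program.forLoop .lev (.subI lenE (.litI 1)) (rowProg d)).Within m₁
      ((k - 1) * (n * (k * rowCost d) + 4 + 9) + 4 + 6) fun m' =>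
      m₁.Kept m' ∧ ∀ i < n, SlotsOK p c ρ m' i (k - 1) := by
    refine (Program.Within.forLoop (c := n * (k * rowCost d)) (K := k - 1)
      (fun l m' => m'.I .lev = (l : ℤ) ∧ m₁.Kept m' ∧ ∀ j < n, SlotsOK p c ρ m' j l)
      (fun j m' h' => ?_) (fun j m' h' => h'.1) ?_ ?_).mono
      le_rfl (fun m' h' => h'.2)
    · simp only [Exp.eval_subI, Holds.eval_lenE (h'.2.1.inp.trans h₁.inp), Exp.eval_litI]
      show (k : ℤ) - 1 = _
      omega
    · refine ⟨by simp, ?_, fun j hj => (S₁ j hj).congr (by simp)⟩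
      constructor <;> simp
    · rintro l hl m' ⟨lev, K, S⟩
      refine (within_rowProg (h₁.kept K) hn lev (by omega) S).mono le_rfl ?_
      rintro m'' ⟨K', lev', S'⟩
      refine ⟨lev', by simp, (K.trans K').trans ?_, fun j hj => (S' j hj).congr (by simp)⟩
      constructor <;> simp
  obtain ⟨t₂, m₂, r₂, ht₂, K₂, S₂⟩ := second
  exact ⟨_, m₂, .seq r₁ r₂, candidates_time hn hk ht₁ ht₂, K₁.trans K₂, S₂⟩

theorem Feasible.of_reach {u v : ℝ} {i : ℕ} (h : Reach (Free p c ρ) u v ((k - 1 : ℕ) : ℝ))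
    (hv : v ≤ i + width n i) : Feasible p c ρ u v := by
  have : width n i ≤ (n : ℝ) - 1 - i := min_le_right _ _
  exact ⟨⟨h.1, h.le, by simp only; linarith⟩, h.2⟩

/-- The entries of the columns at the top level form a stream of candidates. -/
theorem isStream_candidates (hk : 1 ≤ k)
    (h : ∀ i < n, SlotsOK p c ρ m i (k - 1)) :
    IsStream (Feasible p c ρ) (n * k) (fun g => m.R .va (g : ℕ)) (fun g => m.R .vb (g : ℕ)) := by
  have hk0 : k - 1 - (k - 1) = 0 := Nat.sub_self _
  have split : ∀ g < n * k, ∃ i < n, ∃ f < k, g = i * k + f := by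
    intro g hg
    refine ⟨g / k, Nat.div_lt_of_lt_mul (by rwa [mul_comm]), g % k, Nat.mod_lt _ hk, ?_⟩
    rw [mul_comm, Nat.div_add_mod]
  have entry : ∀ i < n, ∀ f < k, m.R .vb (i * k + f : ℕ) ≤ -1 ∨
      IsEntry (Free p c ρ) i (width n i) ((k - 1 : ℕ) : ℝ) (m.R .va (i * k + f : ℕ))
        (m.R .vb (i * k + f : ℕ)) :=
    fun i hi f hf => (h i hi).sound f (by omega) hf
  constructor
  · intro g hg
    obtain ⟨i, hi, f, hf, rfl⟩ := split g hg
    refine (entry i hi f hf).imp id fun he => ?_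
    refine ⟨(Nat.cast_nonneg i).trans he.left_le, he.nonneg, ?_⟩
    rintro ⟨x1, x2⟩ (⟨h1, h2⟩ | ⟨h1, h2, h3, h4⟩)
    · rw [Prod.mk.injEq] at h2
      simp only [h2.1, h2.2]
      have := he.reach _ le_rfl (le_max_left _ _)
      rw [min_eq_left h1.le] at this
      exact .of_reach this he.le_right
    · simp only at h2 h3 h4 ⊢
      subst h2
      have := he.reach x1 h3 (h4.trans (le_max_right _ _))
      rw [min_eq_right h4] at this
      exact .of_reach this (h4.trans he.start_le)
  · intro g g' hlt hg' hb hb'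
    obtain ⟨i, hi, f, hf, rfl⟩ := split g (hlt.trans hg')
    obtain ⟨i', hi', f', hf', rfl⟩ := split g' hg'
    have hii : i ≤ i' := by
      by_contra! hc
      have e1 : (i' + 1) * k ≤ i * k := Nat.mul_le_mul_right _ hc
      have e2 : (i' + 1) * k = i' * k + k := by ring
      omega
    rcases Nat.lt_or_ge i i' with hc | hc
    -- Across columns the order is automatic: the first component of an entry lies in its own
    -- column, and the columns follow each other in the array.
    · have e1 := (entry i hi f hf).resolve_left (by linarith)
      have e2 := (entry i' hi' f' hf').resolve_left (by linarith)
      have e3 : (i : ℝ) + 1 ≤ i' := by exact_mod_cast hc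
      have e4 := width_le_one n i
      have e5 := e1.le_right
      have e6 := e2.left_le
      linarith
    · obtain rfl : i = i' := by omega
      exact (h i hi).sorted f f' (by omega) (by omega) hf' hb hb'
  · rintro u v ⟨⟨h1, h2, h3⟩, h4⟩
    simp only at h1 h2 h3
    have hv : 0 ≤ v := h1.trans h2
    refine ⟨h1, h2, ?_⟩
    have hi : ⌊v⌋₊ < n := by
      have := Nat.floor_le hv
      have : (⌊v⌋₊ : ℝ) < n := by linarith
      exact_mod_cast this
    -- The end point belongs to column `⌊v⌋₊`; the end `v = n - 1` is caught by the last column of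
    -- width 0.
    have hw : v ≤ ⌊v⌋₊ + width n ⌊v⌋₊ := by
      have := (Nat.lt_floor_add_one v).le
      rw [width, ← sub_le_iff_le_add', le_min_iff]
      constructor <;> linarith
    obtain ⟨f, -, f2, f3, f4⟩ := (h _ hi).complete u v (Nat.floor_le hv) hw ⟨h1, h4⟩
    refine ⟨⌊v⌋₊ * k + f, ?_, f3, f4⟩
    calc ⌊v⌋₊ * k + f < ⌊v⌋₊ * k + k := by omega
      _ = (⌊v⌋₊ + 1) * k := by ring
      _ ≤ n * k := Nat.mul_le_mul_right _ hi

end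

/-! ### The records of a curve -/

/-- The address of the first integer cell of the records of the curve with number `g`, where there
are at most `N` records for each curve. -/
def intBase (N g : ℕ) : ℕ := 2 + g * (N + 1)

/-- The address of the first real cell of the records of the curve with number `g`. -/
def realBase (d N g : ℕ) : ℕ := 1 + d + g * (2 * N)

/-- The part of a store that holds the records of the curve with number `g`. -/
def Store.part (S : Store) (d N g : ℕ) : Store :=
  ⟨fun i => S.int (intBase N g + i), fun i => S.real (realBase d N g + i)⟩

/-- The address of an integer cell of the records of the current curve. -/
def intCellE (a : Exp .int) : Exp .int :=
  .addI (.addI (.litI 2) (.mulI IVar.idx.e (.addI IVar.num.e (.litI 1)))) a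

/-- The address of a real cell of the records of the current curve. -/
def realCellE (d : ℕ) (a : Exp .int) : Exp .int :=
  .addI (.addI (.litI (1 + d : ℕ)) (.mulI IVar.idx.e (.mulI (.litI 2) IVar.num.e))) a

/-- Write the record with the components `last`, `top`. -/
def recordProg (d : ℕ) : Program :=
  .branch (.leR RVar.last.e RVar.top.e)
    (.setI .ds (intCellE IVar.cnt.e) (.litI 1))
    (.setI .ds (intCellE IVar.cnt.e) (.litI 0)) ;;
  .setR .ds (realCellE d (.subI (.mulI (.litI 2) IVar.cnt.e) (.litI 2)))
    (.min RVar.last.e RVar.top.e) ;;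
  .setR .ds (realCellE d (.subI (.mulI (.litI 2) IVar.cnt.e) (.litI 1)))
    (.max RVar.last.e RVar.top.e)

/-- Process the candidate with number `pos`. -/
def candidateProg (d : ℕ) : Program :=
  .branch (.ltR RVar.top.e (RVar.vb.get IVar.pos.e))
    (.branch (.leR (RVar.va.get IVar.pos.e) (.max RVar.last.e RVar.top.e))
        .skip
        (RVar.last.set (RVar.va.get IVar.pos.e) ;; IVar.cnt.set (.addI IVar.cnt.e (.litI 1))) ;;
      RVar.top.set (RVar.vb.get IVar.pos.e) ;;
      recordProg d)
    .skip

/-- Write the records of the current curve. -/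
def outputProg (d : ℕ) : Program :=
  (IVar.cnt.set (.litI 0) ;; RVar.top.set (.litR (-1)) ;; RVar.last.set (.litR (-1))) ;;
  .forLoop .pos IVar.num.e (candidateProg d) ;;
  .setI .ds (intCellE (.litI 0)) IVar.cnt.e

/-- The second memory agrees with the first one except in the cells of the records of the curve
with number `g` and in the working variables of the algorithm for a single curve. -/
structure Memory.KeptP (d N g : ℕ) (m m' : Memory) : Prop where
  inp : m' .inp = m .inp
  idx : m'.I .idx = m.I .idx
  num : m'.I .num = m.I .num
  side : m'.I .side = m.I .side
  rho : m'.R .rho 0 = m.R .rho 0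
  base : m'.I .base = m.I .base
  step : m'.R .step 0 = m.R .step 0
  int : ∀ i, i < intBase N g ∨ intBase N g + N < i → (m' .ds).int i = (m .ds).int i
  real : ∀ i, i < realBase d N g ∨ realBase d N g + 2 * N ≤ i →
    (m' .ds).real i = (m .ds).real i

theorem Memory.KeptP.trans {d N g : ℕ} {m m' m'' : Memory} (h : m.KeptP d N g m')
    (h' : m'.KeptP d N g m'') : m.KeptP d N g m'' :=
  ⟨h'.inp.trans h.inp, h'.idx.trans h.idx, h'.num.trans h.num, h'.side.trans h.side,
    h'.rho.trans h.rho, h'.base.trans h.base, h'.step.trans h.step,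
    fun i hi => (h'.int i hi).trans (h.int i hi), fun i hi => (h'.real i hi).trans (h.real i hi)⟩

theorem Memory.Kept.keptP {m m' : Memory} (h : m.Kept m') (d N g : ℕ) : m.KeptP d N g m' :=
  ⟨h.inp, h.idx, h.num, h.side, h.rho, h.base, h.step, fun i _ => by rw [h.ds],
    fun i _ => by rw [h.ds]⟩

section

variable {d N g : ℕ} {m : Memory}

theorem eval_intCellE (h1 : m.I .idx = (g : ℤ)) (h2 : m.I .num = (N : ℤ)) {a : Exp .int} {i : ℕ}
    (ha : a.eval m = (i : ℤ)) : (intCellE a).eval m = ((intBase N g + i : ℕ) : ℤ) := by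
  simp only [intCellE, Exp.eval_addI, Exp.eval_mulI, Exp.eval_litI, Exp.eval_ivar, h1, h2, ha,
    intBase]
  push_cast
  ring

theorem eval_realCellE (h1 : m.I .idx = (g : ℤ)) (h2 : m.I .num = (N : ℤ)) {a : Exp .int} {i : ℕ}
    (ha : a.eval m = (i : ℤ)) : (realCellE d a).eval m = ((realBase d N g + i : ℕ) : ℤ) := by
  simp only [realCellE, Exp.eval_addI, Exp.eval_mulI, Exp.eval_litI, Exp.eval_ivar, h1, h2, ha,
    realBase]
  push_cast
  ring

theorem loopFree_recordProg : (recordProg d).LoopFree := by simp [recordProg]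

theorem loopFree_candidateProg : (candidateProg d).LoopFree := by
  simp [candidateProg, loopFree_recordProg]

open Classical in
theorem den_recordProg (h1 : m.I .idx = (g : ℤ)) (h2 : m.I .num = (N : ℤ)) {r : ℕ}
    (hr : m.I .cnt = ((r + 1 : ℕ) : ℤ)) {x y : ℝ} (hx : m.R .last 0 = x) (hy : m.R .top 0 = y) :
    (recordProg d).den m = ((m.writeI .ds (intBase N g + (r + 1)) (if x ≤ y then 1 else 0)).writeR
      .ds (realBase d N g + 2 * r) (min x y)).writeR .ds (realBase d N g + (2 * r + 1))
        (max x y) := by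
  have e1 : ∀ m' : Memory, m'.I .cnt = m.I .cnt →
      Exp.eval m' (.subI (.mulI (.litI 2) IVar.cnt.e) (.litI 2)) = ((2 * r : ℕ) : ℤ) := by
    intro m' h
    simp only [Exp.eval_subI, Exp.eval_mulI, Exp.eval_litI, Exp.eval_ivar, h, hr]
    push_cast
    ring
  have e2 : ∀ m' : Memory, m'.I .cnt = m.I .cnt →
      Exp.eval m' (.subI (.mulI (.litI 2) IVar.cnt.e) (.litI 1)) = ((2 * r + 1 : ℕ) : ℤ) := by
    intro m' h
    simp only [Exp.eval_subI, Exp.eval_mulI, Exp.eval_litI, Exp.eval_ivar, h, hr]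
    push_cast
    ring
  have e3 : (Program.branch (.leR RVar.last.e RVar.top.e)
    (.setI .ds (intCellE IVar.cnt.e) (.litI 1))
    (.setI .ds (intCellE IVar.cnt.e) (.litI 0))).den m =
      m.writeI .ds (intBase N g + (r + 1)) (if x ≤ y then 1 else 0) := by
    simp only [Program.den_branch, Test.holds_leR, Exp.eval_rvar, hx, hy, Program.den_writeI,
      eval_intCellE h1 h2 (show IVar.cnt.e.eval m = _ from hr), Int.toNat_natCast, Exp.eval_litI]
    split_ifs <;> rfl
  simp only [recordProg, Program.den_seq, e3, Program.den_writeR]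
  rw [eval_realCellE (g := g) (N := N) (by simpa using h1) (by simpa using h2)
      (e1 _ (by simp)), eval_realCellE (g := g) (N := N) (by simpa using h1) (by simpa using h2)
      (e2 _ (by simp)), Int.toNat_natCast, Int.toNat_natCast]
  simp [hx, hy]

/-- The state after the first `i` candidates. -/
structure OutputState (Q : ℝ → ℝ → Prop) (d N g : ℕ) (a b : ℕ → ℝ) (i r : ℕ) (A B : ℕ → ℝ)
    (m : Memory) : Prop where
  front : IsFront Q a b i r A B
  idx : m.I .idx = (g : ℤ)
  num : m.I .num = (N : ℤ)
  cnt : m.I .cnt = (r : ℤ)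
  last : m.R .last 0 = lastOr r A
  top : m.R .top 0 = lastOr r B
  records : ((m .ds).part d N g).HoldsRecords r A B
  va : ∀ i < N, m.R .va (i : ℕ) = a i
  vb : ∀ i < N, m.R .vb (i : ℕ) = b i

theorem Store.HoldsRecords.write {O O' : Store} {r : ℕ} {A B A' B' : ℕ → ℝ}
    (h : O.HoldsRecords r A B) (hA : ∀ j < r, A' j = A j) (hB : ∀ j < r, B' j = B j)
    (h1 : ∀ i, i ≠ r + 1 → O'.int i = O.int i) (h2 : ∀ i < 2 * r, O'.real i = O.real i)
    (h3 : O'.int (r + 1) = if A' r ≤ B' r then 1 else 0)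
    (h4 : O'.real (2 * r) = min (A' r) (B' r)) (h5 : O'.real (2 * r + 1) = max (A' r) (B' r)) :
    O'.HoldsRecords (r + 1) A' B' := by
  constructor
  · intro j hj
    rcases Nat.lt_succ_iff_lt_or_eq.1 hj with hj | rfl
    · rw [hA j hj, hB j hj, ← h.flag j hj]
      exact h1 _ (by omega)
    · exact h3
  · intro j hj
    rcases Nat.lt_succ_iff_lt_or_eq.1 hj with hj | rfl
    · rw [hA j hj, hB j hj, ← h.fst j hj]
      exact h2 _ (by omega)
    · exact h4
  · intro j hj
    rcases Nat.lt_succ_iff_lt_or_eq.1 hj with hj | rfl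
    · rw [hA j hj, hB j hj, ← h.snd j hj]
      exact h2 _ (by omega)
    · exact h5

theorem Store.HoldsRecords.of_le {O : Store} {r r' : ℕ} {A B : ℕ → ℝ}
    (h : O.HoldsRecords r A B) (hr : r' ≤ r) : O.HoldsRecords r' A B :=
  ⟨fun j hj => h.flag j (by omega), fun j hj => h.fst j (by omega), fun j hj => h.snd j (by omega)⟩

open Classical in
theorem holdsRecords_write {r : ℕ} {A B A' B' : ℕ → ℝ}
    (h : ((m .ds).part d N g).HoldsRecords r A B)
    (hA : ∀ j < r, A' j = A j) (hB : ∀ j < r, B' j = B j) :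
    (((((m.writeI .ds (intBase N g + (r + 1)) (if A' r ≤ B' r then 1 else 0)).writeR
      .ds (realBase d N g + 2 * r) (min (A' r) (B' r))).writeR .ds (realBase d N g + (2 * r + 1))
        (max (A' r) (B' r))) .ds).part d N g).HoldsRecords (r + 1) A' B' := by
  refine h.write hA hB ?_ ?_ ?_ ?_ ?_
  · intro i hi
    simp [Store.part, hi]
  · intro i hi
    have e1 : i ≠ 2 * r := by omega
    have e2 : i ≠ 2 * r + 1 := by omega
    simp [Store.part, e1, e2]
  · simp [Store.part]
  · simp [Store.part]
  · simp [Store.part]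

open Classical in
theorem keptP_write {r : ℕ} (hr : r < N) (z : ℤ) (x y : ℝ) :
    m.KeptP d N g (((m.writeI .ds (intBase N g + (r + 1)) z).writeR
      .ds (realBase d N g + 2 * r) x).writeR .ds (realBase d N g + (2 * r + 1)) y) := by
  constructor
  case int =>
    intro i hi
    have : i ≠ intBase N g + (r + 1) := by omega
    simp [this]
  case real =>
    intro i hi
    have e1 : i ≠ realBase d N g + 2 * r := by omega
    have e2 : i ≠ realBase d N g + (2 * r + 1) := by omega
    simp [e1, e2]
  all_goals simp

/-- The branches of the program are the three cases `IsFront.skip`, `IsFront.merge` and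
`IsFront.push`. The variables `last` and `top` hold the components of the last record, with -1 if
there is none. -/
theorem within_candidateProg {Q : ℝ → ℝ → Prop} {a b A B : ℕ → ℝ} {i r : ℕ}
    (hs : IsStream Q N a b) (hi : i < N) (h : OutputState Q d N g a b i r A B m)
    (hpos : m.I .pos = (i : ℤ)) :
    (candidateProg d).Within m (candidateProg d).cost fun m' =>
      m'.I .pos = (i : ℤ) ∧ m.KeptP d N g m' ∧
      ∃ r' A' B', OutputState Q d N g a b (i + 1) r' A' B' m' := by
  refine Program.LoopFree.within loopFree_candidateProg ?_
  classical
  have ha := h.va i hi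
  have hb := h.vb i hi
  have hri := h.front.le
  simp only [candidateProg, Program.den_branch, Test.holds_ltR, Exp.eval_rvar, Exp.eval_get,
    Exp.eval_ivar, hpos, hb, h.top, Program.den_skip]
  split_ifs with hlt
  · simp only [Program.den_seq, Program.den_branch, Test.holds_leR, Exp.eval_max, Exp.eval_rvar,
      Exp.eval_get, Exp.eval_ivar, hpos, ha, h.top, h.last, Program.den_skip, Program.den_setR,
      Program.den_setI]
    split_ifs with hle
    · obtain ⟨hr, hf⟩ := h.front.merge hs hi hlt hle
      -- In the merge case the count is unchanged, so the cells of the last record are overwritten;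
      -- the other records keep their cells.
      obtain ⟨r, rfl⟩ := Nat.exists_eq_succ_of_ne_zero (by omega : r ≠ 0)
      simp only [Nat.succ_eq_add_one, Nat.add_sub_cancel] at hf ⊢
      set B' := Function.update B r (b i) with hB'
      have hBr : B' r = b i := by simp [hB']
      set m1 := m.putR .top 0 (m.R .vb (m.I .pos)) with hm1
      have hm1b : m.R .vb (m.I .pos) = b i := by rw [hpos, hb]
      rw [den_recordProg (g := g) (N := N) (r := r) (x := A r) (y := B' r)
        (by simp [hm1, h.idx]) (by simp [hm1, h.num])
        (by simpa [hm1] using h.cnt) (by simpa [hm1, lastOr_succ] using h.last)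
        (by simp [hm1, hm1b, hBr])]
      have k1 : m.KeptP d N g m1 := by
        constructor <;> simp [hm1]
      refine ⟨by simp [hm1, hpos], k1.trans (keptP_write (by omega) _ _ _), r + 1, A, B', ?_⟩
      constructor
      · exact hf
      · simp [hm1, h.idx]
      · simp [hm1, h.num]
      · simpa [hm1] using h.cnt
      · simpa [hm1] using h.last
      · simp [hm1, lastOr_succ, hBr, hm1b]
      · refine holdsRecords_write (A := A) (B := B) (A' := A) (B' := B') ?_ (fun j _ => rfl)
          (fun j hj => ?_)
        · have := h.records.of_le (Nat.le_succ r)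
          simpa [hm1] using this
        · exact Function.update_of_ne (by omega) _ _
      · intro j hj
        simpa [hm1] using h.va j hj
      · intro j hj
        simpa [hm1] using h.vb j hj
    · have hf := h.front.push hs hi hlt (not_le.1 hle)
      set A' := Function.update A r (a i) with hA'
      set B' := Function.update B r (b i) with hB'
      have hAr : A' r = a i := by simp [hA']
      have hBr : B' r = b i := by simp [hB']
      set m1 := (((m.putR .last 0 (a i)).putI .cnt
        ((m.putR .last 0 (a i)).I .cnt + 1)).putR .top 0 (b i)) with hm1
      have hm1' : ((((m.putR .last 0 (a i)).putI .cnt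
        (Exp.eval (m.putR .last 0 (a i)) (.addI IVar.cnt.e (.litI 1))))).putR .top 0
          (((m.putR .last 0 (a i)).putI .cnt
        (Exp.eval (m.putR .last 0 (a i)) (.addI IVar.cnt.e (.litI 1)))).R .vb
          (((m.putR .last 0 (a i)).putI .cnt
        (Exp.eval (m.putR .last 0 (a i)) (.addI IVar.cnt.e (.litI 1)))).I .pos))) = m1 := by
        simp [hm1, hpos, hb]
      rw [hm1']
      have hc : m1.I .cnt = ((r + 1 : ℕ) : ℤ) := by simp [hm1, h.cnt]
      rw [den_recordProg (g := g) (N := N) (r := r) (x := A' r) (y := B' r)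
        (by simp [hm1, h.idx]) (by simp [hm1, h.num]) hc
        (by simp [hm1, hAr]) (by simp [hm1, hBr])]
      have k1 : m.KeptP d N g m1 := by
        constructor <;> simp [hm1]
      refine ⟨by simp [hm1, hpos], k1.trans (keptP_write (by omega) _ _ _), r + 1, A', B', ?_⟩
      constructor
      · exact hf
      · simp [hm1, h.idx]
      · simp [hm1, h.num]
      · simpa using hc
      · simp [hm1, lastOr_succ, hAr]
      · simp [hm1, lastOr_succ, hBr]
      · refine holdsRecords_write (A := A) (B := B) (A' := A') (B' := B') ?_
          (fun j hj => Function.update_of_ne (by omega) _ _)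
          (fun j hj => Function.update_of_ne (by omega) _ _)
        simpa [hm1] using h.records
      · intro j hj
        simpa [hm1] using h.va j hj
      · intro j hj
        simpa [hm1] using h.vb j hj
  · refine ⟨hpos, ?_, r, A, B, { h with front := h.front.skip hs hi (not_lt.1 hlt) }⟩
    constructor <;> simp

/-- A bound for the time of the output of the records of a curve, divided by their number. -/
def outputCost (d : ℕ) : ℕ := (candidateProg d).cost + 100

theorem within_outputProg {Q : ℝ → ℝ → Prop} (hN : 1 ≤ N) (h1 : m.I .idx = (g : ℤ))
    (h2 : m.I .num = (N : ℤ))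
    (hs : IsStream Q N (fun i => m.R .va (i : ℕ)) (fun i => m.R .vb (i : ℕ))) :
    (outputProg d).Within m (N * outputCost d) fun m' =>
      m.KeptP d N g m' ∧ ∃ r ≤ N, ∃ A B, ((m' .ds).part d N g).int 0 = (r : ℤ) ∧
        ((m' .ds).part d N g).HoldsRecords r A B ∧
        IsFront Q (fun i => m.R .va (i : ℕ)) (fun i => m.R .vb (i : ℕ)) N r A B := by
  set a : ℕ → ℝ := fun i => m.R .va (i : ℕ) with hadef
  set b : ℕ → ℝ := fun i => m.R .vb (i : ℕ) with hbdef
  set P0 := IVar.cnt.set (.litI 0) ;; RVar.top.set (.litR (-1)) ;; RVar.last.set (.litR (-1))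
    with hP0
  have first : P0.Within m 20 fun m' => m.KeptP d N g m' ∧
      OutputState Q d N g a b 0 0 0 0 m' := by
    refine (Program.LoopFree.within (P := P0) (by simp [hP0])
      (Q := fun m' => m.KeptP d N g m' ∧ OutputState Q d N g a b 0 0 0 0 m') ?_).mono
      (by decide) fun _ h => h
    simp only [hP0, Program.den_seq, Program.den_setI, Program.den_setR, Exp.eval_litI,
      Exp.eval_litR]
    constructor
    · constructor <;> simp
    · constructor
      · exact isFront_zero
      · simp [h1]
      · simp [h2]
      · simp
      · simp [lastOr]
      · simp [lastOr]
      · constructor <;> intro j hj <;> omega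
      · intro i hi
        simp [hadef]
      · intro i hi
        simp [hbdef]
  obtain ⟨t₁, m₁, r₁, ht₁, K₁, S₁⟩ := first
  have second : (Program.forLoop .pos IVar.num.e (candidateProg d)).Within m₁
      (N * ((candidateProg d).cost + 2 + 9) + 2 + 6) fun m' =>
      m₁.KeptP d N g m' ∧ ∃ r A B, OutputState Q d N g a b N r A B m' := by
    refine (Program.Within.forLoop (c := (candidateProg d).cost) (K := N)
      (fun i m' => m'.I .pos = (i : ℤ) ∧ m₁.KeptP d N g m' ∧
        ∃ r A B, OutputState Q d N g a b i r A B m')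
      (fun j m' h' => ?_) (fun j m' h' => h'.1) ?_ ?_).mono le_rfl (fun m' h' => h'.2)
    · obtain ⟨-, -, r, A, B, h⟩ := h'
      exact h.num
    · refine ⟨by simp, ?_, 0, 0, 0, ?_⟩
      · constructor <;> simp
      · obtain ⟨g1, g2, g3, g4, g5, g6, g7, g8, g9⟩ := S₁
        constructor <;> simpa
    · rintro i hi m' ⟨pos, K, r, A, B, S⟩
      refine (within_candidateProg hs hi S pos).mono le_rfl ?_
      rintro m'' ⟨pos', K', r', A', B', S'⟩
      refine ⟨pos', by simp, (K.trans K').trans ?_, r', A', B', ?_⟩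
      · constructor <;> simp
      · obtain ⟨g1, g2, g3, g4, g5, g6, g7, g8, g9⟩ := S'
        constructor <;> simpa
  obtain ⟨t₂, m₂, r₂, ht₂, K₂, r, A, B, S⟩ := second
  have third : (Program.setI .ds (intCellE (.litI 0)) IVar.cnt.e).Within m₂ 20 fun m' =>
      m' = m₂.writeI .ds (intBase N g) r := by
    refine (Program.LoopFree.within (P := .setI .ds (intCellE (.litI 0)) IVar.cnt.e) (by simp)
      (Q := fun m' => m' = m₂.writeI .ds (intBase N g) r) ?_).mono (by decide) fun _ h => h
    rw [Program.den_writeI, eval_intCellE S.idx S.num (i := 0) rfl]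
    simp [S.cnt]
  obtain ⟨t₃, m₃, r₃, ht₃, rfl⟩ := third
  refine ⟨_, _, .seq r₁ (.seq r₂ r₃), ?_, (K₁.trans K₂).trans ?_, r, S.front.le, A, B, ?_, ?_,
    S.front⟩
  · simp only [outputCost]
    nlinarith
  · constructor
    case int =>
      intro i hi
      have : i ≠ intBase N g := by omega
      simp [this]
    all_goals simp
  · simp [Store.part]
  · obtain ⟨g1, g2, g3⟩ := S.records
    constructor
    · intro j hj
      simpa [Store.part] using g1 j hj
    · intro j hj
      simpa [Store.part] using g2 j hj
    · intro j hj
      simpa [Store.part] using g3 j hj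

end

/-! ### The loop over the grid curves -/

/-- The remainder of a division. -/
def Exp.mod (x y : Exp .int) : Exp .int := .subI x (.mulI (.divI x y) y)

theorem Exp.eval_mod {m : Memory} {x y : Exp .int} {a b : ℕ} (hx : x.eval m = (a : ℤ))
    (hy : y.eval m = (b : ℤ)) : (x.mod y).eval m = ((a % b : ℕ) : ℤ) := by
  simp only [Exp.mod, Exp.eval_subI, Exp.eval_mulI, Exp.eval_divI, hx, hy]
  push_cast
  rw [Int.emod_def, mul_comm]

/-- The grid curve with number `g`: the digits of `g` in base `M` are the integer coordinates of
the vertices. -/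
noncomputable def gridCurve (k d : ℕ) (o : ℕ → ℝ) (s : ℝ) (M g : ℕ) :
    Fin k → EuclideanSpace ℝ (Fin d) :=
  fun j => WithLp.toLp 2 fun l => o l + s * ((g / M ^ (j * d + l : ℕ) % M : ℕ) : ℝ)

/-- The store holds at most `N` records, for the inclusion-minimal pairs with the property `Q`. -/
def Store.HasRecords (O : Store) (Q : ℝ → ℝ → Prop) (N : ℕ) : Prop :=
  ∃ r ≤ N, ∃ A B a b, O.int 0 = (r : ℤ) ∧ O.HoldsRecords r A B ∧ IsStream Q N a b ∧
    IsFront Q a b N r A B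

theorem Store.HasRecords.congr {O O' : Store} {Q : ℝ → ℝ → Prop} {N : ℕ} (h : O.HasRecords Q N)
    (h1 : ∀ i ≤ N, O'.int i = O.int i) (h2 : ∀ i < 2 * N, O'.real i = O.real i) :
    O'.HasRecords Q N := by
  obtain ⟨r, hr, A, B, a, b, e1, ⟨f1, f2, f3⟩, e3, e4⟩ := h
  refine ⟨r, hr, A, B, a, b, (h1 0 (Nat.zero_le _)).trans e1, ⟨fun j hj => ?_, fun j hj => ?_,
    fun j hj => ?_⟩, e3, e4⟩
  · exact (h1 _ (by omega)).trans (f1 j hj)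
  · exact (h2 _ (by omega)).trans (f2 j hj)
  · exact (h2 _ (by omega)).trans (f3 j hj)

/-- The data structure with the records of the first `g` grid curves. -/
structure Store.HoldsGrid {n d : ℕ} (p : Fin n → EuclideanSpace ℝ (Fin d)) (k : ℕ) (ρ : ℝ)
    (o : ℕ → ℝ) (s : ℝ) (M g : ℕ) (S : Store) : Prop where
  side : S.int 0 = (M : ℤ)
  num : S.int 1 = ((n * k : ℕ) : ℤ)
  step : S.real 0 = s
  offset : ∀ l < d, S.real (1 + l) = o l
  records : ∀ g' < g,
    (S.part d (n * k) g').HasRecords (Feasible p (gridCurve k d o s M g') ρ) (n * k)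
  int_zero : ∀ i, intBase (n * k) g ≤ i → S.int i = 0
  real_zero : ∀ i, realBase d (n * k) g ≤ i → S.real i = 0

/-- The state of the construction before the grid curve with number `g`. -/
structure BuildState {n d : ℕ} (p : Fin n → EuclideanSpace ℝ (Fin d)) (k : ℕ) (δ ε ρ : ℝ)
    (o : ℕ → ℝ) (s : ℝ) (M G g : ℕ) (m : Memory) : Prop where
  inp : m .inp = constructionStart p k δ ε .inp
  idx : m.I .idx = (g : ℤ)
  num : m.I .num = ((n * k : ℕ) : ℤ)
  side : m.I .side = (M : ℤ)
  base : m.I .base = (G : ℤ)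
  rho : m.R .rho 0 = ρ
  step : m.R .step 0 = s
  grid : (m .ds).HoldsGrid p k ρ o s M g

/-- Compute the vertices of the grid curve with number `idx`. -/
def decodeProg (d : ℕ) : Program :=
  IVar.quo.set IVar.idx.e ;;
  .forLoop .pos (.mulI lenE (.litI d))
    (RVar.q.put IVar.pos.e
      (.addR (.getR .ds (.addI (.litI 1) (.mod IVar.pos.e (.litI d))))
        (.mulR RVar.step.e (.ofInt (.mod IVar.quo.e IVar.side.e)))) ;;
    IVar.quo.set (.divI IVar.quo.e IVar.side.e))

/-- Compute and store the records of the grid curve with number `idx`. -/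
def gridProg (d : ℕ) : Program := decodeProg d ;; candidatesProg d ;; outputProg d

section

variable {n k d : ℕ} {p : Fin n → EuclideanSpace ℝ (Fin d)} {δ ε ρ s : ℝ} {o : ℕ → ℝ}
  {M G g : ℕ} {m : Memory}

theorem vertex_gridCurve {j l : ℕ} (hj : j < k) (hl : l < d) :
    vertex (gridCurve k d o s M g) j ⟨l, hl⟩ =
      o l + s * ((g / M ^ (j * d + l) % M : ℕ) : ℝ) := by
  simp [vertex, hj, gridCurve]

/-- Successive divisions by `M` expose the digits of `g`. Entry `a` of the coordinate list belongs
to axis `a % d`, which selects the offset. -/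
theorem within_decodeProg (h : BuildState p k δ ε ρ o s M G g m) (hd : 1 ≤ d) (hρ : 0 ≤ ρ) :
    (decodeProg d).Within m (k * d * 100 + 20) fun m' =>
      m.KeptP d (n * k) g m' ∧ Holds p δ ε (gridCurve k d o s M g) ρ m' := by
  have first : (IVar.quo.set IVar.idx.e).Within m 4 fun m' => m' = m.putI .quo g := by
    refine (Program.LoopFree.within (P := IVar.quo.set IVar.idx.e) (by simp)
      (Q := fun m' => m' = m.putI .quo g) ?_).mono (by decide) fun _ h => h
    simp [h.idx]
  obtain ⟨t₁, m₁, r₁, ht₁, rfl⟩ := first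
  refine (Program.Within.seq (T := 4) (T' := k * d * (60 + 4 + 9) + 4 + 6)
    ⟨t₁, _, r₁, ht₁, ?_⟩).mono (by omega) fun _ h => h
  refine (Program.Within.forLoop (c := 60) (K := k * d)
    (fun a m' => m'.I .pos = (a : ℤ) ∧ m'.I .quo = ((g / M ^ a : ℕ) : ℤ) ∧
      m.KeptP d (n * k) g m' ∧
      ∀ a' < a, m'.R .q (a' : ℕ) = o (a' % d) + s * ((g / M ^ a' % M : ℕ) : ℝ))
    (fun a m' h' => ?_) (fun a m' h' => h'.1) ?_ ?_).mono le_rfl ?_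
  · simp only [Exp.eval_mulI, Holds.eval_lenE (h'.2.2.1.inp.trans h.inp), Exp.eval_litI]
    push_cast
    rfl
  · refine ⟨by simp, by simp, ?_, by simp⟩
    constructor <;> simp
  · rintro a ha m' ⟨pos, quo, K, V⟩
    refine (Program.LoopFree.within (by simp)
      (Q := fun m' => m'.I .pos = (a : ℤ) ∧ _) ?_).mono ?_ fun _ h => h
    · have e1 : Exp.eval m' (.addI (.litI 1) (.mod IVar.pos.e (.litI d))) =
          ((1 + a % d : ℕ) : ℤ) := by
        simp only [Exp.eval_addI, Exp.eval_mod (m := m') (x := IVar.pos.e) (y := .litI d)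
          (a := a) (b := d) pos rfl, Exp.eval_litI]
        push_cast
        rfl
      have e2 : Exp.eval m' (.mod IVar.quo.e IVar.side.e) = ((g / M ^ a % M : ℕ) : ℤ) :=
        Exp.eval_mod quo (K.side.trans h.side)
      have e3 : (m' .ds).real (1 + a % d) = o (a % d) := by
        have hlt : a % d < d := Nat.mod_lt _ hd
        rw [K.real _ (.inl (by unfold realBase; omega))]
        exact h.grid.offset _ hlt
      simp only [Program.den_seq, Program.den_put, Program.den_setI, Exp.eval_addR, Exp.eval_getR,
        Exp.eval_mulR, Exp.eval_ofInt, e1, e2, Exp.eval_divI, Exp.eval_ivar, Exp.eval_rvar, pos,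
        Int.toNat_natCast, e3, K.step.trans h.step]
      refine ⟨by simp [pos], by simp, ?_, K.trans ?_, ?_⟩
      · simp only [Memory.I_putI, Memory.I_putR, quo, K.side.trans h.side, if_true, reduceCtorEq,
          if_false, pow_succ, ← Nat.div_div_eq_div_mul]
        push_cast
        rfl
      · constructor <;> simp
      · intro a' ha'
        rcases Nat.lt_succ_iff_lt_or_eq.1 ha' with ha' | rfl
        · have : (a' : ℤ) ≠ a := by exact_mod_cast ha'.ne
          simp only [Memory.R_putI, Memory.R_putR_natCast, this, and_false, if_false]
          exact V a' ha'
        · simp only [Memory.R_putI, Memory.R_putR_natCast, and_self, if_true, Int.cast_natCast]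
    · simp only [Program.cost, RVar.put, IVar.set, IVar.e, RVar.e, RVar.get, Exp.mod, Exp.cost]
      omega
  · rintro m' ⟨-, -, K, V⟩
    refine ⟨K, K.inp.trans h.inp, fun j hj l hl => ?_, K.rho.trans h.rho, hρ⟩
    have hlt : j * d + l < k * d := by
      calc j * d + l < j * d + d := by omega
        _ = (j + 1) * d := by ring
        _ ≤ k * d := Nat.mul_le_mul_right _ hj
    rw [V _ hlt, vertex_gridCurve hj hl, Nat.mul_add_mod', Nat.mod_eq_of_lt hl]

/-- A bound for the time for a grid curve, divided by `n * k * k`. -/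
def gridCost (d : ℕ) : ℕ := candidatesCost d + outputCost d + 100 * d + 20

theorem intBase_succ (N g : ℕ) : intBase N (g + 1) = intBase N g + N + 1 := by
  unfold intBase
  ring

theorem realBase_succ (d N g : ℕ) : realBase d N (g + 1) = realBase d N g + 2 * N := by
  unfold realBase
  ring

theorem intBase_mono (N : ℕ) : Monotone (intBase N) :=
  monotone_nat_of_le_succ fun g => by rw [intBase_succ]; omega

theorem realBase_mono (d N : ℕ) : Monotone (realBase d N) :=
  monotone_nat_of_le_succ fun g => by rw [realBase_succ]; omega

theorem within_gridProg (h : BuildState p k δ ε ρ o s M G g m) (hd : 1 ≤ d) (hn : 1 ≤ n)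
    (hk : 1 ≤ k) (hρ : 0 ≤ ρ) :
    (gridProg d).Within m (n * (k * (k * gridCost d))) fun m' =>
      m'.I .idx = (g : ℤ) ∧
        BuildState p k δ ε ρ o s M G (g + 1) (m'.putI .idx ((g + 1 : ℕ) : ℤ)) := by
  obtain ⟨t₁, m₁, r₁, ht₁, K₁, H₁⟩ := within_decodeProg h hd hρ
  obtain ⟨t₂, m₂, r₂, ht₂, K₂, S₂⟩ := within_candidatesProg H₁ hn hk
  obtain ⟨t₃, m₃, r₃, ht₃, K₃, r, hr, A, B, e1, e2, e3⟩ :=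
    within_outputProg (d := d) (g := g) (Nat.mul_pos hn hk) (K₂.idx.trans (K₁.idx.trans h.idx))
      (K₂.num.trans (K₁.num.trans h.num)) (isStream_candidates hk S₂)
  have K := (K₁.trans (K₂.keptP d (n * k) g)).trans K₃
  refine ⟨_, m₃, .seq r₁ (.seq r₂ r₃), ?_, K.idx.trans h.idx, ?_⟩
  · have c1 : 1 ≤ n * (k * k) := Nat.mul_pos hn (Nat.mul_pos hk hk)
    have c2 : k ≤ n * (k * k) :=
      (Nat.le_mul_of_pos_left _ hk).trans (Nat.le_mul_of_pos_left _ hn)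
    have c3 : n * k ≤ n * (k * k) := Nat.mul_le_mul_left _ (Nat.le_mul_of_pos_left _ hk)
    have c4 := Nat.mul_le_mul_right (d * 100) c2
    have c5 := Nat.mul_le_mul_right (outputCost d) c3
    calc t₁ + (t₂ + t₃) ≤ (k * (d * 100) + 20) + (n * (k * (k * candidatesCost d)) +
          n * k * outputCost d) := by nlinarith
      _ ≤ (n * (k * k) * (d * 100) + 20 * (n * (k * k))) + (n * (k * (k * candidatesCost d)) +
          n * (k * k) * outputCost d) := by omega
      _ = _ := by unfold gridCost; ring
  · constructor
    · simpa using K.inp.trans h.inp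
    · simp
    · simpa using K.num.trans h.num
    · simpa using K.side.trans h.side
    · simpa using K.base.trans h.base
    · simpa using K.rho.trans h.rho
    · simpa using K.step.trans h.step
    · rw [Memory.putI_ds]
      have b1 : 2 ≤ intBase (n * k) g := Nat.le_add_right _ _
      have b2 : 1 + d ≤ realBase d (n * k) g := Nat.le_add_right _ _
      constructor
      · rw [K.int _ (.inl (by omega)), h.grid.side]
      · rw [K.int _ (.inl (by omega)), h.grid.num]
      · rw [K.real _ (.inl (by omega)), h.grid.step]
      · intro l hl
        rw [K.real _ (.inl (by omega)), h.grid.offset l hl]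
      · intro g' hg'
        rcases Nat.lt_succ_iff_lt_or_eq.1 hg' with hg' | rfl
        · refine (h.grid.records g' hg').congr (fun i hi => ?_) (fun i hi => ?_)
          -- The block of an earlier curve ends before the current block begins, so it has not been
          -- overwritten.
          · have := intBase_mono (n * k) (Nat.succ_le_of_lt hg')
            rw [Nat.succ_eq_add_one, intBase_succ] at this
            exact K.int _ (.inl (by omega))
          · have := realBase_mono d (n * k) (Nat.succ_le_of_lt hg')
            rw [Nat.succ_eq_add_one, realBase_succ] at this
            exact K.real _ (.inl (by omega))
        · exact ⟨r, hr, A, B, _, _, e1, e2, isStream_candidates hk S₂, e3⟩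
      · intro i hi
        rw [intBase_succ] at hi
        rw [K.int _ (.inr (by omega)), h.grid.int_zero i (by omega)]
      · intro i hi
        rw [realBase_succ] at hi
        rw [K.real _ (.inr (by omega)), h.grid.real_zero i (by omega)]

theorem within_gridLoop (h : BuildState p k δ ε ρ o s M G 0 (m.putI .idx 0)) (hd : 1 ≤ d) (hn : 1 ≤ n)
    (hk : 1 ≤ k) (hρ : 0 ≤ ρ) :
    (Program.forLoop .idx IVar.base.e (gridProg d)).Within m
      (G * (n * (k * (k * gridCost d)) + 2 + 9) + 2 + 6) fun m' =>
        (m' .ds).HoldsGrid p k ρ o s M G := by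
  refine (Program.Within.forLoop (N := IVar.base.e) (c := n * (k * (k * gridCost d))) (K := G)
    (fun g m' => BuildState p k δ ε ρ o s M G g m')
    (fun g m' h' => h'.base) (fun g m' h' => h'.idx) h ?_).mono le_rfl (fun m' h' => h'.grid)
  intro g hg m' h'
  exact within_gridProg h' hd hn hk hρ

end

/-! ### The construction program -/

/-- Compute the maximal difference between coordinates of vertices and the corresponding
coordinates of the first vertex. -/
def spreadProg (d : ℕ) : Program :=
  .forLoop .pos (.mulI numE (.litI d))
    (RVar.tmp.set (.subR (.getR .inp (.addI IVar.pos.e (.litI 2)))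
      (.getR .inp (.addI (.mod IVar.pos.e (.litI d)) (.litI 2)))) ;;
    RVar.rad.set (.max RVar.rad.e (.sqrt (.mulR RVar.tmp.e RVar.tmp.e))))

/-- Compute the parameters of the grid. -/
def paramProg (d : ℕ) : Program :=
  RVar.rad.set (.addR RVar.rad.e (.mulR (.litR 2) (.getR .inp (.litI 0)))) ;;
  RVar.step.set (.divR (.mulR (.getR .inp (.litI 1)) (.getR .inp (.litI 0))) (.litR (2 * d : ℕ))) ;;
  RVar.rho.set (.mulR (.addR (.litR 1) (.divR (.getR .inp (.litI 1)) (.litR 2)))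
    (.getR .inp (.litI 0))) ;;
  IVar.side.set (.addI (.floor (.divR (.mulR (.litR 2) RVar.rad.e) RVar.step.e)) (.litI 1)) ;;
  IVar.num.set (.mulI numE lenE) ;;
  IVar.base.set (.litI 1) ;;
  .setI .ds (.litI 0) IVar.side.e ;;
  .setI .ds (.litI 1) IVar.num.e ;;
  .setR .ds (.litI 0) RVar.step.e

/-- Store the smallest coordinates of grid points. -/
def offsetProg (d : ℕ) : Program :=
  .forLoop .pos (.litI d)
    (.setR .ds (.addI IVar.pos.e (.litI 1))
      (.subR (.getR .inp (.addI IVar.pos.e (.litI 2))) RVar.rad.e))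

/-- Compute the number of grid curves. -/
def powerProg (d : ℕ) : Program :=
  .forLoop .pos (.mulI lenE (.litI d)) (IVar.base.set (.mulI IVar.base.e IVar.side.e))

/-- The construction of the data structure. -/
def buildProg (d : ℕ) : Program :=
  spreadProg d ;; paramProg d ;; offsetProg d ;; powerProg d ;;
    .forLoop .idx IVar.base.e (gridProg d)

/-- `L` bounds the differences between coordinates of vertices of `p` and the corresponding
coordinates of the first vertex, and is attained or `0`. -/
structure IsSpread {n d : ℕ} (p : Fin n → EuclideanSpace ℝ (Fin d)) (N : ℕ) (L : ℝ) : Prop where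
  nonneg : 0 ≤ L
  le : ∀ a < N, |coords p a - coords p (a % d)| ≤ L
  eq : L = 0 ∨ ∃ a < N, L = |coords p a - coords p (a % d)|

/-- The number of grid points on an axis. -/
noncomputable def gridSide (d : ℕ) (L δ ε : ℝ) : ℕ :=
  (⌊2 * (L + 2 * δ) / (ε * δ / (2 * d))⌋ + 1).toNat

section

variable {n k d : ℕ} {p : Fin n → EuclideanSpace ℝ (Fin d)} {δ ε : ℝ} {m : Memory}

theorem constructionStart_real (a : ℕ) :
    (constructionStart p k δ ε .inp).real (a + 2) = coords p a := by
  simp [constructionStart]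

theorem gridSide_cast (hδ : 0 < δ) (hε : 0 < ε) {L : ℝ} (hL : 0 ≤ L) :
    ((gridSide d L δ ε : ℕ) : ℤ) = ⌊2 * (L + 2 * δ) / (ε * δ / (2 * d))⌋ + 1 := by
  have : 0 ≤ ⌊2 * (L + 2 * δ) / (ε * δ / (2 * d))⌋ := Int.floor_nonneg.2 (by positivity)
  exact Int.toNat_of_nonneg (by omega)

/-- The deviations are measured from the first vertex, axis by axis. This takes time linear in `n *
d`, and unlike the diameter it needs no comparison of all pairs of vertices. -/
theorem within_spreadProg :
    (spreadProg d).Within (constructionStart p k δ ε) (n * d * 200 + 10) fun m' =>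
      m' .inp = constructionStart p k δ ε .inp ∧ m' .ds = Store.empty ∧
        IsSpread p (n * d) (m'.R .rad 0) := by
  refine (Program.Within.forLoop (c := 100) (K := n * d)
    (fun a m' => m'.I .pos = (a : ℤ) ∧ m' .inp = constructionStart p k δ ε .inp ∧
      m' .ds = Store.empty ∧ IsSpread p a (m'.R .rad 0))
    (fun a m' h' => ?_) (fun a m' h' => h'.1) ?_ ?_).mono ?_ fun m' h => h.2
  · simp only [Exp.eval_mulI, Holds.eval_numE h'.2.1, Exp.eval_litI]
    push_cast
    rfl
  · refine ⟨by simp, by simp, by simp [constructionStart], ?_⟩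
    have : ((constructionStart p k δ ε).putI .pos 0).R .rad 0 = 0 := by
      rw [Memory.R_putI]
      rfl
    rw [this]
    exact ⟨le_rfl, by simp, .inl rfl⟩
  · rintro a ha m' ⟨pos, inp, ds, h⟩
    refine (Program.LoopFree.within (by simp) (Q := fun m' => m'.I .pos = (a : ℤ) ∧ _) ?_).mono ?_
      fun _ h => h
    · have e1 : Exp.eval m' (.getR .inp (.addI IVar.pos.e (.litI 2))) = coords p a := by
        rw [Exp.eval_getR, inp, ← constructionStart_real (k := k) (δ := δ) (ε := ε)]
        congr 1
        have : Exp.eval m' (.addI IVar.pos.e (.litI 2)) = ((a + 2 : ℕ) : ℤ) := by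
          simp [pos]
        rw [this, Int.toNat_natCast]
      have e2 : Exp.eval m' (.getR .inp (.addI (.mod IVar.pos.e (.litI d)) (.litI 2))) =
          coords p (a % d) := by
        rw [Exp.eval_getR, inp, ← constructionStart_real (k := k) (δ := δ) (ε := ε)]
        congr 1
        have : Exp.eval m' (.addI (.mod IVar.pos.e (.litI d)) (.litI 2)) =
            ((a % d + 2 : ℕ) : ℤ) := by
          rw [Exp.eval_addI, Exp.eval_mod (x := IVar.pos.e) (y := .litI d) (a := a) (b := d) pos rfl]
          simp
        rw [this, Int.toNat_natCast]
      simp only [Program.den_seq, Program.den_setR, Exp.eval_subR, e1, e2, Exp.eval_max,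
        Exp.eval_sqrt, Exp.eval_mulR, Exp.eval_rvar, Memory.R_putR_zero, and_self, if_true,
        reduceCtorEq, false_and, if_false, Real.sqrt_mul_self_eq_abs]
      refine ⟨by simp [pos], by simp, by simp [inp], by simp [ds], ?_⟩
      have : ∀ x : ℝ, (((m'.putR .tmp 0 (coords p a - coords p (a % d))).putR .rad 0 x).putI .pos
          ((a + 1 : ℕ) : ℤ)).R .rad 0 = x := by
        intro x
        simp
      rw [this]
      refine ⟨le_max_of_le_left h.nonneg, fun b hb => ?_, ?_⟩
      · rcases Nat.lt_succ_iff_lt_or_eq.1 hb with hb | rfl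
        · exact le_max_of_le_left (h.le b hb)
        · exact le_max_right _ _
      · rcases max_choice (m'.R .rad 0) |coords p a - coords p (a % d)| with h1 | h1
        · rw [h1]
          exact h.eq.imp id fun ⟨b, hb, h2⟩ => ⟨b, by omega, h2⟩
        · exact .inr ⟨a, by omega, h1⟩
    · simp only [Program.cost, RVar.set, RVar.put, IVar.e, RVar.e, RVar.get, Exp.mod, Exp.max,
        Exp.cost]
      omega
  · simp only [numE, Exp.cost]
    omega

theorem within_paramProg {L : ℝ} (hL : 0 ≤ L) (hδ : 0 < δ) (hε : 0 < ε)
    (inp : m .inp = constructionStart p k δ ε .inp) (ds : m .ds = Store.empty)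
    (rad : m.R .rad 0 = L) :
    (paramProg d).Within m 200 fun m' =>
      m' .inp = m .inp ∧ m'.R .rad 0 = L + 2 * δ ∧ m'.R .step 0 = ε * δ / (2 * d) ∧
      m'.R .rho 0 = (1 + ε / 2) * δ ∧ m'.I .side = (gridSide d L δ ε : ℤ) ∧
      m'.I .num = ((n * k : ℕ) : ℤ) ∧ m'.I .base = 1 ∧
      m' .ds = ⟨fun i => if i = 0 then (gridSide d L δ ε : ℤ) else
        if i = 1 then ((n * k : ℕ) : ℤ) else 0, fun i => if i = 0 then ε * δ / (2 * d) else 0⟩ := by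
  refine (Program.LoopFree.within (P := paramProg d) (by simp [paramProg])
    (Q := fun m' => m' .inp = m .inp ∧ _) ?_).mono ?_ fun _ h => h
  · have i0 : (m .inp).real 0 = δ := by simp [inp, constructionStart]
    have i1 : (m .inp).real 1 = ε := by simp [inp, constructionStart]
    have n0 : (m .inp).int 0 = (n : ℤ) := by simp [inp, constructionStart]
    have n1 : (m .inp).int 1 = (k : ℤ) := by simp [inp, constructionStart]
    have side := gridSide_cast (d := d) hδ hε hL
    rw [show (((n * k : ℕ) : ℤ)) = (n : ℤ) * k by push_cast; rfl]
    simp only [paramProg, numE, lenE, Program.den_seq, Program.den_setR, Program.den_setI,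
      Program.den_writeI, Program.den_writeR, Exp.eval_addR, Exp.eval_rvar, Exp.eval_mulR,
      Exp.eval_litR, Exp.eval_getR, Exp.eval_litI, Exp.eval_divR, Exp.eval_addI, Exp.eval_floor,
      Exp.eval_mulI, Exp.eval_getI, Exp.eval_ivar, Int.toNat_zero, Int.toNat_one, Memory.putI_inp,
      Memory.putR_inp, Memory.R_putR_zero, Memory.I_putI, Memory.I_putR, i0, i1,
      n0, n1, rad, and_self, and_true, if_true, reduceCtorEq, if_false]
    simp only [side, Rat.cast_mul, Rat.cast_natCast, Nat.cast_mul, Nat.cast_ofNat, Rat.cast_ofNat, Rat.cast_one,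
      Memory.I_writeI_ds, Memory.I_writeR_ds, Memory.R_writeI_ds, Memory.R_writeR_ds,
      Memory.I_putI, Memory.I_putR, Memory.R_putI, Memory.R_putR_zero, Memory.writeR_ds_inp,
      Memory.writeI_ds_inp, Memory.putI_inp, Memory.putR_inp, and_self, and_true, if_true,
      reduceCtorEq, if_false, true_and]
    have ext : ∀ S T : Store, S.int = T.int → S.real = T.real → S = T := by
      rintro ⟨⟩ ⟨⟩ rfl rfl
      rfl
    refine ext _ _ ?_ ?_
    · simp only [Memory.writeR_same_int, Memory.writeI_same_int, Memory.putI_ds, Memory.putR_ds, ds,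
        Store.empty]
      funext i
      simp only [Function.update_apply]
      split_ifs with h1 h2 <;> first | rfl | omega
    · simp only [Memory.writeR_same_real, Memory.writeI_same_real, Memory.putI_ds, Memory.putR_ds,
        ds, Store.empty]
      funext i
      simp only [Function.update_apply]
  · simp only [paramProg, Program.cost, RVar.set, RVar.put, IVar.set, IVar.e, RVar.e, RVar.get,
      Exp.cost, numE, lenE]
    omega

theorem within_offsetProg {L : ℝ} (inp : m .inp = constructionStart p k δ ε .inp)
    (rad : m.R .rad 0 = L) :
    (offsetProg d).Within m (d * 40 + 10) fun m' =>
      m' .inp = m .inp ∧ m'.R .step 0 = m.R .step 0 ∧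
      m'.R .rho 0 = m.R .rho 0 ∧ m'.I .side = m.I .side ∧
      m'.I .num = m.I .num ∧ m'.I .base = m.I .base ∧
      (m' .ds).int = (m .ds).int ∧ ∀ i, (m' .ds).real i =
        if 1 ≤ i ∧ i < 1 + d then coords p (i - 1) - L else (m .ds).real i := by
  refine (Program.Within.forLoop (c := 20) (K := d)
    (fun a m' => m'.I .pos = (a : ℤ) ∧ m'.R .rad 0 = L ∧
      m' .inp = m .inp ∧ m'.R .step 0 = m.R .step 0 ∧
      m'.R .rho 0 = m.R .rho 0 ∧ m'.I .side = m.I .side ∧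
      m'.I .num = m.I .num ∧ m'.I .base = m.I .base ∧
      (m' .ds).int = (m .ds).int ∧ ∀ i, (m' .ds).real i =
        if 1 ≤ i ∧ i < 1 + a then coords p (i - 1) - L else (m .ds).real i)
    (fun a m' h' => rfl) (fun a m' h' => h'.1) ?_ ?_).mono ?_ fun m' h => h.2.2
  · refine ⟨by simp, by simp [rad], by simp, by simp, by simp, by simp, by simp, by simp, by simp,
      fun i => ?_⟩
    rw [if_neg (by omega), Memory.putI_ds]
  · rintro a ha m' ⟨pos, h1, h2, h3, h4, h5, h6, h7, h8, h9⟩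
    refine (Program.LoopFree.within (by simp) (Q := fun m' => m'.I .pos = (a : ℤ) ∧ _) ?_).mono ?_
      fun _ h => h
    · have e1 : Exp.eval m' (.addI IVar.pos.e (.litI 1)) = ((a + 1 : ℕ) : ℤ) := by simp [pos]
      have e2 : Exp.eval m' (.addI IVar.pos.e (.litI 2)) = ((a + 2 : ℕ) : ℤ) := by simp [pos]
      simp only [Program.den_writeR, e1, Exp.eval_subR, Exp.eval_getR, e2, Int.toNat_natCast, h2,
        inp, constructionStart_real, Exp.eval_rvar, h1]
      refine ⟨by simp [pos], by simp, by simp [h1], by simp [h2, inp], by simp [h3], by simp [h4],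
        by simp [h5], by simp [h6], by simp [h7], by simp [h8], fun i => ?_⟩
      simp only [Memory.putI_ds, Memory.writeR_same_real, Function.update_apply]
      by_cases hi : i = a + 1
      · subst hi
        rw [if_pos rfl, if_pos (by omega)]
        rfl
      · rw [if_neg hi, h9]
        congr 1
        simp only [eq_iff_iff]
        omega
    · simp only [Program.cost, IVar.e, RVar.e, RVar.get, Exp.cost]
      omega
  · simp only [Exp.cost]
    omega

theorem within_powerProg {M : ℕ} (inp : m .inp = constructionStart p k δ ε .inp)
    (side : m.I .side = (M : ℤ)) (base : m.I .base = 1) :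
    (powerProg d).Within m (k * d * 40 + 10) fun m' =>
      m' .inp = m .inp ∧ m' .ds = m .ds ∧ m'.R .step 0 = m.R .step 0 ∧
      m'.R .rho 0 = m.R .rho 0 ∧ m'.I .side = m.I .side ∧
      m'.I .num = m.I .num ∧ m'.I .base = ((M ^ (k * d) : ℕ) : ℤ) := by
  refine (Program.Within.forLoop (c := 10) (K := k * d)
    (fun a m' => m'.I .pos = (a : ℤ) ∧
      m' .inp = m .inp ∧ m' .ds = m .ds ∧ m'.R .step 0 = m.R .step 0 ∧
      m'.R .rho 0 = m.R .rho 0 ∧ m'.I .side = m.I .side ∧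
      m'.I .num = m.I .num ∧ m'.I .base = ((M ^ a : ℕ) : ℤ))
    (fun a m' h' => ?_) (fun a m' h' => h'.1) ?_ ?_).mono ?_ fun m' h => h.2
  · simp only [Exp.eval_mulI, Holds.eval_lenE (h'.2.1.trans inp), Exp.eval_litI]
    push_cast
    rfl
  · simp [base]
  · rintro a ha m' ⟨pos, h2, h3, h4, h5, h6, h7, h8⟩
    refine (Program.LoopFree.within (by simp) (Q := fun m' => m'.I .pos = (a : ℤ) ∧ _) ?_).mono ?_
      fun _ h => h
    · simp [pos, h2, h3, h4, h5, h6, h7, h8, side, pow_succ]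
    · simp only [Program.cost, IVar.set, IVar.e, Exp.cost]
      omega
  · simp only [lenE, Exp.cost]
    omega

/-- A bound for the time of the construction, divided by `n * k * k` and the number of grid
curves. -/
def buildCost (d : ℕ) : ℕ := gridCost d + 300 * d + 300

theorem build_time {n k d G c t₁ t₂ t₃ t₄ t₅ : ℕ} (hn : 1 ≤ n) (hk : 1 ≤ k) (hG : 1 ≤ G)
    (h1 : t₁ ≤ n * d * 200 + 10) (h2 : t₂ ≤ 200) (h3 : t₃ ≤ d * 40 + 10)
    (h4 : t₄ ≤ k * d * 40 + 10) (h5 : t₅ ≤ G * (n * (k * (k * c)) + 2 + 9) + 2 + 6) :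
    t₁ + (t₂ + (t₃ + (t₄ + t₅))) ≤ n * k * k * G * (c + 300 * d + 300) := by
  have a1 : 1 ≤ k * k * G := Nat.mul_pos (Nat.mul_pos hk hk) hG
  have a2 : 1 ≤ n * k * k * G := Nat.mul_pos (Nat.mul_pos (Nat.mul_pos hn hk) hk) hG
  have a3 : n ≤ n * k * k * G := by
    calc n = n * 1 := (mul_one n).symm
      _ ≤ n * (k * k * G) := Nat.mul_le_mul_left _ a1
      _ = _ := by ring
  have a4 : k ≤ n * k * k * G := by
    calc k = 1 * k := (one_mul k).symm
      _ ≤ (n * k * G) * k := Nat.mul_le_mul_right _ (Nat.mul_pos (Nat.mul_pos hn hk) hG)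
      _ = _ := by ring
  have a5 : G ≤ n * k * k * G := Nat.le_mul_of_pos_left _ (Nat.mul_pos (Nat.mul_pos hn hk) hk)
  have b1 := Nat.mul_le_mul_right d a3
  have b2 := Nat.mul_le_mul_right d a4
  have b3 := Nat.mul_le_mul_right d a2
  have b4 : G * (n * (k * (k * c)) + 2 + 9) = n * k * k * G * c + 11 * G := by ring
  generalize n * k * k * G = X at *
  have b5 : X * (c + 300 * d + 300) = X * c + 300 * (X * d) + 300 * X := by ring
  rw [b4] at h5
  rw [b5]
  omega

theorem within_buildProg (hd : 1 ≤ d) (hn : 1 ≤ n) (hk : 1 ≤ k) (hδ : 0 < δ) (hε : 0 < ε) :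
    ∃ L, IsSpread p (n * d) L ∧
      (buildProg d).Within (constructionStart p k δ ε)
        (n * k * k * gridSide d L δ ε ^ (k * d) * buildCost d) fun m' =>
        (m' .ds).HoldsGrid p k ((1 + ε / 2) * δ) (fun l => coords p l - (L + 2 * δ))
          (ε * δ / (2 * d)) (gridSide d L δ ε) (gridSide d L δ ε ^ (k * d)) := by
  obtain ⟨t₁, m₁, r₁, ht₁, inp₁, ds₁, h₁⟩ := within_spreadProg (p := p) (k := k) (δ := δ) (ε := ε)
  refine ⟨m₁.R .rad 0, h₁, ?_⟩
  generalize hL : m₁.R .rad 0 = L at h₁ ⊢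
  have hM : 1 ≤ gridSide d L δ ε := by
    have h1 := gridSide_cast (d := d) hδ hε h₁.nonneg
    have h2 : 0 ≤ ⌊2 * (L + 2 * δ) / (ε * δ / (2 * d))⌋ :=
      Int.floor_nonneg.2 (by have := h₁.nonneg; positivity)
    omega
  obtain ⟨t₂, m₂, r₂, ht₂, inp₂, rad₂, step₂, rho₂, side₂, num₂, base₂, ds₂⟩ :=
    within_paramProg (d := d) h₁.nonneg hδ hε inp₁ ds₁ hL
  obtain ⟨t₃, m₃, r₃, ht₃, inp₃, step₃, rho₃, side₃, num₃, base₃, int₃, real₃⟩ :=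
    within_offsetProg (inp₂.trans inp₁) rad₂
  obtain ⟨t₄, m₄, r₄, ht₄, inp₄, ds₄, step₄, rho₄, side₄, num₄, base₄⟩ :=
    within_powerProg (d := d) (inp₃.trans (inp₂.trans inp₁)) (side₃.trans side₂)
      (base₃.trans base₂)
  generalize gridSide d L δ ε = M at *
  have start : BuildState p k δ ε ((1 + ε / 2) * δ) (fun l => coords p l - (L + 2 * δ))
      (ε * δ / (2 * d)) M (M ^ (k * d)) 0 (m₄.putI .idx 0) := by
    constructor
    · simp [inp₄, inp₃, inp₂, inp₁]
    · simp
    · simp [num₄, num₃, num₂]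
    · simp [side₄, side₃, side₂]
    · simp [base₄]
    · simp [rho₄, rho₃, rho₂]
    · simp [step₄, step₃, step₂]
    · rw [Memory.putI_ds, ds₄]
      constructor
      · simp [int₃, ds₂]
      · simp [int₃, ds₂]
      · simp [real₃, ds₂]
      · intro l hl
        rw [real₃, if_pos (by omega), Nat.add_sub_cancel_left]
      · intro g hg
        omega
      · intro i hi
        simp only [intBase, zero_mul, add_zero] at hi
        simp only [int₃, ds₂]
        rw [if_neg (by omega), if_neg (by omega)]
      · intro i hi
        simp only [realBase, zero_mul, add_zero] at hi
        rw [real₃, if_neg (by omega), ds₂]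
        simp only
        rw [if_neg (by omega)]
  obtain ⟨t₅, m₅, r₅, ht₅, h₅⟩ := within_gridLoop start hd hn hk (by positivity)
  exact ⟨_, m₅, .seq r₁ (.seq r₂ (.seq r₃ (.seq r₄ r₅))),
    build_time hn hk (Nat.one_le_pow _ _ hM) ht₁ ht₂ ht₃ ht₄ ht₅, h₅⟩

end

/-! ### The query program -/

/-- Compute the digits of the number of the grid curve next to the query curve. -/
def locateProg (d : ℕ) : Program :=
  (IVar.base.set (.litI 1) ;; IVar.cnt.set (.litI 1) ;; IVar.idx.set (.litI 0) ;;
    IVar.side.set (.getI .ds (.litI 0)) ;; IVar.num.set (.getI .ds (.litI 1))) ;;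
  .forLoop .pos (.mulI (.getI .inp (.litI 0)) (.litI d))
    (IVar.quo.set (.floor (.divR (.subR (.getR .inp IVar.pos.e)
        (.getR .ds (.addI (.litI 1) (.mod IVar.pos.e (.litI d))))) (.getR .ds (.litI 0)))) ;;
      .branch (.leI (.litI 0) IVar.quo.e)
        (.branch (.ltI IVar.quo.e IVar.side.e) .skip (IVar.cnt.set (.litI 0)))
        (IVar.cnt.set (.litI 0)) ;;
      IVar.idx.set (.addI IVar.idx.e (.mulI IVar.quo.e IVar.base.e)) ;;
      IVar.base.set (.mulI IVar.base.e IVar.side.e))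

/-- Copy a record of the current grid curve to the output. -/
def copyRecordProg (d : ℕ) : Program :=
  .setI .out (.addI IVar.pos.e (.litI 1)) (.getI .ds (intCellE (.addI IVar.pos.e (.litI 1)))) ;;
  .setR .out (.mulI (.litI 2) IVar.pos.e)
    (.getR .ds (realCellE d (.mulI (.litI 2) IVar.pos.e))) ;;
  .setR .out (.addI (.mulI (.litI 2) IVar.pos.e) (.litI 1))
    (.getR .ds (realCellE d (.addI (.mulI (.litI 2) IVar.pos.e) (.litI 1))))

/-- Copy the records of the current grid curve to the output. -/
def copyProg (d : ℕ) : Program :=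
  (IVar.lft.set (.getI .ds (intCellE (.litI 0))) ;; .setI .out (.litI 0) IVar.lft.e) ;;
  .forLoop .pos IVar.lft.e (copyRecordProg d)

/-- The query. -/
def queryProg (d : ℕ) : Program :=
  locateProg d ;; .branch (.leI (.litI 1) IVar.cnt.e) (copyProg d) .skip

/-- The integer coordinates of the grid points next to the vertices of a curve. -/
noncomputable def gridDigit {k d : ℕ} (q : Fin k → EuclideanSpace ℝ (Fin d)) (o : ℕ → ℝ) (s : ℝ)
    (a : ℕ) : ℤ :=
  ⌊(coords q a - o (a % d)) / s⌋

/-- Positional notation by induction on the number of digits: the leading term is a multiple of `M ^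
(a + 1)` for every lower position `a`, hence invisible to that digit, and the remaining sum is too
small to affect the leading digit. -/
theorem sum_digits {M : ℕ} {e : ℕ → ℕ} {K : ℕ} (he : ∀ a < K, e a < M) :
    ∑ a ∈ Finset.range K, e a * M ^ a < M ^ K ∧
      ∀ a < K, (∑ a ∈ Finset.range K, e a * M ^ a) / M ^ a % M = e a := by
  induction K with
  | zero => simp
  | succ K ih =>
    obtain ⟨h1, h2⟩ := ih fun a ha => he a (by omega)
    have hM : 0 < M := (Nat.zero_le _).trans_lt (he K (by omega))
    rw [Finset.sum_range_succ]
    generalize ∑ a ∈ Finset.range K, e a * M ^ a = g at *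
    have h3 := he K (by omega)
    refine ⟨?_, fun a ha => ?_⟩
    · calc g + e K * M ^ K < M ^ K + e K * M ^ K := by omega
        _ = (e K + 1) * M ^ K := by ring
        _ ≤ M * M ^ K := Nat.mul_le_mul_right _ h3
        _ = M ^ (K + 1) := by ring
    · rcases Nat.lt_succ_iff_lt_or_eq.1 ha with ha | rfl
      · obtain ⟨b, rfl⟩ : ∃ b, K = a + 1 + b := Nat.exists_eq_add_of_lt ha |>.imp fun b hb => by omega
        have : e (a + 1 + b) * M ^ (a + 1 + b) = M ^ a * (M * (e (a + 1 + b) * M ^ b)) := by ring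
        rw [this, Nat.add_mul_div_left _ _ (Nat.pow_pos hM), Nat.add_mul_mod_self_left, h2 a ha]
      · rw [Nat.add_mul_div_right _ _ (Nat.pow_pos hM), Nat.div_eq_of_lt h1, zero_add,
          Nat.mod_eq_of_lt h3]

section

variable {n k d : ℕ} {p : Fin n → EuclideanSpace ℝ (Fin d)} {ρ s : ℝ} {o : ℕ → ℝ}
  {q : Fin k → EuclideanSpace ℝ (Fin d)} {M G : ℕ} {S : Store} {m : Memory}

-- The variable `cnt` is a flag that drops to 0 at the first digit out of range and never recovers.
-- The number `idx` is accumulated in any case, but is the number of a grid curve only if the flag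
-- is still 1.
open Classical in
theorem within_locateProg (h : S.HoldsGrid p k ρ o s M G) (hd : 1 ≤ d) :
    (locateProg d).Within (queryStart S q) (k * d * 100 + 50) fun m' =>
      m' .ds = S ∧ m' .out = Store.empty ∧
      m'.I .num = ((n * k : ℕ) : ℤ) ∧
      m'.I .cnt = (if ∀ a < k * d, 0 ≤ gridDigit q o s a ∧ gridDigit q o s a < M then 1 else 0) ∧
      m'.I .idx = ∑ a ∈ Finset.range (k * d), gridDigit q o s a * (M : ℤ) ^ a := by
  set P0 := IVar.base.set (.litI 1) ;; IVar.cnt.set (.litI 1) ;; IVar.idx.set (.litI 0) ;;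
    IVar.side.set (.getI .ds (.litI 0)) ;; IVar.num.set (.getI .ds (.litI 1)) with hP0
  have first : P0.Within (queryStart S q) 20 fun m' => m' .inp = queryStart S q .inp ∧
      m' .ds = S ∧ m' .out = Store.empty ∧ m'.I .num = ((n * k : ℕ) : ℤ) ∧ m'.I .side = (M : ℤ) ∧
      m'.I .cnt = 1 ∧ m'.I .idx = 0 ∧ m'.I .base = 1 := by
    refine (Program.LoopFree.within (P := P0) (by simp [hP0])
      (Q := fun m' => m' .inp = queryStart S q .inp ∧ _) ?_).mono (by decide) fun _ h => h
    simp [hP0, queryStart, h.side, h.num]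
  obtain ⟨t₁, m₁, r₁, ht₁, inp₁, ds₁, out₁, num₁, side₁, cnt₁, idx₁, base₁⟩ := first
  have second : (Program.forLoop .pos (.mulI (.getI .inp (.litI 0)) (.litI d))
    (IVar.quo.set (.floor (.divR (.subR (.getR .inp IVar.pos.e)
        (.getR .ds (.addI (.litI 1) (.mod IVar.pos.e (.litI d))))) (.getR .ds (.litI 0)))) ;;
      .branch (.leI (.litI 0) IVar.quo.e)
        (.branch (.ltI IVar.quo.e IVar.side.e) .skip (IVar.cnt.set (.litI 0)))
        (IVar.cnt.set (.litI 0)) ;;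
      IVar.idx.set (.addI IVar.idx.e (.mulI IVar.quo.e IVar.base.e)) ;;
      IVar.base.set (.mulI IVar.base.e IVar.side.e))).Within m₁ (k * d * (60 + 4 + 9) + 4 + 6)
      fun m' => m' .ds = S ∧ m' .out = Store.empty ∧ m'.I .num = ((n * k : ℕ) : ℤ) ∧
      m'.I .cnt = (if ∀ a < k * d, 0 ≤ gridDigit q o s a ∧ gridDigit q o s a < M then 1 else 0) ∧
      m'.I .idx = ∑ a ∈ Finset.range (k * d), gridDigit q o s a * (M : ℤ) ^ a := by
    refine (Program.Within.forLoop (c := 60) (K := k * d)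
      (fun a m' => m'.I .pos = (a : ℤ) ∧ m' .inp = queryStart S q .inp ∧ m'.I .side = (M : ℤ) ∧
        m'.I .base = (M : ℤ) ^ a ∧
        m' .ds = S ∧ m' .out = Store.empty ∧ m'.I .num = ((n * k : ℕ) : ℤ) ∧
        m'.I .cnt = (if ∀ b < a, 0 ≤ gridDigit q o s b ∧ gridDigit q o s b < M then 1 else 0) ∧
        m'.I .idx = ∑ b ∈ Finset.range a, gridDigit q o s b * (M : ℤ) ^ b)
      (fun a m' h' => ?_) (fun a m' h' => h'.1) ?_ ?_).mono le_rfl fun m' h' => h'.2.2.2.2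
    · simp [h'.2.1, queryStart]
    · simp [inp₁, ds₁, out₁, num₁, side₁, cnt₁, idx₁, base₁]
    · rintro a ha m' ⟨pos, inp, side, base, ds, out, num, cnt, idx⟩
      refine (Program.LoopFree.within (by simp) (Q := fun m' => m'.I .pos = (a : ℤ) ∧ _) ?_).mono
        ?_ fun _ h => h
      · have e1 : Exp.eval m' (.floor (.divR (.subR (.getR .inp IVar.pos.e)
            (.getR .ds (.addI (.litI 1) (.mod IVar.pos.e (.litI d))))) (.getR .ds (.litI 0)))) =
            gridDigit q o s a := by
          have e2 : Exp.eval m' (.addI (.litI 1) (.mod IVar.pos.e (.litI d))) =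
              ((1 + a % d : ℕ) : ℤ) := by
            simp only [Exp.eval_addI, Exp.eval_mod (m := m') (x := IVar.pos.e) (y := .litI d)
              (a := a) (b := d) pos rfl, Exp.eval_litI]
            push_cast
            rfl
          simp only [Exp.eval_floor, Exp.eval_divR, Exp.eval_subR, Exp.eval_getR, e2,
            Exp.eval_ivar, pos, Int.toNat_natCast, Exp.eval_litI, Int.toNat_zero, ds, h.step,
            h.offset _ (Nat.mod_lt a hd), inp]
          rfl
        have e3 : (Program.branch (.leI (.litI 0) IVar.quo.e)
            (.branch (.ltI IVar.quo.e IVar.side.e) .skip (IVar.cnt.set (.litI 0)))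
            (IVar.cnt.set (.litI 0))).den (m'.putI .quo (gridDigit q o s a)) =
            if 0 ≤ gridDigit q o s a ∧ gridDigit q o s a < M then
              m'.putI .quo (gridDigit q o s a)
            else (m'.putI .quo (gridDigit q o s a)).putI .cnt 0 := by
          simp only [Program.den_branch, Test.holds_leI, Test.holds_ltI, Exp.eval_litI,
            Exp.eval_ivar, Memory.I_putI, side, if_true, reduceCtorEq, if_false, Program.den_skip,
            Program.den_setI]
          split_ifs <;> first | rfl | (exfalso; tauto)
        simp only [Program.den_seq, Program.den_setI, e1, e3, Exp.eval_addI, Exp.eval_mulI,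
          Exp.eval_ivar]
        have hsucc : (∀ b < a + 1, 0 ≤ gridDigit q o s b ∧ gridDigit q o s b < M) ↔
            (∀ b < a, 0 ≤ gridDigit q o s b ∧ gridDigit q o s b < M) ∧
              0 ≤ gridDigit q o s a ∧ gridDigit q o s a < M := by
          refine ⟨fun h => ⟨fun b hb => h b (by omega), h a (by omega)⟩, fun h b hb => ?_⟩
          rcases Nat.lt_succ_iff_lt_or_eq.1 hb with hb | rfl
          · exact h.1 b hb
          · exact h.2
        simp only [hsucc, Finset.sum_range_succ]
        by_cases hc : 0 ≤ gridDigit q o s a ∧ gridDigit q o s a < M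
        · simp only [hc, and_self, if_true, and_true]
          simp [pos, inp, side, base, ds, out, num, cnt, idx, pow_succ]
        · simp only [hc, if_false, and_false]
          simp [pos, inp, side, base, ds, out, num, idx, pow_succ]
      · simp only [Program.cost, Test.cost, IVar.set, IVar.e, Exp.mod, Exp.cost]
        omega
  obtain ⟨t₂, m₂, r₂, ht₂, h₂⟩ := second
  exact ⟨_, m₂, .seq r₁ r₂, by omega, h₂⟩

theorem within_copyProg {g N r : ℕ} (hidx : m.I .idx = (g : ℤ)) (hnum : m.I .num = (N : ℤ))
    (hr : ((m .ds).part d N g).int 0 = (r : ℤ)) :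
    (copyProg d).Within m (r * 100 + 50) fun m' => (m' .out).int 0 = (r : ℤ) ∧ ∀ j < r,
      (m' .out).int (j + 1) = ((m .ds).part d N g).int (j + 1) ∧
      (m' .out).real (2 * j) = ((m .ds).part d N g).real (2 * j) ∧
      (m' .out).real (2 * j + 1) = ((m .ds).part d N g).real (2 * j + 1) := by
  have first : (IVar.lft.set (.getI .ds (intCellE (.litI 0))) ;;
      .setI .out (.litI 0) IVar.lft.e).Within m 30 fun m' =>
      m' = (m.putI .lft r).writeI .out 0 r := by
    refine (Program.LoopFree.within (P := IVar.lft.set (.getI .ds (intCellE (.litI 0))) ;;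
      .setI .out (.litI 0) IVar.lft.e) (by simp)
      (Q := fun m' => m' = (m.putI .lft r).writeI .out 0 r) ?_).mono (by decide) fun _ h => h
    have : (m .ds).int (intBase N g) = (r : ℤ) := hr
    simp only [Program.den_seq, Program.den_setI, Exp.eval_getI,
      eval_intCellE hidx hnum (a := .litI 0) (i := 0) rfl, add_zero, Int.toNat_natCast, this,
      Program.den_writeI, Exp.eval_litI, Int.toNat_zero, Exp.eval_ivar, Memory.I_putI, if_true]
  obtain ⟨t₁, m₁, r₁, ht₁, hm₁⟩ := first
  have second : (Program.forLoop .pos IVar.lft.e (copyRecordProg d)).Within m₁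
      (r * (80 + 2 + 9) + 2 + 6) fun m' => (m' .out).int 0 = (r : ℤ) ∧ ∀ j < r,
      (m' .out).int (j + 1) = ((m .ds).part d N g).int (j + 1) ∧
      (m' .out).real (2 * j) = ((m .ds).part d N g).real (2 * j) ∧
      (m' .out).real (2 * j + 1) = ((m .ds).part d N g).real (2 * j + 1) := by
    refine (Program.Within.forLoop (N := IVar.lft.e) (c := 80) (K := r)
      (fun a m' => m'.I .pos = (a : ℤ) ∧ m'.I .lft = (r : ℤ) ∧ m'.I .idx = (g : ℤ) ∧
        m'.I .num = (N : ℤ) ∧ m' .ds = m .ds ∧ (m' .out).int 0 = (r : ℤ) ∧ ∀ j < a,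
        (m' .out).int (j + 1) = ((m .ds).part d N g).int (j + 1) ∧
        (m' .out).real (2 * j) = ((m .ds).part d N g).real (2 * j) ∧
        (m' .out).real (2 * j + 1) = ((m .ds).part d N g).real (2 * j + 1))
      (fun a m' h' => h'.2.1) (fun a m' h' => h'.1) ?_ ?_).mono le_rfl fun m' h' => h'.2.2.2.2.2
    · simp [hm₁, hidx, hnum]
    · rintro a ha m' ⟨pos, lft, idx, num, ds, out, H⟩
      refine (Program.LoopFree.within (by simp [copyRecordProg])
        (Q := fun m' => m'.I .pos = (a : ℤ) ∧ _) ?_).mono ?_ fun _ h => h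
      · have a1 : ∀ m'' : Memory, m''.I .pos = m'.I .pos →
            Exp.eval m'' (.addI IVar.pos.e (.litI 1)) = ((a + 1 : ℕ) : ℤ) := by
          intro m'' h
          simp [h, pos]
        have a2 : ∀ m'' : Memory, m''.I .pos = m'.I .pos →
            Exp.eval m'' (.mulI (.litI 2) IVar.pos.e) = ((2 * a : ℕ) : ℤ) := by
          intro m'' h
          simp [h, pos]
        have a3 : ∀ m'' : Memory, m''.I .pos = m'.I .pos →
            Exp.eval m'' (.addI (.mulI (.litI 2) IVar.pos.e) (.litI 1)) =
              ((2 * a + 1 : ℕ) : ℤ) := by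
          intro m'' h
          simp [h, pos]
        have hden : (copyRecordProg d).den m' =
            ((m'.writeI .out (a + 1) (((m .ds).part d N g).int (a + 1))).writeR .out (2 * a)
              (((m .ds).part d N g).real (2 * a))).writeR .out (2 * a + 1)
              (((m .ds).part d N g).real (2 * a + 1)) := by
          simp only [copyRecordProg, Program.den_seq, Program.den_writeI, Program.den_writeR,
            Exp.eval_getI, Exp.eval_getR, eval_intCellE idx num (a1 _ rfl)]
          rw [eval_realCellE (g := g) (N := N) (by simpa using idx) (by simpa using num)
            (a2 _ (by simp)), eval_realCellE (g := g) (N := N) (by simpa using idx)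
            (by simpa using num) (a3 _ (by simp)), a1 _ rfl, a2 _ (by simp), a3 _ (by simp)]
          simp only [Int.toNat_natCast, Memory.writeI_out_ds, Memory.writeR_out_ds, ds]
          rfl
        rw [hden]
        refine ⟨by simp [pos], by simp, by simp [lft], by simp [idx], by simp [num],
          by simp [ds], by simp [out], fun j hj => ?_⟩
        simp only [Memory.putI_out, Memory.writeR_same_int, Memory.writeI_same_int,
          Memory.writeR_same_real, Memory.writeI_same_real, Function.update_apply]
        rcases Nat.lt_succ_iff_lt_or_eq.1 hj with hj | rfl
        · obtain ⟨b1, b2, b3⟩ := H j hj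
          rw [if_neg (by omega), if_neg (by omega), if_neg (by omega), if_neg (by omega),
            if_neg (by omega)]
          exact ⟨b1, b2, b3⟩
        · simp
      · simp only [Program.cost, copyRecordProg, intCellE, realCellE, IVar.e, Exp.cost]
        omega
  obtain ⟨t₂, m₂, r₂, ht₂, h₂⟩ := second
  exact ⟨_, m₂, .seq r₁ r₂, by omega, h₂⟩

/-- A query either finds a digit that is out of range, or reports the records of the grid curve
with the given digits. -/
theorem ends_queryProg (h : S.HoldsGrid p k ρ o s M (M ^ (k * d))) (hd : 1 ≤ d) (hk : 1 ≤ k) :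
    (queryProg d).Ends (queryStart S q) fun t m' => ∃ r, t ≤ (100 * d + 200) * (k + r) ∧
      (m' .out).int 0 = (r : ℤ) ∧
      ((r = 0 ∧ ∃ a < k * d, ¬ (0 ≤ gridDigit q o s a ∧ gridDigit q o s a < M)) ∨
        ∃ g, (∀ a < k * d, ((g / M ^ a % M : ℕ) : ℤ) = gridDigit q o s a) ∧
          ∃ A B a b, (m' .out).HoldsRecords r A B ∧
            IsStream (Feasible p (gridCurve k d o s M g) ρ) (n * k) a b ∧
            IsFront (Feasible p (gridCurve k d o s M g) ρ) a b (n * k) r A B) := by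
  classical
  obtain ⟨t₁, m₁, r₁, ht₁, ds₁, out₁, num₁, cnt₁, idx₁⟩ := within_locateProg (q := q) h hd
  have htime : ∀ t r : ℕ, t ≤ r * 100 + 100 → t₁ + t ≤ (100 * d + 200) * (k + r) := by
    intro t r ht
    have : k * d * 100 + 150 ≤ (100 * d + 200) * k := by nlinarith
    nlinarith
  by_cases hc : ∀ a < k * d, 0 ≤ gridDigit q o s a ∧ gridDigit q o s a < M
  · rw [if_pos hc] at cnt₁
    have hdig : ∀ a < k * d, ((gridDigit q o s a).toNat : ℤ) = gridDigit q o s a := fun a ha =>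
      Int.toNat_of_nonneg (hc a ha).1
    obtain ⟨s1, s2⟩ := sum_digits (M := M) (e := fun a => (gridDigit q o s a).toNat) (K := k * d)
      fun a ha => by
        have := (hc a ha).2
        have := hdig a ha
        omega
    set g := ∑ a ∈ Finset.range (k * d), (gridDigit q o s a).toNat * M ^ a with hg
    have hidx : m₁.I .idx = (g : ℤ) := by
      rw [idx₁, hg]
      push_cast
      refine Finset.sum_congr rfl fun a ha => ?_
      rw [← hdig a (Finset.mem_range.1 ha)]
      simp
    obtain ⟨r, hr, A, B, a, b, e1, ⟨f1, f2, f3⟩, e3, e4⟩ := h.records g s1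
    rw [← ds₁] at e1 f1 f2 f3
    obtain ⟨t₂, m₂, r₂, ht₂, h0, h₂⟩ := within_copyProg hidx num₁ e1
    refine ⟨_, m₂, .seq r₁ (.branch_true ?_ r₂), r, ?_, h0, .inr ⟨g, fun a ha => ?_, A, B, a, b,
      ⟨fun j hj => ?_, fun j hj => ?_, fun j hj => ?_⟩, e3, e4⟩⟩
    · simp [cnt₁]
    · have : (Test.leI (.litI 1) IVar.cnt.e).cost ≤ 10 := by decide
      exact htime _ _ (by omega)
    · rw [s2 a ha, hdig a ha]
    · rw [(h₂ j hj).1, f1 j hj]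
    · rw [(h₂ j hj).2.1, f2 j hj]
    · rw [(h₂ j hj).2.2, f3 j hj]
  · rw [if_neg hc] at cnt₁
    push Not at hc
    obtain ⟨a, ha, hna⟩ := hc
    refine ⟨_, m₁, .seq r₁ (.branch_false ?_ (.skip _)), 0, ?_, by simp [out₁, Store.empty],
      .inl ⟨rfl, a, ha, by simpa using hna⟩⟩
    · simp [cnt₁]
    · have : (Test.leI (.litI 1) IVar.cnt.e).cost ≤ 10 := by decide
      exact htime _ _ (by omega)

end

/-! ### Correctness of the answers -/

section

variable {n k d : ℕ} {p : Fin n → EuclideanSpace ℝ (Fin d)} {q c : Fin k → EuclideanSpace ℝ (Fin d)}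
  {L δ ε ρ η s : ℝ}

theorem coords_of_lt (p : Fin n → EuclideanSpace ℝ (Fin d)) {l : ℕ} (hl : l < d) :
    coords p l = vertex p 0 ⟨l, hl⟩ := by
  rw [← coords_mul_add p 0 l hl, zero_mul, zero_add]

theorem mul_add_lt {i l : ℕ} (hi : i < n) (hl : l < d) : i * d + l < n * d := by
  calc i * d + l < i * d + d := by omega
    _ = (i + 1) * d := by ring
    _ ≤ n * d := Nat.mul_le_mul_right _ hi

theorem IsSpread.abs_vertex_sub_le (h : IsSpread p (n * d) L) {i l : ℕ} (hi : i < n) (hl : l < d) :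
    |vertex p i ⟨l, hl⟩ - coords p l| ≤ L := by
  have := h.le _ (mul_add_lt hi hl)
  rwa [Nat.mul_add_mod', Nat.mod_eq_of_lt hl, coords_mul_add p i l hl] at this

/-- The spread is 0 or a coordinate of a difference of two vertices, and a coordinate is bounded by
the norm. -/
theorem IsSpread.le_diam (h : IsSpread p (n * d) L) (hd : 1 ≤ d) :
    L ≤ Metric.diam (Set.range p) := by
  rcases h.eq with h0 | ⟨a, ha, h1⟩
  · rw [h0]
    exact Metric.diam_nonneg
  · have hi : a / d < n := Nat.div_lt_of_lt_mul (by rwa [mul_comm])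
    have hl : a % d < d := Nat.mod_lt _ hd
    have e : coords p a = vertex p (a / d) ⟨a % d, hl⟩ := by
      rw [← coords_mul_add p _ _ hl, mul_comm, Nat.div_add_mod]
    rw [h1, coords_of_lt p hl, e]
    have h0 : 0 < n := (Nat.zero_le _).trans_lt hi
    have hb : Bornology.IsBounded (Set.range p) := (Set.finite_range p).isBounded
    calc |vertex p (a / d) ⟨a % d, hl⟩ - vertex p 0 ⟨a % d, hl⟩|
        = ‖(vertex p (a / d) - vertex p 0) ⟨a % d, hl⟩‖ := rfl
      _ ≤ ‖vertex p (a / d) - vertex p 0‖ := PiLp.norm_apply_le _ _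
      _ = dist (p ⟨a / d, hi⟩) (p ⟨0, h0⟩) := by
        rw [dist_eq_norm, vertex, vertex, dif_pos hi, dif_pos h0]
      _ ≤ _ := Metric.dist_le_diam_of_mem hb (Set.mem_range_self _) (Set.mem_range_self _)

theorem IsSpread.abs_curve_sub_le (h : IsSpread p (n * d) L) {x : ℝ} (h0 : 0 ≤ x)
    (h1 : x ≤ (n : ℝ) - 1) {l : ℕ} (hl : l < d) : |curve p x ⟨l, hl⟩ - coords p l| ≤ L := by
  have hi : ⌊x⌋₊ < n := by
    have := Nat.floor_le h0
    have : (⌊x⌋₊ : ℝ) < n := by linarith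
    exact_mod_cast this
  -- At the right end the vertex after `⌊x⌋₊` is only the default value 0, which the spread does not
  -- control; there `x` is itself an integer.
  rcases Nat.lt_or_ge (⌊x⌋₊ + 1) n with hi' | hi'
  · obtain ⟨y, hy⟩ : ∃ y, x = ⌊x⌋₊ + y := ⟨x - ⌊x⌋₊, by ring⟩
    have y0 : 0 ≤ y := by linarith [Nat.floor_le h0]
    have y1 : y ≤ 1 := by linarith [Nat.lt_floor_add_one x]
    rw [hy, curve_natCast_add p _ y0 y1]
    have a1 := abs_le.1 (h.abs_vertex_sub_le hi hl)
    have a2 := abs_le.1 (h.abs_vertex_sub_le hi' hl)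
    simp only [PiLp.add_apply, PiLp.smul_apply, smul_eq_mul]
    rw [abs_le]
    constructor <;> nlinarith
  · have hx : x = ⌊x⌋₊ := by
      have h2 := Nat.floor_le h0
      have h3 : (n : ℝ) ≤ ⌊x⌋₊ + 1 := by exact_mod_cast hi'
      linarith
    rw [hx, curve_natCast]
    exact h.abs_vertex_sub_le hi hl

theorem norm_curve_sub_le (h : ∀ j, ‖vertex c j - vertex q j‖ ≤ η) (t : ℝ) :
    ‖curve c t - curve q t‖ ≤ η := by
  have e : curve c t - curve q t =
      (1 - Int.fract t) • (vertex c ⌊t⌋₊ - vertex q ⌊t⌋₊) +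
        Int.fract t • (vertex c (⌊t⌋₊ + 1) - vertex q (⌊t⌋₊ + 1)) := by
    simp only [curve, smul_sub]
    abel
  have f0 := Int.fract_nonneg t
  have f1 := (Int.fract_lt_one t).le
  rw [e]
  refine (norm_add_le _ _).trans ?_
  rw [norm_smul, norm_smul, Real.norm_of_nonneg f0, Real.norm_of_nonneg (sub_nonneg.2 f1)]
  nlinarith [h ⌊t⌋₊, h (⌊t⌋₊ + 1)]

theorem polyFrechet_le (hk : 1 ≤ k) (h : ∀ j, ‖vertex c j - vertex q j‖ ≤ η) :
    polyFrechet c q ≤ η := by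
  have hk' : (0 : ℝ) ≤ (k : ℝ) - 1 := by
    have : (1 : ℝ) ≤ k := by exact_mod_cast hk
    linarith
  have hm : Monotone fun t : ℝ => t * ((k : ℝ) - 1) := fun x y hxy =>
    mul_le_mul_of_nonneg_right hxy hk'
  have hc : Continuous fun t : ℝ => t * ((k : ℝ) - 1) := by fun_prop
  refine csInf_le ⟨0, ?_⟩ ⟨fun t => t * ((k : ℝ) - 1), fun t => t * ((k : ℝ) - 1),
    hc.continuousOn, hm.monotoneOn _, by simp, by simp, hc.continuousOn, hm.monotoneOn _,
    by simp, by simp, fun t _ => norm_curve_sub_le h _⟩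
  rintro r ⟨σ, θ, -, -, -, -, -, -, -, -, hr⟩
  exact (norm_nonneg _).trans (hr 0 (by simp))

theorem Free.of_norm_sub_le {x t : ℝ} (hF : Free p c ρ x t)
    (h : ∀ j, ‖vertex c j - vertex q j‖ ≤ η) : Free p q (ρ + η) x t := by
  have h1 := norm_curve_sub_le h t
  calc ‖curve p x - curve q t‖ = ‖(curve p x - curve c t) + (curve c t - curve q t)‖ := by
        rw [sub_add_sub_cancel]
    _ ≤ ρ + η := (norm_add_le _ _).trans (add_le_add hF h1)

/-- Rounding down changes each coordinate by less than one mesh width. The indices `j ≥ k` are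
harmless, because both vertices are then the default 0. -/
theorem norm_vertex_gridCurve_sub_le {o : ℕ → ℝ} {M g : ℕ} (hs : 0 < s)
    (hg : ∀ a < k * d, ((g / M ^ a % M : ℕ) : ℤ) = gridDigit q o s a) (j : ℕ) :
    ‖vertex (gridCurve k d o s M g) j - vertex q j‖ ≤ d * s := by
  by_cases hj : j < k
  · have hv : ∀ (l : ℕ) (hl : l < d),
        |(vertex (gridCurve k d o s M g) j - vertex q j) ⟨l, hl⟩| ≤ s := by
      intro l hl
      have h1 := hg _ (mul_add_lt hj hl)
      have h2 : ((g / M ^ (j * d + l) % M : ℕ) : ℝ) = (gridDigit q o s (j * d + l) : ℝ) := by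
        rw [← h1, Int.cast_natCast]
      rw [gridDigit, Nat.mul_add_mod', Nat.mod_eq_of_lt hl, coords_mul_add q j l hl] at h2
      set x := vertex q j ⟨l, hl⟩
      have h3 := Int.floor_le ((x - o l) / s)
      have h4 := Int.lt_floor_add_one ((x - o l) / s)
      rw [← h2] at h3 h4
      rw [le_div_iff₀ hs] at h3
      rw [div_lt_iff₀ hs] at h4
      rw [PiLp.sub_apply, vertex_gridCurve hj hl, abs_le]
      constructor <;> nlinarith
    rw [norm_le_iff_sum_range _ (f := fun l => if h : l < d then
      (vertex (gridCurve k d o s M g) j - vertex q j) ⟨l, h⟩ else 0)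
      (fun l hl => by rw [dif_pos hl]) (by positivity)]
    calc _ ≤ ∑ l ∈ Finset.range d, s ^ 2 := by
          refine Finset.sum_le_sum fun l hl => ?_
          rw [dif_pos (Finset.mem_range.1 hl)]
          exact sq_le_sq' (abs_le.1 (hv l _)).1 (abs_le.1 (hv l _)).2
      _ = d * s ^ 2 := by simp
      -- The bound √d · s is relaxed to d · s, which equals εδ/2 for the mesh εδ/(2d).
      _ ≤ (d : ℝ) ^ 2 * s ^ 2 := by
        refine mul_le_mul_of_nonneg_right ?_ (sq_nonneg _)
        exact_mod_cast Nat.le_self_pow two_ne_zero d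
      _ = _ := by ring
  · rw [vertex, vertex, dif_neg hj, dif_neg hj, sub_zero, norm_zero]
    positivity

/-- If a digit of a curve is out of range, then no subcurve is close to the curve. -/
theorem not_feasible (h : IsSpread p (n * d) L) (hd : 1 ≤ d) (hε : 0 < ε) (hδ : 0 < δ)
    (hρ : ρ < 2 * δ) {a : ℕ} (ha : a < k * d)
    (hr : ¬ (0 ≤ gridDigit q (fun l => coords p l - (L + 2 * δ)) (ε * δ / (2 * d)) a ∧
      gridDigit q (fun l => coords p l - (L + 2 * δ)) (ε * δ / (2 * d)) a < gridSide d L δ ε))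
    (u v : ℝ) : ¬ Feasible p q ρ u v := by
  rintro ⟨⟨h0, -, h1⟩, h2⟩
  refine hr ?_
  have hl : a % d < d := Nat.mod_lt _ hd
  have hj : a / d < k := Nat.div_lt_of_lt_mul (by rwa [mul_comm])
  have hd' : (0 : ℝ) < d := by exact_mod_cast hd
  -- The path passes the height of vertex `a / d` of `q`, so some point of `p` lies within `ρ < 2δ`
  -- of this vertex. Its coordinates deviate by at most `L` from those of the first vertex, so the
  -- digit is in range.
  obtain ⟨x, x1, x2, x3, -⟩ := h2.split_snd (y := (a / d : ℕ)) (Nat.cast_nonneg _)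
    (by exact_mod_cast Nat.le_sub_one_of_lt hj)
  have hF : ‖curve p x - curve q (a / d : ℕ)‖ ≤ ρ := x3.right
  rw [curve_natCast] at hF
  have c1 := (PiLp.norm_apply_le (curve p x - vertex q (a / d)) ⟨a % d, hl⟩).trans hF
  rw [PiLp.sub_apply, Real.norm_eq_abs] at c1
  have c2 := abs_le.1 (h.abs_curve_sub_le (h0.trans x1) (x2.trans h1) hl)
  have c3 := abs_le.1 c1
  have hs : 0 < ε * δ / (2 * d) := by positivity
  have e : coords q a = vertex q (a / d) ⟨a % d, hl⟩ := by
    rw [← coords_mul_add q _ _ hl, mul_comm, Nat.div_add_mod]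
  rw [gridSide_cast hδ hε h.nonneg, gridDigit, e]
  constructor
  · refine Int.floor_nonneg.2 (div_nonneg ?_ hs.le)
    linarith
  · refine Int.lt_add_one_iff.2 (Int.floor_le_floor ?_)
    refine div_le_div_of_nonneg_right ?_ hs.le
    linarith

theorem isInclusionMinimal_iff (hk : 1 ≤ k) (x : ℝ × ℝ) :
    IsInclusionMinimal p c ρ x ↔ Feasible p c ρ x.1 x.2 ∧
      ∀ y : ℝ × ℝ, Feasible p c ρ y.1 y.2 → x.1 ≤ y.1 → y.2 ≤ x.2 → y = x := by
  unfold IsInclusionMinimal Feasible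
  constructor
  · rintro ⟨h1, h2, h3⟩
    refine ⟨⟨h1, (subFrechet_le_iff h1 hk).1 h2⟩, ?_⟩
    rintro y ⟨h4, h5⟩ h6 h7
    exact h3 y h4 h6 h7 ((subFrechet_le_iff h4 hk).2 h5)
  · rintro ⟨⟨h1, h2⟩, h3⟩
    refine ⟨h1, (subFrechet_le_iff h1 hk).2 h2, ?_⟩
    intro y h4 h6 h7 h5
    exact h3 y ⟨h4, (subFrechet_le_iff h4 hk).1 h5⟩ h6 h7

/-- Closeness of the vertices bounds the distance between points of `c` and `q` at equal parameters.
So a path in one free space is a path in the other after the radius grows by εδ/2: from δ to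
(1+ε/2)δ for completeness, and from there to (1+ε)δ for soundness. -/
theorem isASRSAnswer_of_close (hk : 1 ≤ k)
    (hc : ∀ j, ‖vertex c j - vertex q j‖ ≤ ε * δ / 2)
    (hex : ∀ u v, Feasible p c ((1 + ε / 2) * δ) u v → ∃ x : ℝ × ℝ,
      IsInclusionMinimal p c ((1 + ε / 2) * δ) x ∧ u ≤ x.1 ∧ x.2 ≤ v) :
    IsASRSAnswer p δ ε q {x | IsInclusionMinimal p c ((1 + ε / 2) * δ) x} := by
  refine ⟨?_, ?_, c, polyFrechet_le hk hc, rfl⟩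
  · rintro x ⟨h1, h2, -⟩
    refine ⟨h1, (subFrechet_le_iff h1 hk).2 ?_⟩
    refine ((subFrechet_le_iff h1 hk).1 h2).mono fun y z _ _ _ _ hF => ?_
    have := hF.of_norm_sub_le hc
    rwa [show (1 + ε / 2) * δ + ε * δ / 2 = (1 + ε) * δ by ring] at this
  · intro y h1 h2
    obtain ⟨x, h3, h4⟩ := hex y.1 y.2 ⟨h1, ((subFrechet_le_iff h1 hk).1 h2).mono
      fun y z _ _ _ _ hF => by
        have := hF.of_norm_sub_le (q := c) (η := ε * δ / 2) fun j => by
          rw [norm_sub_rev]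
          exact hc j
        rwa [show δ + ε * δ / 2 = (1 + ε / 2) * δ by ring] at this⟩
    exact ⟨x, h3, h4⟩

theorem ends_queryProg_answer {S : Store} (h : IsSpread p (n * d) L)
    (hS : S.HoldsGrid p k ((1 + ε / 2) * δ) (fun l => coords p l - (L + 2 * δ))
      (ε * δ / (2 * d)) (gridSide d L δ ε) (gridSide d L δ ε ^ (k * d)))
    (hd : 1 ≤ d) (hk : 1 ≤ k) (hε : 0 < ε) (hε1 : ε ≤ 1) (hδ : 0 < δ)
    (q : Fin k → EuclideanSpace ℝ (Fin d)) :
    (queryProg d).Ends (queryStart S q) fun t m' => ∃ r R, t ≤ (100 * d + 200) * (k + r) ∧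
      (m' .out).Reports r R ∧ IsASRSAnswer p δ ε q R := by
  have hd' : (0 : ℝ) < d := by exact_mod_cast hd
  refine (ends_queryProg hS hd hk).mono ?_
  rintro t m' ⟨r, ht, h0, ⟨rfl, a, ha, hr⟩ | ⟨g, hg, A, B, a, b, h1, h2, h3⟩⟩
  -- Here `ε ≤ 1` enters: the radius (1+ε/2)δ must stay below the margin 2δ of the grid.
  · have hno := not_feasible h hd hε hδ (ρ := (1 + ε / 2) * δ) (by nlinarith) ha hr
    have hempty : {x | IsInclusionMinimal p q ((1 + ε / 2) * δ) x} = ∅ := by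
      ext x
      simp only [Set.mem_ofPred_eq, Set.mem_empty_iff_false, iff_false,
        isInclusionMinimal_iff hk]
      exact fun h => hno _ _ h.1
    refine ⟨0, ∅, ht, ⟨h0, by omega, by omega, by simp⟩, ?_⟩
    -- Out of range, the query curve itself plays the role of the approximating curve.
    rw [← hempty]
    refine isASRSAnswer_of_close hk (fun j => ?_) fun u v huv => (hno u v huv).elim
    rw [sub_self, norm_zero]
    positivity
  · refine ⟨r, _, ht, h1.reports h0 h2 h3, ?_⟩
    simp only [← isInclusionMinimal_iff hk]
    refine isASRSAnswer_of_close hk (fun j => ?_) fun u v huv => ?_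
    · refine (norm_vertex_gridCurve_sub_le (by positivity) hg j).trans (le_of_eq ?_)
      field_simp
    · obtain ⟨j, hj, x, hx, h4⟩ := h3.exists_mem h2 huv
      exact ⟨x, (isInclusionMinimal_iff hk x).2 ((h3.minimal h2 x).1 ⟨j, hj, hx⟩), h4⟩

end

/-! ### Bounds for time and size -/

section

variable {n k d : ℕ} {p : Fin n → EuclideanSpace ℝ (Fin d)} {L δ ε : ℝ}

/-- The side is at most 4d·L/(εδ) + 8d/ε + 1. As `L` is at most the diameter and `ε ≤ δ`, each of
the three terms is bounded by a multiple of d times the maximum, with factors 4 + 8 + 1 = 13. -/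
theorem gridSide_le (h : IsSpread p (n * d) L) (hd : 1 ≤ d) (hε : 0 < ε) (hε1 : ε ≤ 1)
    (hεδ : ε ≤ δ) : (gridSide d L δ ε : ℝ) ≤
      13 * d * max (1 / ε) (Metric.diam (Set.range p) / ε ^ 2) := by
  have hδ := hε.trans_le hεδ
  have hd' : (1 : ℝ) ≤ d := by exact_mod_cast hd
  have h1 : (gridSide d L δ ε : ℝ) = ⌊2 * (L + 2 * δ) / (ε * δ / (2 * d))⌋ + 1 := by
    have := congrArg (Int.cast (R := ℝ)) (gridSide_cast (d := d) hδ hε h.nonneg)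
    simpa using this
  have h2 := Int.floor_le (2 * (L + 2 * δ) / (ε * δ / (2 * d)))
  have h3 : 2 * (L + 2 * δ) / (ε * δ / (2 * d)) = 4 * d * (L / (ε * δ)) + 8 * d * (1 / ε) := by
    field_simp
    ring
  have h4 : L / (ε * δ) ≤ Metric.diam (Set.range p) / ε ^ 2 := by
    refine div_le_div₀ Metric.diam_nonneg (h.le_diam hd) (by positivity) ?_
    rw [sq]
    exact mul_le_mul_of_nonneg_left hεδ hε.le
  have h5 : 1 ≤ 1 / ε := by rwa [le_div_iff₀ hε, one_mul]
  have h6 := le_max_left (1 / ε) (Metric.diam (Set.range p) / ε ^ 2)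
  have h7 := le_max_right (1 / ε) (Metric.diam (Set.range p) / ε ^ 2)
  set X := max (1 / ε) (Metric.diam (Set.range p) / ε ^ 2)
  have h8 : (d : ℝ) * (L / (ε * δ)) ≤ d * X := by gcongr; exact h4.trans h7
  have h9 : (d : ℝ) * (1 / ε) ≤ d * X := by gcongr
  have h10 : 1 ≤ (d : ℝ) * X := one_le_mul_of_one_le_of_one_le hd' (h5.trans h6)
  rw [h3] at h2
  rw [h1, h3]
  linarith

theorem max_pow_eq {x y : ℝ} (hx : 0 ≤ x) (hy : 0 ≤ y) (N : ℕ) :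
    max x y ^ N = max (x ^ N) (y ^ N) := by
  rcases le_total x y with h | h
  · rw [max_eq_right h, max_eq_right (pow_le_pow_left₀ hx h N)]
  · rw [max_eq_left h, max_eq_left (pow_le_pow_left₀ hy h N)]

/-- The number of grid curves, times a multiple of `k`, is bounded by `gridBound`. -/
theorem mul_gridSide_pow_le (h : IsSpread p (n * d) L) (hd : 1 ≤ d) (hk : 1 ≤ k) (hε : 0 < ε)
    (hε1 : ε ≤ 1) (hεδ : ε ≤ δ) {b : ℕ} (hb : 1 ≤ b) :
    (k : ℝ) * (gridSide d L δ ε : ℝ) ^ (k * d) * b ≤ gridBound p k ε ((26 * d * b : ℕ) : ℝ) := by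
  have h1 := pow_le_pow_left₀ (Nat.cast_nonneg _) (gridSide_le h hd hε hε1 hεδ) (k * d)
  rw [mul_pow, max_pow_eq (by positivity) (div_nonneg Metric.diam_nonneg (sq_nonneg _))] at h1
  -- The factors `k` and `b` are absorbed into the `k * d`-th power, which explains the constant 26
  -- · d · b = 2 · b · 13 · d.
  have h2 : k * b ≤ 2 ^ (k * d) * b ^ (k * d) := by
    have hkd : 1 ≤ k * d := Nat.mul_pos hk hd
    refine Nat.mul_le_mul ?_ (Nat.le_self_pow (by omega) b)
    exact Nat.lt_two_pow_self.le.trans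
      (Nat.pow_le_pow_right (by norm_num) (Nat.le_mul_of_pos_right k hd))
  have h3 : (k : ℝ) * b ≤ 2 ^ (k * d) * (b : ℝ) ^ (k * d) := by exact_mod_cast h2
  unfold gridBound
  set Y := max ((1 / ε) ^ (k * d)) ((Metric.diam (Set.range p) / ε ^ 2) ^ (k * d)) with hY
  have hY0 : 0 ≤ Y := le_max_of_le_left (by positivity)
  calc (k : ℝ) * (gridSide d L δ ε : ℝ) ^ (k * d) * b
      = (k * b) * (gridSide d L δ ε : ℝ) ^ (k * d) := by ring
    _ ≤ (2 ^ (k * d) * (b : ℝ) ^ (k * d)) * ((13 * d) ^ (k * d) * Y) :=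
      mul_le_mul h3 h1 (by positivity) (by positivity)
    _ = (2 * b * (13 * d)) ^ (k * d) * Y := by
      rw [← mul_pow, ← mul_assoc, ← mul_pow]
    _ = _ := by push_cast; ring

theorem Store.HoldsGrid.sizeAtMost {ρ s : ℝ} {o : ℕ → ℝ} {M G : ℕ} {S : Store}
    (h : S.HoldsGrid p k ρ o s M G) (hn : 1 ≤ n) (hk : 1 ≤ k) (hG : 1 ≤ G) {N : ℝ}
    (hN : ((n * (k * G * (d + 7)) : ℕ) : ℝ) ≤ N) : S.SizeAtMost N := by
  refine ⟨_, _, h.int_zero, h.real_zero, le_trans ?_ hN⟩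
  have h1 : 1 ≤ n * k := Nat.mul_pos hn hk
  have h2 : G ≤ n * k * G := Nat.le_mul_of_pos_left _ h1
  have h3 := Nat.mul_le_mul_right d (hG.trans h2)
  have : intBase (n * k) G + realBase d (n * k) G ≤ n * (k * G * (d + 7)) := by
    calc _ = 3 + d + G + 3 * (n * k * G) := by unfold intBase realBase; ring
      _ ≤ n * k * G * d + 7 * (n * k * G) := by omega
      _ = _ := by ring
  exact_mod_cast this

end

/-- One constant, 26 · d · `buildCost d`, serves as the base of the power in `gridBound` and as the
factor of the query time. -/
theorem mainTheorem3 (d : ℕ) (hd : 1 ≤ d) :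
    ∃ (C : ℝ) (build query : Program), 0 < C ∧
      ∀ (n k : ℕ) (_ : 1 ≤ n) (_ : 1 ≤ k) (p : Fin n → EuclideanSpace ℝ (Fin d)) (δ ε : ℝ)
        (_ : 0 < ε) (_ : ε ≤ 1) (_ : ε ≤ δ),
        ∃ (T : ℕ) (m : Memory),
          Runs build (constructionStart p k δ ε) T m ∧
          (T : ℝ) ≤ (n : ℝ) * (k : ℝ) * gridBound p k ε C ∧
          (m Bank.ds).SizeAtMost ((n : ℝ) * gridBound p k ε C) ∧
          ∀ q : Fin k → EuclideanSpace ℝ (Fin d),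
            ∃ (t : ℕ) (m' : Memory) (r : ℕ) (R : Set (ℝ × ℝ)),
              Runs query (queryStart (m Bank.ds) q) t m' ∧
              (m' Bank.out).Reports r R ∧
              (t : ℝ) ≤ C * ((k : ℝ) + (r : ℝ)) ∧
              IsASRSAnswer p δ ε q R := by
  have hb : d + 7 ≤ buildCost d := by unfold buildCost; omega
  have hb' : 100 * d + 200 ≤ 26 * d * buildCost d :=
    le_trans (by unfold buildCost; omega) (Nat.le_mul_of_pos_left (buildCost d) (by omega))
  refine ⟨((26 * d * buildCost d : ℕ) : ℝ), buildProg d, queryProg d, Nat.cast_pos.2 (by omega),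
    ?_⟩
  intro n k hn hk p δ ε hε hε1 hεδ
  have hδ := hε.trans_le hεδ
  obtain ⟨L, hL, T, m, hrun, hT, hm⟩ := within_buildProg (p := p) hd hn hk hδ hε
  have hG := mul_gridSide_pow_le hL hd hk hε hε1 hεδ (b := buildCost d) (by omega)
  have hM : 1 ≤ gridSide d L δ ε ^ (k * d) := by
    have h1 := gridSide_cast (d := d) hδ hε hL.nonneg
    have h2 : 0 ≤ ⌊2 * (L + 2 * δ) / (ε * δ / (2 * d))⌋ :=
      Int.floor_nonneg.2 (by have := hL.nonneg; positivity)
    exact Nat.one_le_pow _ _ (by omega)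
  refine ⟨T, m, hrun, ?_, hm.sizeAtMost hn hk hM ?_, fun q => ?_⟩
  -- The construction takes time proportional to nk² for each grid curve; one factor `k` is passed
  -- to `mul_gridSide_pow_le`, the other remains in the bound.
  · calc (T : ℝ) ≤ ((n * k * k * gridSide d L δ ε ^ (k * d) * buildCost d : ℕ) : ℝ) := by
          exact_mod_cast hT
      _ = n * k * (k * (gridSide d L δ ε : ℝ) ^ (k * d) * buildCost d) := by push_cast; ring
      _ ≤ _ := mul_le_mul_of_nonneg_left hG (by positivity)
  · calc ((n * (k * gridSide d L δ ε ^ (k * d) * (d + 7)) : ℕ) : ℝ)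
        ≤ ((n * (k * gridSide d L δ ε ^ (k * d) * buildCost d) : ℕ) : ℝ) := by
          exact_mod_cast Nat.mul_le_mul_left _ (Nat.mul_le_mul_left _ hb)
      _ = n * (k * (gridSide d L δ ε : ℝ) ^ (k * d) * buildCost d) := by push_cast; ring
      _ ≤ _ := mul_le_mul_of_nonneg_left hG (by positivity)
  · obtain ⟨t, m', h1, r, R, h2, h3, h4⟩ := ends_queryProg_answer hL hm hd hk hε hε1 hδ q
    refine ⟨t, m', r, R, h1, h3, ?_, h4⟩
    have : t ≤ 26 * d * buildCost d * (k + r) := h2.trans (Nat.mul_le_mul_right _ hb')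
    exact_mod_cast this
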